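/- For a finite graph $G$, let $\chi_c(G)$ denote its clique chromatic number, i.e., the smallest number of colors in a coloring of the vertices of $G$ such that no inclusion-maximal clique with at least two vertices is monochromatic (so isolated vertices are ignored). Let $G_{n,p}$ denote the binomial random graph on $n$ vertices, in which each of the $\binom{n}{2}$ possible edges is present independently with probability $p$. There is a constant $C \ge 1$ such that, for every edge-probability $p=p(n) \in [0,1]$, with probability tending to $1$ as $n \to \infty$ we have $$\frac{\chi_c(G_{n,p})}{\max\Bigl\{1, \; \frac{e^{-np^2}np}{\log n}, \; \min\Bigl\{\frac{p^{3/2}n}{\sqrt{\log n}}, \; \frac{1}{p}\Bigr\}\Bigr\}} \; \in \; \Bigl[(C\log n)^{-1}, \; C \log n\Bigr],$$ where $\log$ denotes the natural logarithm, and for $p=0$ the inner minimum is read as $0$. -/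

import Mathlib

open Filter Topology

/-- A vertex colouring `c` of `G` is a clique colouring if no inclusion-maximal clique of `G` is
monochromatic, where isolated vertices (the inclusion-maximal cliques with a single vertex) are
ignored. -/
def IsCliqueColoring {V α : Type*} (G : SimpleGraph V) (c : V → α) : Prop :=
  ∀ s : Set V, Maximal G.IsClique s → s.Nontrivial → ¬ ∃ a : α, ∀ v ∈ s, c v = a

/-- The clique chromatic number of a finite graph: the smallest number of colours in a clique
colouring. -/
noncomputable def cliqueChromaticNumber {V : Type*} [Finite V] (G : SimpleGraph V) : ℕ :=
  sInf {k : ℕ | ∃ c : V → Fin k, IsCliqueColoring G c}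

/-- The minimum that defines the clique chromatic number is attained. -/
theorem exists_isCliqueColoring {V : Type*} [Finite V] (G : SimpleGraph V) :
    ∃ c : V → Fin (cliqueChromaticNumber G), IsCliqueColoring G c := by
  have h : {k : ℕ | ∃ c : V → Fin k, IsCliqueColoring G c}.Nonempty := by
    refine ⟨Nat.card V, Finite.equivFin V, ?_⟩
    rintro s - ⟨x, hx, y, hy, hxy⟩ ⟨a, ha⟩
    exact hxy ((Finite.equivFin V).injective ((ha x hx).trans (ha y hy).symm))
  exact Nat.sInf_mem h

open Finset

set_option linter.unusedSectionVars false

/-! ### Expectations over independent Bernoulli bits -/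

section BernoulliExp

variable {α β ι : Type*} [DecidableEq α] [DecidableEq β]

/-! Write `x = n p²` and `L = log n`. Every estimate holds for all large `n` uniformly in `p`, with
failure probability `O(1/n)`, so the behaviour of the function `p(n)` plays no role. Probabilities
are finite weighted sums over edge sets; `binomialRandom_real_eq_bernoulliProb` is the link with the
measure on graphs.

Upper bound. A maximal clique never lies inside the neighbourhood of one vertex, so a total
dominating set of about `L/p` vertices yields a clique colouring: colour each vertex by a neighbour
in that set (`cliqueChromaticNumber_dominating_whp`). For smaller `p` it suffices to avoid
monochromatic triangles and monochromatic edges that lie in no triangle. A counting argument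
(`card_isTriangleColoringOn_le`) shows that `k` colours suffice once `k` is at least 4 times the
number of triangle-free edges at any vertex and `k²` is at least 8 times the number of ordered pairs
forming a triangle with any vertex. Typically the first number is at most of order `max(L, e^{-x}
np)`, and the second is at most of order `(np + L)(x + L)`. This is
`cliqueChromaticNumber_sparse_whp`.

Lower bound. If every set of `s` vertices contains a clique with at least two vertices and no common
neighbour outside the set, then extending that clique inside the set gives a maximal clique, so
colour classes have fewer than `s` vertices and there are more than `n/s` of them
(`card_lt_cliqueChromaticNumber_mul`). A set is presented as `r` parts of `m` vertices, and only
cliques with one vertex in each part are used. The failure probability for one set must beat the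
`n^{rm}` choices of the set. In both regimes the edges leaving the set are revealed first, and the
few outside vertices with unusually many neighbours in the set are treated separately.

With `r = 2`, an edge has no common neighbour with probability about `e^{-x}`, so sets of about `e^x
L/p` vertices work; this gives the term `e^{-x} np/L` (`lt_cliqueChromaticNumber_sparse_whp`). With
larger `r`, at most half of the transversals are covered by an outside vertex, and Janson's
inequality finds a clique among the others; this gives `min(p^{3/2} n/√L, 1/(pL))` up to a constant
(`lt_cliqueChromaticNumber_dense_whp`). Where the sparse bound does not apply, the term `e^{-x}
np/L` is at most of order `L` times the dense one, or below `L` and hence trivial. -/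

/-- The expectation of `f A` when the random subset `A` of `s` contains each element of `s`
independently with probability `p`. -/
noncomputable def bernoulliExp (p : ℝ) (s : Finset α) (f : Finset α → ℝ) : ℝ :=
  ∑ A ∈ s.powerset, p ^ #A * (1 - p) ^ (#s - #A) * f A

open scoped Classical in
/-- The probability of `P A` when the random subset `A` of `s` contains each element of `s`
independently with probability `p`. -/
noncomputable def bernoulliProb (p : ℝ) (s : Finset α) (P : Finset α → Prop) : ℝ :=
  bernoulliExp p s fun A ↦ if P A then 1 else 0

variable {p : ℝ} {s t : Finset α} {f g : Finset α → ℝ}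

@[simp] lemma bernoulliExp_empty : bernoulliExp p ∅ f = f ∅ := by simp [bernoulliExp]

lemma bernoulliExp_insert {a : α} (ha : a ∉ s) :
    bernoulliExp p (insert a s) f =
      (1 - p) * bernoulliExp p s f + p * bernoulliExp p s fun A ↦ f (insert a A) := by
  simp only [bernoulliExp, sum_powerset_insert ha, mul_sum]
  congr 1
  · refine sum_congr rfl fun A hA ↦ ?_
    have hc := card_le_card (mem_powerset.1 hA)
    rw [card_insert_of_notMem ha, Nat.sub_add_comm hc, pow_succ]
    ring
  · refine sum_congr rfl fun A hA ↦ ?_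
    have haA : a ∉ A := fun h ↦ ha (mem_powerset.1 hA h)
    rw [card_insert_of_notMem ha, card_insert_of_notMem haA, Nat.add_sub_add_right, pow_succ]
    ring

lemma bernoulliExp_congr (h : ∀ A ⊆ s, f A = g A) : bernoulliExp p s f = bernoulliExp p s g :=
  sum_congr rfl fun A hA ↦ by rw [h A (mem_powerset.1 hA)]

lemma bernoulliExp_mono (hp0 : 0 ≤ p) (hp1 : p ≤ 1) (h : ∀ A ⊆ s, f A ≤ g A) :
    bernoulliExp p s f ≤ bernoulliExp p s g := by
  have := sub_nonneg.2 hp1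
  exact sum_le_sum fun A hA ↦ mul_le_mul_of_nonneg_left (h A (mem_powerset.1 hA)) (by positivity)

lemma bernoulliExp_add :
    bernoulliExp p s (fun A ↦ f A + g A) = bernoulliExp p s f + bernoulliExp p s g := by
  simp [bernoulliExp, mul_add, sum_add_distrib]

lemma bernoulliExp_const_mul (c : ℝ) :
    bernoulliExp p s (fun A ↦ c * f A) = c * bernoulliExp p s f := by
  simp only [bernoulliExp, mul_sum]
  exact sum_congr rfl fun _ _ ↦ by ring

lemma bernoulliExp_mul_const (c : ℝ) :
    bernoulliExp p s (fun A ↦ f A * c) = bernoulliExp p s f * c := by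
  simp only [mul_comm _ c, bernoulliExp_const_mul]

lemma bernoulliExp_sum (I : Finset ι) (F : ι → Finset α → ℝ) :
    bernoulliExp p s (fun A ↦ ∑ i ∈ I, F i A) = ∑ i ∈ I, bernoulliExp p s (F i) := by
  simp only [bernoulliExp, mul_sum]
  exact sum_comm

@[simp] lemma bernoulliExp_const (c : ℝ) : bernoulliExp p s (fun _ ↦ c) = c := by
  induction s using Finset.induction_on with
  | empty => simp
  | insert a s ha ih => rw [bernoulliExp_insert ha, ih]; ring

lemma bernoulliExp_nonneg (hp0 : 0 ≤ p) (hp1 : p ≤ 1) (h : ∀ A ⊆ s, 0 ≤ f A) :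
    0 ≤ bernoulliExp p s f := by
  simpa using bernoulliExp_mono hp0 hp1 h (f := fun _ ↦ 0)

/-- Independence of disjoint sets of bits. -/
lemma bernoulliExp_union (h : Disjoint s t) (f : Finset α → ℝ) :
    bernoulliExp p (s ∪ t) f =
      bernoulliExp p s fun A ↦ bernoulliExp p t fun B ↦ f (A ∪ B) := by
  induction s using Finset.induction_on generalizing f with
  | empty => simp
  | insert a s ha ih =>
    obtain ⟨hat, hst⟩ := disjoint_insert_left.1 h
    rw [insert_union, bernoulliExp_insert (by simp [ha, hat]), bernoulliExp_insert ha, ih hst,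
      ih hst]
    simp only [insert_union]

/-- A function of the bits in `t ⊆ s` may be averaged over `t` only. -/
lemma bernoulliExp_inter (h : t ⊆ s) (f : Finset α → ℝ) :
    bernoulliExp p s (fun A ↦ f (A ∩ t)) = bernoulliExp p t f := by
  conv_lhs => rw [← union_sdiff_of_subset h]
  rw [bernoulliExp_union disjoint_sdiff]
  refine bernoulliExp_congr fun A hA ↦ ?_
  rw [bernoulliExp_congr (g := fun _ ↦ f A), bernoulliExp_const]
  intro B hB
  rw [union_inter_distrib_right, inter_eq_left.2 hA,
    disjoint_iff_inter_eq_empty.1 (disjoint_of_subset_left hB sdiff_disjoint), union_empty]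

/-- Independence of a family of disjoint sets of bits. -/
lemma bernoulliExp_prod (W : Finset ι) (E : ι → Finset α) (hE : ∀ w ∈ W, E w ⊆ s)
    (hd : (W : Set ι).PairwiseDisjoint E) (h : ι → Finset α → ℝ) :
    bernoulliExp p s (fun A ↦ ∏ w ∈ W, h w (A ∩ E w)) = ∏ w ∈ W, bernoulliExp p (E w) (h w) := by
  classical
  induction W using Finset.induction_on generalizing s with
  | empty => simp
  | insert w W hw ih =>
    have hws : E w ⊆ s := hE w (mem_insert_self _ _)
    have hdw : ∀ v ∈ W, Disjoint (E v) (E w) := fun v hv ↦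
      hd (mem_coe.2 (mem_insert_of_mem hv)) (mem_coe.2 (mem_insert_self _ _))
        (by rintro rfl; exact hw hv)
    conv_lhs => rw [← union_sdiff_of_subset hws]
    rw [bernoulliExp_union disjoint_sdiff, prod_insert hw]
    rw [← ih (s := s \ E w) (fun v hv ↦ subset_sdiff.2 ⟨hE v (mem_insert_of_mem hv), hdw v hv⟩)
      (hd.subset (by simp)), ← bernoulliExp_mul_const]
    refine bernoulliExp_congr fun A hA ↦ ?_
    rw [← bernoulliExp_const_mul]
    refine bernoulliExp_congr fun B hB ↦ ?_
    rw [prod_insert hw, union_inter_distrib_right, inter_eq_left.2 hA,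
      disjoint_iff_inter_eq_empty.1 (disjoint_of_subset_left hB sdiff_disjoint), union_empty]
    congr 1
    refine prod_congr rfl fun v hv ↦ ?_
    rw [union_inter_distrib_right, disjoint_iff_inter_eq_empty.1
      (disjoint_of_subset_left hA (hdw v hv).symm), empty_union]

/-- The bits may be renamed. -/
lemma bernoulliExp_image {e : α → β} {s : Finset α} (he : Set.InjOn e s) (f : Finset β → ℝ) :
    bernoulliExp p (s.image e) f = bernoulliExp p s fun A ↦ f (A.image e) := by
  induction s using Finset.induction_on generalizing f with
  | empty => simp
  | insert a s ha ih =>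
    have he' : Set.InjOn e s := he.mono (by simp)
    have hea : e a ∉ s.image e := by
      rw [mem_image]
      rintro ⟨b, hb, hba⟩
      exact ha (he (by simp [hb]) (by simp) hba ▸ hb)
    rw [image_insert, bernoulliExp_insert hea, bernoulliExp_insert ha, ih he', ih he']
    simp only [image_insert]

/-- Harris' inequality. -/
lemma bernoulliExp_mul_le (hp0 : 0 ≤ p) (hp1 : p ≤ 1) (hf : Antitone f) (hg : Antitone g) :
    bernoulliExp p s f * bernoulliExp p s g ≤ bernoulliExp p s fun A ↦ f A * g A := by
  induction s using Finset.induction_on generalizing f g with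
  | empty => simp
  | insert a s ha ih =>
    rw [bernoulliExp_insert ha, bernoulliExp_insert ha, bernoulliExp_insert ha]
    have hins : Monotone fun A : Finset α ↦ insert a A := fun A B h ↦ insert_subset_insert a h
    have h1 := ih hf hg
    have h2 := ih (hf.comp_monotone hins) (hg.comp_monotone hins)
    have h3 : bernoulliExp p s (fun A ↦ f (insert a A)) ≤ bernoulliExp p s f :=
      bernoulliExp_mono hp0 hp1 fun A _ ↦ hf (subset_insert a A)
    have h4 : bernoulliExp p s (fun A ↦ g (insert a A)) ≤ bernoulliExp p s g :=
      bernoulliExp_mono hp0 hp1 fun A _ ↦ hg (subset_insert a A)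
    simp only [Function.comp_def] at h2
    -- After conditioning on the bit `a`, the remaining discrepancy is the covariance in that bit:
    -- `p (1 - p)` times the product of the two drops, which have the same sign.
    have h5 := mul_nonneg (mul_nonneg hp0 (sub_nonneg.2 hp1))
      (mul_nonneg (sub_nonneg.2 h3) (sub_nonneg.2 h4))
    have h6 := mul_le_mul_of_nonneg_left h1 (sub_nonneg.2 hp1)
    have h7 := mul_le_mul_of_nonneg_left h2 hp0
    nlinarith

/-- Conditioning on `K ⊆ A` amounts to adding `K` to `A`. -/
lemma bernoulliExp_superset {K : Finset α} (hK : K ⊆ s) (f : Finset α → ℝ) :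
    bernoulliExp p s (fun A ↦ if K ⊆ A then f A else 0) =
      p ^ #K * bernoulliExp p s fun A ↦ f (A ∪ K) := by
  induction K using Finset.induction_on generalizing f with
  | empty => simp
  | insert a K ha ih =>
    obtain ⟨has, hKs⟩ := insert_subset_iff.1 hK
    have key : ∀ g : Finset α → ℝ, bernoulliExp p s (fun A ↦ if a ∈ A then g A else 0) =
        p * bernoulliExp p s fun A ↦ g (insert a A) := by
      intro g
      conv_lhs => rw [← insert_erase has]
      conv_rhs => rw [← insert_erase has]
      rw [bernoulliExp_insert (notMem_erase _ _), bernoulliExp_insert (notMem_erase _ _),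
        bernoulliExp_congr (g := fun _ ↦ 0)]
      · simp only [bernoulliExp_const, mem_insert_self, if_true, insert_idem]
        ring
      · intro A hA
        exact if_neg fun h ↦ notMem_erase a s (hA h)
    have h1 : ∀ A : Finset α, (if insert a K ⊆ A then f A else 0) =
        if K ⊆ A then (if a ∈ A then f A else 0) else 0 := by
      intro A
      by_cases h : K ⊆ A <;> by_cases h' : a ∈ A <;> simp [insert_subset_iff, h, h']
    simp only [h1]
    rw [ih hKs, card_insert_of_notMem ha, pow_succ, mul_assoc]
    have h2 : ∀ A : Finset α, (if a ∈ A ∪ K then f (A ∪ K) else 0) =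
        if a ∈ A then f (A ∪ K) else 0 := by
      intro A
      simp [ha]
    simp only [h2]
    rw [key fun A ↦ f (A ∪ K)]
    simp only [insert_union, union_insert]

lemma bernoulliExp_prod_mem (c : α → ℝ) :
    bernoulliExp p s (fun A ↦ ∏ a ∈ A, c a) = ∏ a ∈ s, (1 - p + p * c a) := by
  induction s using Finset.induction_on with
  | empty => simp
  | insert a s ha ih =>
    rw [bernoulliExp_insert ha, prod_insert ha, ← ih,
      bernoulliExp_congr (f := fun A ↦ ∏ b ∈ insert a A, c b) (g := fun A ↦ c a * ∏ b ∈ A, c b),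
      bernoulliExp_const_mul]
    · ring
    · exact fun A hA ↦ prod_insert fun h ↦ ha (hA h)

lemma bernoulliExp_pow_card (c : ℝ) :
    bernoulliExp p s (fun A ↦ c ^ #A) = (1 - p + p * c) ^ #s := by
  simpa using bernoulliExp_prod_mem (p := p) (s := s) fun _ ↦ c

lemma one_sub_add_mul_exp_le (l : ℝ) : 1 - p + p * Real.exp l ≤ Real.exp (p * (Real.exp l - 1)) := by
  have := Real.add_one_le_exp (p * (Real.exp l - 1))
  linarith

lemma bernoulliExp_exp_card_le (hp0 : 0 ≤ p) (hp1 : p ≤ 1) (l : ℝ) :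
    bernoulliExp p s (fun A ↦ Real.exp (l * #A)) ≤ Real.exp (p * #s * (Real.exp l - 1)) := by
  have h := bernoulliExp_pow_card (p := p) (s := s) (Real.exp l)
  simp only [← Real.exp_nat_mul] at h
  simp only [mul_comm l, h]
  calc (1 - p + p * Real.exp l) ^ #s ≤ Real.exp (p * (Real.exp l - 1)) ^ #s := by
        have := sub_nonneg.2 hp1
        exact pow_le_pow_left₀ (by positivity) (one_sub_add_mul_exp_le l) _
    _ = _ := by rw [← Real.exp_nat_mul]; congr 1; ring

/-- Exponential moments of functions of independent bits with bounded differences. -/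
lemma bernoulliExp_exp_neg_le (hp0 : 0 ≤ p) (hp1 : p ≤ 1) {l : ℝ} (hl : 0 ≤ l) (c : α → ℝ)
    (hf : ∀ a ∈ s, ∀ A, f (insert a A) ≤ f A) (hc : ∀ a ∈ s, ∀ A, f A ≤ f (insert a A) + c a) :
    bernoulliExp p s (fun A ↦ Real.exp (-(l * f A))) ≤
      Real.exp (-(l * bernoulliExp p s f) + p * ∑ a ∈ s, (Real.exp (l * c a) - 1 - l * c a)) := by
  induction s using Finset.induction_on generalizing f with
  | empty => simp
  | insert a s ha ih =>
    -- Averaging out the bit `a` preserves the bounded differences in the other bits, so induction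
    -- applies to `h`; the bit itself costs one Poisson-type factor.
    set h : Finset α → ℝ := fun A ↦ (1 - p) * f A + p * f (insert a A) with hh
    have hq := sub_nonneg.2 hp1
    have e1 : bernoulliExp p (insert a s) f = bernoulliExp p s h := by
      rw [bernoulliExp_insert ha, hh, bernoulliExp_add, bernoulliExp_const_mul,
        bernoulliExp_const_mul]
    have ih' := ih (f := h) (fun b hb A ↦ ?_) (fun b hb A ↦ ?_)
    · rw [bernoulliExp_insert ha, ← bernoulliExp_const_mul, ← bernoulliExp_const_mul,
        ← bernoulliExp_add, e1, sum_insert ha]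
      calc _ ≤ bernoulliExp p s (fun A ↦ Real.exp (-(l * h A)) *
            Real.exp (p * (Real.exp (l * c a) - 1 - l * c a))) := by
            refine bernoulliExp_mono hp0 hp1 fun A _ ↦ ?_
            set u := f A - f (insert a A) with hu
            have hu0 : 0 ≤ u := sub_nonneg.2 (hf a (by simp) A)
            have huc : u ≤ c a := by linarith [hc a (by simp) A]
            have e2 : (1 - p) * Real.exp (-(l * f A)) + p * Real.exp (-(l * f (insert a A))) =
                Real.exp (-(l * h A)) * (Real.exp (-(p * (l * u))) *
                  (1 - p + p * Real.exp (l * u))) := by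
              have h1 : Real.exp (-(l * f A)) =
                  Real.exp (-(l * h A)) * Real.exp (-(p * (l * u))) := by
                rw [← Real.exp_add]; congr 1; simp only [hh, hu]; ring
              have h2 : Real.exp (-(l * f (insert a A))) =
                  Real.exp (-(l * f A)) * Real.exp (l * u) := by
                rw [← Real.exp_add]; congr 1; simp only [hu]; ring
              rw [h2, h1]
              ring
            rw [e2]
            gcongr
            calc Real.exp (-(p * (l * u))) * (1 - p + p * Real.exp (l * u))
                ≤ Real.exp (-(p * (l * u))) * Real.exp (p * (Real.exp (l * u) - 1)) := by
                  gcongr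
                  exact one_sub_add_mul_exp_le _
              _ = Real.exp (p * (Real.exp (l * u) - 1 - l * u)) := by
                  rw [← Real.exp_add]; congr 1; ring
              _ ≤ _ := by
                  -- The function `v ↦ exp v - 1 - v` is increasing on `v ≥ 0`, so the actual drop
                  -- may be replaced by its bound.
                  gcongr Real.exp (p * ?_)
                  have hv0 : 0 ≤ l * u := by positivity
                  have hv : l * u ≤ l * c a := by gcongr
                  have h3 := Real.add_one_le_exp (l * c a - l * u)
                  have h4 := Real.one_le_exp hv0
                  have h5 : Real.exp (l * c a) = Real.exp (l * u) * Real.exp (l * c a - l * u) := by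
                    rw [← Real.exp_add]; congr 1; ring
                  have h6 : Real.exp (l * u) * (l * c a - l * u + 1) ≤ Real.exp (l * c a) := by
                    rw [h5]; gcongr
                  nlinarith
        _ = bernoulliExp p s (fun A ↦ Real.exp (-(l * h A))) *
            Real.exp (p * (Real.exp (l * c a) - 1 - l * c a)) := bernoulliExp_mul_const _
        _ ≤ _ := mul_le_mul_of_nonneg_right ih' (Real.exp_nonneg _)
        _ = _ := by rw [← Real.exp_add]; congr 1; ring
    · simp only [hh]
      have h1 := hf b (by simp [hb]) A
      have h2 := hf b (by simp [hb]) (insert a A)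
      rw [insert_comm]
      gcongr
    · simp only [hh]
      have h1 := hc b (by simp [hb]) A
      have h2 := hc b (by simp [hb]) (insert a A)
      rw [insert_comm] at h2
      nlinarith

/-! ### Probabilities -/

variable {P Q : Finset α → Prop}

lemma bernoulliProb_le_bernoulliExp (hp0 : 0 ≤ p) (hp1 : p ≤ 1) (h0 : ∀ A ⊆ s, 0 ≤ f A)
    (h : ∀ A ⊆ s, P A → 1 ≤ f A) : bernoulliProb p s P ≤ bernoulliExp p s f := by
  refine bernoulliExp_mono hp0 hp1 fun A hA ↦ ?_
  split_ifs with hP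
  exacts [h A hA hP, h0 A hA]

lemma bernoulliProb_nonneg (hp0 : 0 ≤ p) (hp1 : p ≤ 1) : 0 ≤ bernoulliProb p s P :=
  bernoulliExp_nonneg hp0 hp1 fun A _ ↦ by split_ifs <;> norm_num

lemma bernoulliProb_mono (hp0 : 0 ≤ p) (hp1 : p ≤ 1) (h : ∀ A ⊆ s, P A → Q A) :
    bernoulliProb p s P ≤ bernoulliProb p s Q :=
  bernoulliProb_le_bernoulliExp hp0 hp1 (fun A _ ↦ by split_ifs <;> norm_num)
    fun A hA hP ↦ by rw [if_pos (h A hA hP)]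

lemma bernoulliProb_or_le (hp0 : 0 ≤ p) (hp1 : p ≤ 1) :
    bernoulliProb p s (fun A ↦ P A ∨ Q A) ≤ bernoulliProb p s P + bernoulliProb p s Q := by
  rw [bernoulliProb, bernoulliProb, bernoulliProb, ← bernoulliExp_add]
  refine bernoulliExp_mono hp0 hp1 fun A _ ↦ ?_
  by_cases h : P A <;> by_cases h' : Q A <;> simp [h, h']

lemma bernoulliProb_exists_le (hp0 : 0 ≤ p) (hp1 : p ≤ 1) (I : Finset ι)
    (R : ι → Finset α → Prop) :
    bernoulliProb p s (fun A ↦ ∃ i ∈ I, R i A) ≤ ∑ i ∈ I, bernoulliProb p s (R i) := by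
  simp only [bernoulliProb]
  rw [← bernoulliExp_sum]
  refine bernoulliExp_mono hp0 hp1 fun A _ ↦ ?_
  split_ifs with h
  · obtain ⟨i, hi, hR⟩ := h
    refine le_trans ?_ (single_le_sum (fun j _ ↦ by split_ifs <;> norm_num) hi)
    rw [if_pos hR]
  · exact sum_nonneg fun j _ ↦ by split_ifs <;> norm_num

lemma bernoulliProb_not : bernoulliProb p s (fun A ↦ ¬ P A) = 1 - bernoulliProb p s P := by
  have : bernoulliProb p s (fun A ↦ ¬ P A) + bernoulliProb p s P = 1 := by
    rw [bernoulliProb, bernoulliProb, ← bernoulliExp_add]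
    conv_rhs => rw [← bernoulliExp_const (p := p) (s := s) 1]
    refine bernoulliExp_congr fun A _ ↦ ?_
    by_cases h : P A <;> simp [h]
  linarith

lemma bernoulliProb_union (h : Disjoint s t) (P : Finset α → Prop) :
    bernoulliProb p (s ∪ t) P =
      bernoulliExp p s fun A ↦ bernoulliProb p t fun B ↦ P (A ∪ B) :=
  bernoulliExp_union h _

lemma bernoulliProb_inter (h : t ⊆ s) (P : Finset α → Prop) :
    bernoulliProb p s (fun A ↦ P (A ∩ t)) = bernoulliProb p t P := by
  classical
  exact bernoulliExp_inter h fun A ↦ if P A then 1 else 0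

end BernoulliExp

/-! ### Janson's inequality -/

section Janson

variable {α ι : Type*} [DecidableEq α] {p : ℝ} {s : Finset α}

/-- **Janson's inequality**: the probability that a random set contains none of the sets `K i`. -/
lemma bernoulliProb_forall_not_subset_le (hp0 : 0 ≤ p) (hp1 : p ≤ 1) (I : Finset ι)
    (K : ι → Finset α) (hK : ∀ i ∈ I, K i ⊆ s) {l : ℝ} (hl : 0 ≤ l) :
    bernoulliProb p s (fun A ↦ ∀ i ∈ I, ¬ K i ⊆ A) ≤
      Real.exp (-(l * ∑ i ∈ I, p ^ #(K i)) +
        l ^ 2 / 2 * ∑ i ∈ I, ∑ j ∈ I with ¬ Disjoint (K i) (K j), p ^ #(K i ∪ K j)) := by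
  set μ := ∑ i ∈ I, p ^ #(K i) with hμ
  set Δ := ∑ i ∈ I, ∑ j ∈ I with ¬ Disjoint (K i) (K j), p ^ #(K i ∪ K j) with hΔ
  set X : Finset α → ℝ := fun A ↦ ∑ i ∈ I, if K i ⊆ A then 1 else 0 with hX
  set Φ : ℝ → ℝ := fun l ↦ bernoulliExp p s fun A ↦ Real.exp (-(l * X A)) with hΦ
  have hind : ∀ (i : ι) {A B : Finset α}, A ⊆ B →
      (if K i ⊆ A then (1 : ℝ) else 0) ≤ if K i ⊆ B then 1 else 0 := by
    intro i A B h
    split_ifs with h1 h2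
    exacts [le_rfl, absurd (h1.trans h) h2, zero_le_one, le_rfl]
  -- This is the differential inequality `-Φ' ≥ (μ - l Δ) Φ`. Each summand of `X` is handled by
  -- conditioning on `K i ⊆ A`, followed by Harris' inequality and `exp (-z) ≥ 1 - z`.
  have key : ∀ l : ℝ, 0 ≤ l → (μ - l * Δ) * Φ l ≤
      bernoulliExp p s fun A ↦ X A * Real.exp (-(l * X A)) := by
    intro l hl
    simp only [hX, sum_mul]
    rw [bernoulliExp_sum, hμ, hΔ, mul_sum, ← sum_sub_distrib, sum_mul]
    refine sum_le_sum fun i hi ↦ ?_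
    set Y : Finset α → ℝ := fun A ↦
      ∑ j ∈ I with ¬ Disjoint (K i) (K j), if K j ⊆ A then 1 else 0 with hY
    -- Adding `K i` to `A` can create only those `K j` that meet `K i`.
    have hXY : ∀ A, X (A ∪ K i) ≤ X A + Y (A ∪ K i) := by
      intro A
      simp only [hX, hY, sum_filter]
      rw [← sum_add_distrib]
      refine sum_le_sum fun j _ ↦ ?_
      by_cases hd : Disjoint (K i) (K j)
      · have : K j ⊆ A ∪ K i → K j ⊆ A := fun h ↦
          (hd.symm.left_le_of_le_sup_right h)
        by_cases h1 : K j ⊆ A ∪ K i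
        · simp [this h1, hd, h1]
        · simp only [h1, hd, if_false, not_true]
          split_ifs <;> norm_num
      · simp only [hd, not_false_eq_true, if_true]
        split_ifs <;> norm_num
    have h1 : bernoulliExp p s (fun A ↦ (if K i ⊆ A then 1 else 0) * Real.exp (-(l * X A))) =
        p ^ #(K i) * bernoulliExp p s fun A ↦ Real.exp (-(l * X (A ∪ K i))) := by
      rw [← bernoulliExp_superset (hK i hi) fun A ↦ Real.exp (-(l * X A))]
      exact bernoulliExp_congr fun A _ ↦ by split_ifs <;> simp
    have h2 : p ^ #(K i) * bernoulliExp p s (fun A ↦ Y (A ∪ K i)) =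
        ∑ j ∈ I with ¬ Disjoint (K i) (K j), p ^ #(K i ∪ K j) := by
      rw [← bernoulliExp_superset (hK i hi) Y]
      have : ∀ A, (if K i ⊆ A then Y A else 0) =
          ∑ j ∈ I with ¬ Disjoint (K i) (K j), if K i ∪ K j ⊆ A then 1 else 0 := by
        intro A
        split_ifs with h
        · simp only [hY, union_subset_iff, h, true_and]
        · simp only [union_subset_iff, h, false_and, if_false, sum_const_zero]
      simp only [this]
      rw [bernoulliExp_sum]
      refine sum_congr rfl fun j hj ↦ ?_
      have := bernoulliExp_superset (p := p)
        (union_subset (hK i hi) (hK j (mem_filter.1 hj).1)) fun _ ↦ 1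
      rwa [bernoulliExp_const, mul_one] at this
    rw [h1, ← h2]
    have h3 : Φ l * bernoulliExp p s (fun A ↦ Real.exp (-(l * Y (A ∪ K i)))) ≤
        bernoulliExp p s fun A ↦ Real.exp (-(l * X (A ∪ K i))) := by
      refine (bernoulliExp_mul_le hp0 hp1 ?_ ?_).trans (bernoulliExp_mono hp0 hp1 fun A _ ↦ ?_)
      · intro A B h
        have : X A ≤ X B := sum_le_sum fun j _ ↦ hind j h
        dsimp only
        gcongr
      · intro A B h
        have : Y (A ∪ K i) ≤ Y (B ∪ K i) :=
          sum_le_sum fun j _ ↦ hind j (union_subset_union_left h)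
        dsimp only
        gcongr
      · rw [← Real.exp_add, Real.exp_le_exp]
        have := mul_le_mul_of_nonneg_left (hXY A) hl
        linarith
    have h4 : 1 - l * bernoulliExp p s (fun A ↦ Y (A ∪ K i)) ≤
        bernoulliExp p s (fun A ↦ Real.exp (-(l * Y (A ∪ K i)))) := by
      have : bernoulliExp p s (fun A ↦ 1 + (-l) * Y (A ∪ K i)) ≤
          bernoulliExp p s (fun A ↦ Real.exp (-(l * Y (A ∪ K i)))) := by
        refine bernoulliExp_mono hp0 hp1 fun A _ ↦ ?_
        have := Real.add_one_le_exp (-(l * Y (A ∪ K i)))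
        linarith
      rw [bernoulliExp_add, bernoulliExp_const, bernoulliExp_const_mul] at this
      linarith
    have h5 : 0 ≤ Φ l := bernoulliExp_nonneg hp0 hp1 fun A _ ↦ Real.exp_nonneg _
    calc (p ^ #(K i) - l * (p ^ #(K i) * bernoulliExp p s fun A ↦ Y (A ∪ K i))) * Φ l
        = p ^ #(K i) * (Φ l * (1 - l * bernoulliExp p s fun A ↦ Y (A ∪ K i))) := by ring
      _ ≤ p ^ #(K i) * (Φ l * bernoulliExp p s (fun A ↦ Real.exp (-(l * Y (A ∪ K i))))) := by
          gcongr
      _ ≤ _ := by gcongr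
  have hder : ∀ l, HasDerivAt Φ (bernoulliExp p s fun A ↦ -X A * Real.exp (-(l * X A))) l := by
    intro l
    simp only [hΦ, bernoulliExp]
    refine HasDerivAt.fun_sum fun A _ ↦ ?_
    refine HasDerivAt.const_mul _ ?_
    have := (((hasDerivAt_id l).mul_const (X A)).neg).exp
    simpa [mul_comm] using this
  -- The integrating factor of the differential inequality: `Ψ` is decreasing from `Ψ 0 = 1`.
  set Ψ : ℝ → ℝ := fun l ↦ Φ l * Real.exp (l * μ - l ^ 2 / 2 * Δ) with hΨ
  have hderΨ : ∀ l, HasDerivAt Ψ (((bernoulliExp p s fun A ↦ -X A * Real.exp (-(l * X A))) +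
      (μ - l * Δ) * Φ l) * Real.exp (l * μ - l ^ 2 / 2 * Δ)) l := by
    intro l
    have h1 : HasDerivAt (fun l : ℝ ↦ l * μ - l ^ 2 / 2 * Δ) (μ - l * Δ) l := by
      have := ((hasDerivAt_id l).mul_const μ).sub
        ((((hasDerivAt_id l).pow 2).div_const 2).mul_const Δ)
      refine this.congr_deriv ?_
      simp
    refine ((hder l).mul h1.exp).congr_deriv ?_
    ring
  have hanti : AntitoneOn Ψ (Set.Ici 0) := by
    refine antitoneOn_of_deriv_nonpos (convex_Ici 0)
      (fun l _ ↦ (hderΨ l).continuousAt.continuousWithinAt)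
      (fun l _ ↦ (hderΨ l).differentiableAt.differentiableWithinAt) fun l hl ↦ ?_
    rw [interior_Ici, Set.mem_Ioi] at hl
    rw [(hderΨ l).deriv]
    refine mul_nonpos_of_nonpos_of_nonneg ?_ (Real.exp_nonneg _)
    have := key l hl.le
    have h2 : (bernoulliExp p s fun A ↦ -X A * Real.exp (-(l * X A))) =
        -(bernoulliExp p s fun A ↦ X A * Real.exp (-(l * X A))) := by
      rw [← neg_one_mul, ← bernoulliExp_const_mul]
      exact bernoulliExp_congr fun A _ ↦ by ring
    linarith
  have h0 : Ψ 0 = 1 := by simp [hΨ, hΦ]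
  have h1 : Ψ l ≤ 1 := h0 ▸ hanti (Set.mem_Ici.2 le_rfl) (Set.mem_Ici.2 hl) hl
  have h2 : Φ l ≤ Real.exp (-(l * μ) + l ^ 2 / 2 * Δ) := by
    have h3 : Φ l = Ψ l * Real.exp (-(l * μ) + l ^ 2 / 2 * Δ) := by
      simp only [hΨ]
      rw [mul_assoc, ← Real.exp_add]
      ring_nf
      simp
    rw [h3]
    exact mul_le_of_le_one_left (Real.exp_nonneg _) h1
  refine (bernoulliProb_le_bernoulliExp hp0 hp1 (fun A _ ↦ Real.exp_nonneg (-(l * X A)))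
    fun A _ hA ↦ ?_).trans h2
  have : X A = 0 := sum_eq_zero fun i hi ↦ if_neg (hA i hi)
  simp [this]

end Janson

/-! ### The binomial random graph -/

section BinomialRandom

variable {V : Type*} [Fintype V] [DecidableEq V]

/-- The pairs of distinct vertices. -/
def vertexPairs (V : Type*) [Fintype V] [DecidableEq V] : Finset (Sym2 V) :=
  univ.filter fun e ↦ ¬ e.IsDiag

@[simp] lemma mk_mem_vertexPairs {u v : V} : s(u, v) ∈ vertexPairs V ↔ u ≠ v := by
  simp [vertexPairs]

-- Both sides are finite sums over graphs, matched by `A ↦ fromEdgeSet A`, which is a bijection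
-- because the sets `A` contain no diagonal pairs. Through it the whole argument can be carried out
-- with finite sums.
open scoped Classical in
lemma binomialRandom_real_eq_bernoulliProb (p : unitInterval) (S : Set (SimpleGraph V)) :
    (SimpleGraph.binomialRandom V p).real S =
      bernoulliProb (p : ℝ) (vertexPairs V) fun A ↦ SimpleGraph.fromEdgeSet (A : Set _) ∈ S := by
  have hS : S.Finite := S.toFinite
  have hsub : ∀ A ∈ (vertexPairs V).powerset,
      (SimpleGraph.fromEdgeSet (A : Set (Sym2 V))).edgeSet = A := by
    intro A hA
    rw [SimpleGraph.edgeSet_fromEdgeSet, sdiff_eq_left, Set.disjoint_left]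
    intro e he hd
    exact (mem_filter.1 (mem_powerset.1 hA he)).2 (by simpa using hd)
  have hcard : #(vertexPairs V) = (Nat.card V).choose 2 := by
    rw [Nat.card_eq_fintype_card, ← Sym2.card_subtype_not_diag, Fintype.card_subtype]
    rfl
  have : MeasurableSingletonClass (SimpleGraph V) := by
    refine ⟨fun G ↦ ?_⟩
    rw [← SimpleGraph.edgeSet_injective.preimage_image {G}, Set.image_singleton]
    exact SimpleGraph.measurable_edgeSet (Set.toFinite _).measurableSet
  have h1 : (SimpleGraph.binomialRandom V p).real S =
      ∑ G ∈ hS.toFinset, (SimpleGraph.binomialRandom V p).real {G} := by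
    rw [MeasureTheory.sum_measureReal_singleton]
    simp
  rw [h1, bernoulliProb, bernoulliExp]
  simp only [mul_ite, mul_one, mul_zero]
  rw [← sum_filter]
  symm
  refine sum_bij (fun A _ ↦ SimpleGraph.fromEdgeSet (A : Set (Sym2 V))) ?_ ?_ ?_ ?_
  · intro A hA
    simpa using (mem_filter.1 hA).2
  · intro A hA B hB h
    have := congrArg SimpleGraph.edgeSet h
    rw [hsub A (mem_filter.1 hA).1, hsub B (mem_filter.1 hB).1] at this
    exact_mod_cast this
  · intro G hG
    refine ⟨G.edgeSet.toFinset, ?_, ?_⟩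
    · rw [mem_filter, mem_powerset]
      refine ⟨fun e he ↦ ?_, by simpa using hG⟩
      simpa [vertexPairs] using SimpleGraph.not_isDiag_of_mem_edgeSet G (by simpa using he)
    · simp
  · intro A hA
    have hA' := (mem_filter.1 hA).1
    rw [MeasureTheory.measureReal_def, SimpleGraph.binomialRandom_singleton, hsub A hA',
      Set.ncard_coe_finset, hcard]
    simp

end BinomialRandom

/-! ### Bounds for the clique chromatic number of a given graph -/

section CliqueColoring

variable {V : Type*} [Fintype V] {G : SimpleGraph V} {k : ℕ}

lemma cliqueChromaticNumber_le (c : V → Fin k) (h : IsCliqueColoring G c) :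
    cliqueChromaticNumber G ≤ k :=
  Nat.sInf_le ⟨c, h⟩

lemma cliqueChromaticNumber_le_card : cliqueChromaticNumber G ≤ Fintype.card V := by
  refine cliqueChromaticNumber_le (Fintype.equivFin V) ?_
  rintro s - ⟨x, hx, y, hy, hxy⟩ ⟨a, ha⟩
  exact hxy ((Fintype.equivFin V).injective ((ha x hx).trans (ha y hy).symm))

lemma one_le_cliqueChromaticNumber [Nonempty V] : 1 ≤ cliqueChromaticNumber G := by
  obtain ⟨c, -⟩ := exists_isCliqueColoring G
  exact (c (Classical.arbitrary V)).pos

/-- Neighbourhoods contain no maximal cliques, so a total dominating set bounds the clique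
chromatic number. -/
lemma cliqueChromaticNumber_le_of_dominating (T : Fin k → V) (hT : ∀ v, ∃ i, G.Adj v (T i)) :
    cliqueChromaticNumber G ≤ k := by
  choose c hc using hT
  refine cliqueChromaticNumber_le c ?_
  rintro s hs - ⟨i, hi⟩
  have hadj : ∀ v ∈ s, G.Adj v (T i) := fun v hv ↦ hi v hv ▸ hc v
  have hTs : T i ∉ s := fun h ↦ G.loopless.irrefl _ (hadj _ h)
  have hins : G.IsClique (insert (T i) s) :=
    hs.prop.insert fun v hv _ ↦ (hadj v hv).symm
  exact hTs (hs.le_of_ge hins (Set.subset_insert _ _) (Set.mem_insert _ _))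

variable [DecidableEq V]

/-- Recolouring `v` arbitrarily is injective here: the old colour of `v` can be read off from `u`.
This is the statement that a colour at `v` coincides with that at `u` with probability at most
`1/k`. -/
lemma mul_card_filter_eq_le {Q : (V → Fin k) → Prop} [DecidablePred Q] {u v : V} (huv : u ≠ v)
    (hQ : ∀ c i, Q c → Q (Function.update c v i)) :
    k * #{c | Q c ∧ c v = c u} ≤ #{c | Q c} := by
  have : k * #{c | Q c ∧ c v = c u} =
      #((univ : Finset (Fin k)) ×ˢ ({c | Q c ∧ c v = c u} : Finset (V → Fin k))) := by
    simp [card_product]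
  rw [this]
  refine card_le_card_of_injOn (fun x ↦ Function.update x.2 v x.1) ?_ ?_
  · rintro ⟨i, c⟩ h
    simp only [coe_product, Set.mem_prod, mem_coe, mem_filter, mem_univ, true_and] at h ⊢
    exact hQ c i h.1
  · rintro ⟨i, c⟩ h ⟨j, d⟩ h' heq
    simp only [coe_product, Set.mem_prod, mem_coe, mem_filter, mem_univ, true_and] at h h' heq
    have hij : i = j := by simpa using congrFun heq v
    have hcd : ∀ w, w ≠ v → c w = d w := fun w hw ↦ by simpa [hw] using congrFun heq w
    have : c = d := by
      funext w
      by_cases hw : w = v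
      · rw [hw, h.2, h'.2, hcd u huv]
      · exact hcd w hw
    rw [hij, this]

/-- Colourings of `S` in which no triangle is monochromatic and no edge outside all triangles is
monochromatic. -/
def IsTriangleColoringOn (G : SimpleGraph V) (S : Finset V) (c : V → Fin k) : Prop :=
  (∀ u ∈ S, ∀ v ∈ S, G.Adj u v → (∀ w, ¬ (G.Adj u w ∧ G.Adj v w)) → c u ≠ c v) ∧
    ∀ u ∈ S, ∀ v ∈ S, ∀ w ∈ S, G.Adj u v → G.Adj u w → G.Adj v w → ¬ (c v = c u ∧ c w = c u)

lemma IsTriangleColoringOn.mono {S T : Finset V} {c : V → Fin k} (hST : S ⊆ T)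
    (h : IsTriangleColoringOn G T c) : IsTriangleColoringOn G S c :=
  ⟨fun u hu v hv ↦ h.1 u (hST hu) v (hST hv),
    fun u hu v hv w hw ↦ h.2 u (hST hu) v (hST hv) w (hST hw)⟩

lemma IsTriangleColoringOn.update {S : Finset V} {c : V → Fin k} {v : V} (hv : v ∉ S) (i : Fin k)
    (h : IsTriangleColoringOn G S c) : IsTriangleColoringOn G S (Function.update c v i) := by
  have hne : ∀ u ∈ S, u ≠ v := fun u hu huv ↦ hv (huv ▸ hu)
  refine ⟨fun u hu w hw ↦ ?_, fun u hu w hw x hx ↦ ?_⟩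
  · rw [Function.update_of_ne (hne u hu), Function.update_of_ne (hne w hw)]
    exact h.1 u hu w hw
  · rw [Function.update_of_ne (hne u hu), Function.update_of_ne (hne w hw),
      Function.update_of_ne (hne x hx)]
    exact h.2 u hu w hw x hx

/-- A maximal clique with an edge `uv` lying in some triangle must have a third vertex, since
otherwise a common neighbour of `u` and `v` could be added. It therefore contains a triangle. -/
lemma IsTriangleColoringOn.isCliqueColoring {c : V → Fin k}
    (h : IsTriangleColoringOn G univ c) : IsCliqueColoring G c := by
  rintro s hs ⟨u, hu, v, hv, huv⟩ ⟨i, hi⟩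
  have hadj : G.Adj u v := hs.prop hu hv huv
  by_cases hw : ∀ w, ¬ (G.Adj u w ∧ G.Adj v w)
  · exact h.1 u (mem_univ _) v (mem_univ _) hadj hw ((hi u hu).trans (hi v hv).symm)
  push Not at hw
  obtain ⟨w, huw, hvw⟩ := hw
  have : ∃ x ∈ s, x ≠ u ∧ x ≠ v := by
    by_contra! hcon
    have hsub : s ⊆ {u, v} := fun x hx ↦ by
      by_cases hxu : x = u
      · simp [hxu]
      · simp [hcon x hx hxu]
    have hclq : G.IsClique (insert w s) := hs.prop.insert fun b hb _ ↦ by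
      rcases hsub hb with rfl | rfl
      exacts [huw.symm, hvw.symm]
    rcases hsub (hs.le_of_ge hclq (Set.subset_insert _ _) (Set.mem_insert _ _)) with rfl | rfl
    exacts [G.loopless.irrefl _ huw, G.loopless.irrefl _ hvw]
  obtain ⟨x, hx, hxu, hxv⟩ := this
  exact h.2 u (mem_univ _) v (mem_univ _) x (mem_univ _) hadj (hs.prop hu hx hxu.symm)
    (hs.prop hv hx hxv.symm) ⟨(hi v hv).trans (hi u hu).symm, (hi x hx).trans (hi u hu).symm⟩

open scoped Classical in
/-- Adding a vertex loses at most half of the colourings. -/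
lemma card_isTriangleColoringOn_le {D Δ : ℝ} (hk : 0 < k)
    (hD : ∀ v, (#{u | G.Adj v u ∧ ∀ w, ¬ (G.Adj v w ∧ G.Adj u w)} : ℝ) ≤ D)
    (hΔ : ∀ v, (#{x : V × V | G.Adj v x.1 ∧ G.Adj v x.2 ∧ G.Adj x.1 x.2} : ℝ) ≤ Δ)
    (hkD : 4 * D ≤ k) (hkΔ : 8 * Δ ≤ (k : ℝ) ^ 2) (S : Finset V) (v : V) (hv : v ∉ S) :
    (#{c : V → Fin k | IsTriangleColoringOn G S c} : ℝ) ≤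
      2 * #{c : V → Fin k | IsTriangleColoringOn G (insert v S) c} := by
  induction hm : #S using Nat.strong_induction_on generalizing S v with
  | _ m ih =>
    set N := (#{c : V → Fin k | IsTriangleColoringOn G S c} : ℝ) with hN
    have hk' : (0 : ℝ) < k := by exact_mod_cast hk
    have hN0 : 0 ≤ N := by positivity
    set B : Finset V := {u | G.Adj v u ∧ ∀ w, ¬ (G.Adj v w ∧ G.Adj u w)} with hB
    set T : Finset (V × V) := {x | G.Adj v x.1 ∧ G.Adj v x.2 ∧ G.Adj x.1 x.2} with hT
    -- A colouring that is good on `S` but not on `insert v S` has a conflict at `v`: an edge `vu`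
    -- in no triangle, or a triangle with two vertices of `S`. In the second case the condition on
    -- `S` is weakened to `S.erase x.1`, so that the colour of `x.1` becomes free as well.
    have hcov : ({c : V → Fin k | IsTriangleColoringOn G S c} : Finset _) ⊆
        ({c : V → Fin k | IsTriangleColoringOn G (insert v S) c} : Finset _) ∪
        ((B.filter (· ∈ S)).biUnion fun u ↦ {c | IsTriangleColoringOn G S c ∧ c v = c u}) ∪
        ((T.filter fun x ↦ x.1 ∈ S ∧ x.2 ∈ S).biUnion fun x ↦
          {c | (IsTriangleColoringOn G (S.erase x.1) c ∧ c x.1 = c x.2) ∧ c v = c x.2}) := by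
      intro c hc
      have hc' : IsTriangleColoringOn G S c := by simpa using hc
      simp only [mem_union, mem_biUnion, mem_filter, mem_univ, true_and]
      by_contra! hcon
      obtain ⟨⟨h1, h2⟩, h3⟩ := hcon
      refine h1 ⟨fun a ha b hb hab hw ↦ ?_, fun a ha b hb d hd hab had hbd hm ↦ ?_⟩
      · rcases mem_insert.1 ha with rfl | haS
        · rcases mem_insert.1 hb with rfl | hbS
          · exact absurd hab (G.loopless.irrefl _)
          · exact h2 b ⟨by simp only [hB, mem_filter, mem_univ, true_and]; exact ⟨hab, hw⟩, hbS⟩ hc'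
        · rcases mem_insert.1 hb with rfl | hbS
          · refine (h2 a ⟨?_, haS⟩ hc').symm
            simp only [hB, mem_filter, mem_univ, true_and]
            exact ⟨hab.symm, fun w h ↦ hw w h.symm⟩
          · exact hc'.1 a haS b hbS hab hw
      · have hT' : ∀ y z, y ∈ S → z ∈ S → G.Adj v y → G.Adj v z → G.Adj y z →
            c y = c z → c v = c z → False := fun y z hy hz hvy hvz hyz h4 h5 ↦
          h3 (y, z) ⟨by simp [hT, hvy, hvz, hyz], hy, hz⟩
            ⟨hc'.mono (erase_subset _ _), h4⟩ h5
        have hne : ∀ {y}, G.Adj y v → y ∈ insert v S → y ∈ S := fun hy hy' ↦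
          (mem_insert.1 hy').resolve_left fun h ↦ G.loopless.irrefl _ (h ▸ hy)
        rcases mem_insert.1 ha with rfl | haS
        · exact hT' b d (hne hab.symm hb) (hne had.symm hd) hab had hbd (hm.1.trans hm.2.symm)
            hm.2.symm
        rcases mem_insert.1 hb with rfl | hbS
        · exact hT' a d haS (hne hbd.symm hd) hab.symm hbd had hm.2.symm (hm.1.trans hm.2.symm)
        rcases mem_insert.1 hd with rfl | hdS
        · exact hT' a b haS hbS had.symm hbd.symm hab hm.1.symm (hm.2.trans hm.1.symm)
        exact hc'.2 a haS b hbS d hdS hab had hbd hm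
    have hBc : ∀ u ∈ B.filter (· ∈ S),
        (#{c : V → Fin k | IsTriangleColoringOn G S c ∧ c v = c u} : ℝ) ≤ N / k := by
      intro u hu
      rw [le_div_iff₀' hk', hN]
      have hne : u ≠ v := fun h ↦ hv (h ▸ (mem_filter.1 hu).2)
      exact_mod_cast mul_card_filter_eq_le (k := k) hne fun c i h ↦
        IsTriangleColoringOn.update hv i h
    have hTc : ∀ x ∈ T.filter fun x ↦ x.1 ∈ S ∧ x.2 ∈ S,
        (#{c : V → Fin k | (IsTriangleColoringOn G (S.erase x.1) c ∧ c x.1 = c x.2) ∧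
          c v = c x.2} : ℝ) ≤ 2 * N / k ^ 2 := by
      rintro ⟨a, b⟩ hx
      obtain ⟨hxT, haS, hbS⟩ := mem_filter.1 hx
      simp only [hT, mem_filter, mem_univ, true_and] at hxT
      simp only at haS hbS ⊢
      have hba : b ≠ a := hxT.2.2.symm.ne
      have hbv : b ≠ v := hxT.2.1.symm.ne
      have hav : a ≠ v := hxT.1.symm.ne
      have h1 := mul_card_filter_eq_le (k := k) (u := b) (v := v)
        (Q := fun c ↦ IsTriangleColoringOn G (S.erase a) c ∧ c a = c b) hbv fun c i h ↦
          ⟨h.1.update (fun hv' ↦ hv (mem_of_mem_erase hv')) i, by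
            rw [Function.update_of_ne hav, Function.update_of_ne hbv]; exact h.2⟩
      have h2 := mul_card_filter_eq_le (k := k) (u := b) (v := a)
        (Q := fun c ↦ IsTriangleColoringOn G (S.erase a) c) hba fun c i h ↦
          h.update (notMem_erase _ _) i
      -- Forgetting the condition at `a` at most doubles the number of colourings, by induction; the
      -- two coincidences of colours gain `1 / k ^ 2`.
      have h3 := ih #(S.erase a) (hm ▸ card_erase_lt_of_mem haS) (S.erase a) a
        (notMem_erase _ _) rfl
      rw [insert_erase haS] at h3
      rw [le_div_iff₀ (by positivity)]
      have h1' : (k : ℝ) * #{c : V → Fin k | (IsTriangleColoringOn G (S.erase a) c ∧ c a = c b) ∧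
          c v = c b} ≤ #{c : V → Fin k | IsTriangleColoringOn G (S.erase a) c ∧ c a = c b} := by
        exact_mod_cast h1
      have h2' : (k : ℝ) * #{c : V → Fin k | IsTriangleColoringOn G (S.erase a) c ∧ c a = c b} ≤
          #{c : V → Fin k | IsTriangleColoringOn G (S.erase a) c} := by
        exact_mod_cast h2
      have h4 := mul_le_mul_of_nonneg_left h1' hk'.le
      nlinarith
    have hcard : N ≤ #{c : V → Fin k | IsTriangleColoringOn G (insert v S) c} +
        #(B.filter (· ∈ S)) * (N / k) +
        #(T.filter fun x ↦ x.1 ∈ S ∧ x.2 ∈ S) * (2 * N / k ^ 2) := by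
      have h1 := (card_le_card hcov).trans (card_union_le _ _)
      have h2 := h1.trans (Nat.add_le_add_right (card_union_le _ _) _)
      have h3 := h2.trans (Nat.add_le_add (Nat.add_le_add_left card_biUnion_le _) card_biUnion_le)
      have h4 : N ≤ (_ : ℝ) := Nat.cast_le.2 h3
      push_cast at h4
      refine h4.trans ?_
      gcongr
      · exact (sum_le_sum hBc).trans (by simp)
      · exact (sum_le_sum hTc).trans (by simp)
    have hB1 : (#(B.filter (· ∈ S)) : ℝ) * (N / k) ≤ N / 4 := by
      have h1 : (#(B.filter (· ∈ S)) : ℝ) ≤ D :=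
        (Nat.cast_le.2 (card_le_card (filter_subset _ _))).trans (hD v)
      rw [mul_div_assoc', div_le_div_iff₀ hk' (by norm_num)]
      nlinarith
    have hT1 : (#(T.filter fun x ↦ x.1 ∈ S ∧ x.2 ∈ S) : ℝ) * (2 * N / k ^ 2) ≤ N / 4 := by
      have h1 : (#(T.filter fun x ↦ x.1 ∈ S ∧ x.2 ∈ S) : ℝ) ≤ Δ :=
        (Nat.cast_le.2 (card_le_card (filter_subset _ _))).trans (hΔ v)
      rw [mul_div_assoc', div_le_div_iff₀ (by positivity) (by norm_num)]
      nlinarith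
    linarith

open scoped Classical in
lemma cliqueChromaticNumber_le_of_triangles {D Δ : ℝ} (hk : 0 < k)
    (hD : ∀ v, (#{u | G.Adj v u ∧ ∀ w, ¬ (G.Adj v w ∧ G.Adj u w)} : ℝ) ≤ D)
    (hΔ : ∀ v, (#{x : V × V | G.Adj v x.1 ∧ G.Adj v x.2 ∧ G.Adj x.1 x.2} : ℝ) ≤ Δ)
    (hkD : 4 * D ≤ k) (hkΔ : 8 * Δ ≤ (k : ℝ) ^ 2) : cliqueChromaticNumber G ≤ k := by
  have hpos : ∀ S : Finset V, (0 : ℝ) < #{c : V → Fin k | IsTriangleColoringOn G S c} := by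
    intro S
    induction S using Finset.induction_on with
    | empty =>
      rw [Nat.cast_pos, card_pos]
      exact ⟨fun _ ↦ ⟨0, hk⟩, by simp [IsTriangleColoringOn]⟩
    | insert v S hv ih =>
      have := card_isTriangleColoringOn_le hk hD hΔ hkD hkΔ S v hv
      linarith
  have := hpos univ
  rw [Nat.cast_pos, card_pos] at this
  obtain ⟨c, hc⟩ := this
  exact cliqueChromaticNumber_le c (IsTriangleColoringOn.isCliqueColoring (by simpa using hc))

/-- If every vertex set of size `r * m` contains a clique that has no common neighbour outside
the set, then every colour class of a clique colouring has fewer than `r * m` vertices. -/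
lemma card_lt_cliqueChromaticNumber_mul [Nonempty V] {r m : ℕ}
    (h : ∀ φ : Fin r × Fin m ↪ V, ∃ K ⊆ Set.range φ, G.IsClique K ∧ K.Nontrivial ∧
      ∀ w ∉ Set.range φ, ∃ x ∈ K, ¬ G.Adj w x) :
    Fintype.card V < cliqueChromaticNumber G * (r * m) := by
  by_contra! hcon
  obtain ⟨c, hc⟩ := exists_isCliqueColoring G
  have : Nonempty (Fin (cliqueChromaticNumber G)) := ⟨c (Classical.arbitrary V)⟩
  obtain ⟨i, hi⟩ := Fintype.exists_le_card_fiber_of_mul_le_card c (n := r * m) (by simpa using hcon)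
  obtain ⟨ψ⟩ : Nonempty (Fin r × Fin m ↪ {v // c v = i}) := by
    rw [Function.Embedding.nonempty_iff_card_le, Fintype.card_subtype]
    simpa using hi
  set φ : Fin r × Fin m ↪ V := ψ.trans (Function.Embedding.subtype _) with hφ
  obtain ⟨K, hK, hKc, hKn, hKw⟩ := h φ
  -- A largest extension of `K` inside the set is maximal in `G`: any further vertex would lie
  -- outside the set and be a common neighbour of `K`.
  obtain ⟨K', hKK', hK'⟩ := Set.Finite.exists_le_maximal
    (s := {L : Set V | L ⊆ Set.range φ ∧ G.IsClique L}) (Set.toFinite _) ⟨hK, hKc⟩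
  refine hc K' ⟨hK'.prop.2, fun L hL hK'L ↦ ?_⟩ (hKn.mono hKK') ⟨i, fun v hv ↦ ?_⟩
  · refine hK'.le_of_ge ⟨fun w hw ↦ ?_, hL⟩ hK'L
    by_contra hwφ
    obtain ⟨x, hxK, hx⟩ := hKw w hwφ
    have hxw : w ≠ x := fun h ↦ hwφ (h ▸ hK hxK)
    exact hx (hL hw (hK'L (hKK' hxK)) hxw)
  · obtain ⟨x, rfl⟩ := hK'.prop.1 hv
    exact (ψ x).2

end CliqueColoring

/-! ### Neighbourhoods in the binomial random graph -/

section Reindex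

variable {α β ι : Type*} [DecidableEq α] [DecidableEq β] {p : ℝ} {s : Finset α}

/-- With `e b = s(b, w)` this says that the neighbourhood of `w` in `S` is a binomial random subset
of `S`. The product version below adds the independence of neighbourhoods that use disjoint sets of
pairs. -/
lemma bernoulliExp_filter_mem {S : Finset β} {e : β → α} (he : Set.InjOn e S)
    (hs : ∀ b ∈ S, e b ∈ s) (h : Finset β → ℝ) :
    bernoulliExp p s (fun A ↦ h (S.filter (e · ∈ A))) = bernoulliExp p S h := by
  have h1 := bernoulliExp_inter (p := p) (image_subset_iff.2 hs) fun A ↦ h (S.filter (e · ∈ A))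
  rw [bernoulliExp_image he] at h1
  convert h1 using 1
  · refine bernoulliExp_congr fun A _ ↦ congrArg h (filter_congr fun b hb ↦ ?_)
    simp [mem_image_of_mem e hb]
  · refine bernoulliExp_congr fun A hA ↦ congrArg h ?_
    ext b
    simp only [mem_filter, mem_image]
    constructor
    · exact fun hb ↦ ⟨hA hb, b, hb, rfl⟩
    · rintro ⟨hb, b', hb', hbb'⟩
      rwa [← he (hA hb') hb hbb']

lemma bernoulliExp_prod_filter_mem (W : Finset ι) (S : ι → Finset β) (e : ι → β → α)
    (he : ∀ w ∈ W, Set.InjOn (e w) (S w)) (hs : ∀ w ∈ W, ∀ b ∈ S w, e w b ∈ s)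
    (hd : ∀ w ∈ W, ∀ w' ∈ W, w ≠ w' → ∀ b ∈ S w, ∀ b' ∈ S w', e w b ≠ e w' b')
    (h : ι → Finset β → ℝ) :
    bernoulliExp p s (fun A ↦ ∏ w ∈ W, h w ((S w).filter (e w · ∈ A))) =
      ∏ w ∈ W, bernoulliExp p (S w) (h w) := by
  have h1 := bernoulliExp_prod (p := p) (s := s) W (fun w ↦ (S w).image (e w))
    (fun w hw ↦ image_subset_iff.2 (hs w hw)) (fun w hw w' hw' hww' ↦ by
      rw [Function.onFun, disjoint_left]
      intro a ha ha'
      obtain ⟨b, hb, rfl⟩ := mem_image.1 ha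
      obtain ⟨b', hb', hbb'⟩ := mem_image.1 ha'
      exact hd w hw w' hw' hww' b hb b' hb' hbb'.symm)
    (fun w A ↦ h w ((S w).filter (e w · ∈ A)))
  convert h1 using 1
  · refine bernoulliExp_congr fun A _ ↦ prod_congr rfl fun w _ ↦
      congrArg (h w) (filter_congr fun b hb ↦ ?_)
    simp [mem_image_of_mem (e w) hb]
  · refine prod_congr rfl fun w hw ↦ ?_
    have := bernoulliExp_filter_mem (p := p) (s := (S w).image (e w)) (he w hw)
      (fun b hb ↦ mem_image_of_mem _ hb) (h w)
    exact this.symm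

lemma bernoulliExp_ite_subset {K : Finset α} (hK : K ⊆ s) (a : ℝ) :
    bernoulliExp p s (fun A ↦ if K ⊆ A then a else 1) = 1 + (a - 1) * p ^ #K := by
  have h1 := bernoulliExp_superset (p := p) hK fun _ ↦ a - 1
  rw [bernoulliExp_const] at h1
  have h2 : bernoulliExp p s (fun A ↦ if K ⊆ A then a else 1) =
      bernoulliExp p s fun A ↦ 1 + if K ⊆ A then a - 1 else 0 :=
    bernoulliExp_congr fun A _ ↦ by split_ifs <;> ring
  rw [h2, bernoulliExp_add, bernoulliExp_const, h1]
  ring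

lemma bernoulliProb_empty : bernoulliProb p s (fun A ↦ A = ∅) = (1 - p) ^ #s := by
  have h1 := bernoulliExp_pow_card (p := p) (s := s) 0
  rw [mul_zero, add_zero] at h1
  rw [← h1]
  refine bernoulliExp_congr fun A _ ↦ ?_
  by_cases hA : A = ∅
  · simp [hA]
  · rw [if_neg hA, zero_pow (card_ne_zero.2 (nonempty_iff_ne_empty.2 hA))]

end Reindex

lemma Real.exp_sub_one_le_add_sq {l : ℝ} (h0 : 0 ≤ l) (h1 : l ≤ 1) :
    Real.exp l - 1 ≤ l + l ^ 2 := by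
  have := abs_le.1 (Real.abs_exp_sub_one_sub_id_le (abs_le.2 ⟨by linarith, h1⟩))
  linarith [this.2]

section Neighbourhoods

variable {V : Type*} [Fintype V] [DecidableEq V] {p : ℝ} (hp0 : 0 ≤ p) (hp1 : p ≤ 1)

include hp0 hp1

/-- Chernoff's bound with the parameter left free: `l = 1` gives degrees of order `np + L`, while `l
= 2pL` with `δ = 1/p` gives the sharper control that is needed inside an exponential `exp (-p *
degree)`. -/
lemma bernoulliProb_exists_degree_ge_le {l : ℝ} (hl0 : 0 ≤ l) (hl1 : l ≤ 1) (δ : ℝ) :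
    bernoulliProb p (vertexPairs V)
      (fun A ↦ ∃ v, Fintype.card V * p + δ ≤ #{u | s(v, u) ∈ A}) ≤
      Fintype.card V * Real.exp (l ^ 2 * (Fintype.card V * p) - l * δ) := by
  set n := Fintype.card V
  have key : ∀ v : V, bernoulliProb p (vertexPairs V)
      (fun A ↦ (n * p + δ : ℝ) ≤ #{u | s(v, u) ∈ A}) ≤
      Real.exp (l ^ 2 * (n * p) - l * δ) := by
    intro v
    have h1 := bernoulliExp_filter_mem (p := p) (s := vertexPairs V) (S := univ.erase v)
      (e := fun u ↦ s(v, u)) (fun a _ b _ h ↦ Sym2.congr_right.1 h)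
      (fun b hb ↦ by simpa using (ne_of_mem_erase hb).symm)
      (fun B ↦ Real.exp (-(l * (n * p + δ))) * Real.exp (l * #B))
    refine (bernoulliProb_le_bernoulliExp hp0 hp1 (fun A _ ↦ by positivity)
      fun A hA hle ↦ ?_).trans (h1.trans_le ?_)
    · have h2 : (univ.erase v).filter (fun u ↦ s(v, u) ∈ A) =
          univ.filter fun u ↦ s(v, u) ∈ A := by
        ext u
        simp only [mem_filter, mem_erase, mem_univ, and_true, true_and, and_iff_right_iff_imp]
        intro h huv
        exact (mk_mem_vertexPairs.1 (hA h)) huv.symm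
      rw [h2, ← Real.exp_add, Real.one_le_exp_iff]
      nlinarith
    · rw [bernoulliExp_const_mul]
      calc _ ≤ Real.exp (-(l * (n * p + δ))) *
            Real.exp (p * #(univ.erase v) * (Real.exp l - 1)) := by
            gcongr
            exact bernoulliExp_exp_card_le hp0 hp1 l
        _ ≤ _ := by
            rw [← Real.exp_add, Real.exp_le_exp]
            have h2 : (#(univ.erase v) : ℝ) ≤ n := by exact_mod_cast card_le_univ _
            have h3 := Real.exp_sub_one_le_add_sq hl0 hl1
            have h4 : p * #(univ.erase v) * (Real.exp l - 1) ≤ p * n * (l + l ^ 2) := by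
              have : 0 ≤ Real.exp l - 1 := by linarith [Real.add_one_le_exp l]
              gcongr
            linarith
  have h := (bernoulliProb_exists_le (s := vertexPairs V) hp0 hp1 univ
    (fun (v : V) A ↦ (n * p + δ : ℝ) ≤ #{u | s(v, u) ∈ A})).trans
    (sum_le_sum fun v _ ↦ key v)
  simpa [n] using h

omit hp0 hp1 in
lemma bernoulliExp_prod_common_neighbor {u v : V} (huv : u ≠ v) (a : ℝ) :
    bernoulliExp p (vertexPairs V)
      (fun A ↦ ∏ w ∈ univ \ {u, v}, if s(u, w) ∈ A ∧ s(v, w) ∈ A then a else 1) =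
      (1 + (a - 1) * p ^ 2) ^ (Fintype.card V - 2) := by
  have h1 := bernoulliExp_prod_filter_mem (p := p) (s := vertexPairs V) (univ \ {u, v})
    (fun _ ↦ ({u, v} : Finset V)) (fun w b ↦ s(b, w)) (fun w _ a _ b _ h ↦ Sym2.congr_left.1 h)
    (fun w hw b hb ↦ by
      rw [mk_mem_vertexPairs]
      rintro rfl
      exact (mem_sdiff.1 hw).2 hb)
    (fun w hw w' hw' hww' b hb b' hb' h ↦ by
      rcases Sym2.eq_iff.1 h with ⟨-, h⟩ | ⟨h, -⟩
      · exact hww' h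
      · exact (mem_sdiff.1 hw').2 (h ▸ hb))
    (fun _ B ↦ if {u, v} ⊆ B then a else 1)
  rw [prod_const, bernoulliExp_ite_subset Subset.rfl, card_pair huv,
    card_sdiff_of_subset (subset_univ _), card_pair huv, card_univ] at h1
  rw [← h1]
  refine bernoulliExp_congr fun A _ ↦ prod_congr rfl fun w _ ↦ ?_
  congr 1
  simp [insert_subset_iff]

lemma bernoulliProb_exists_codegree_ge_le (K : ℝ) :
    bernoulliProb p (vertexPairs V)
      (fun A ↦ ∃ u v, u ≠ v ∧ K ≤ #{w | s(u, w) ∈ A ∧ s(v, w) ∈ A}) ≤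
      Fintype.card V ^ 2 * Real.exp (2 * (Fintype.card V * p ^ 2) - K) := by
  set n := Fintype.card V
  have key : ∀ x : V × V, bernoulliProb p (vertexPairs V)
      (fun A ↦ x.1 ≠ x.2 ∧ K ≤ #{w | s(x.1, w) ∈ A ∧ s(x.2, w) ∈ A}) ≤
      Real.exp (2 * (n * p ^ 2) - K) := by
    rintro ⟨u, v⟩
    simp only
    by_cases huv : u = v
    · refine le_trans (le_of_eq ?_) (Real.exp_nonneg _)
      simp [huv, bernoulliProb]
    have h1 := bernoulliExp_prod_common_neighbor (p := p) huv (Real.exp 1)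
    refine (bernoulliProb_le_bernoulliExp (f := fun A ↦ Real.exp (-K) *
      ∏ w ∈ univ \ {u, v}, if s(u, w) ∈ A ∧ s(v, w) ∈ A then Real.exp 1 else 1)
      hp0 hp1 (fun A _ ↦ ?_) fun A hA hle ↦ ?_).trans ?_
    · refine mul_nonneg (Real.exp_nonneg _) (prod_nonneg fun w _ ↦ ?_)
      split_ifs <;> positivity
    · have h2 : (univ \ {u, v} : Finset V).filter (fun w ↦ s(u, w) ∈ A ∧ s(v, w) ∈ A) =
          univ.filter fun w ↦ s(u, w) ∈ A ∧ s(v, w) ∈ A := by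
        ext w
        simp only [mem_filter, Finset.mem_sdiff, mem_univ, true_and, and_iff_right_iff_imp, mem_insert,
          mem_singleton]
        rintro ⟨h3, h4⟩ (rfl | rfl)
        · exact mk_mem_vertexPairs.1 (hA h3) rfl
        · exact mk_mem_vertexPairs.1 (hA h4) rfl
      rw [prod_ite, prod_const, prod_const_one, mul_one, h2, ← Real.exp_nat_mul, mul_one,
        ← Real.exp_add, Real.one_le_exp_iff]
      linarith [hle.2]
    · rw [bernoulliExp_const_mul, h1, sub_eq_add_neg _ K, Real.exp_add, mul_comm]
      gcongr
      have h3 : Real.exp 1 - 1 ≤ 2 := by linarith [Real.exp_one_lt_three]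
      have h4 : 0 ≤ Real.exp 1 - 1 := by linarith [Real.add_one_le_exp 1]
      calc (1 + (Real.exp 1 - 1) * p ^ 2) ^ (n - 2) ≤ Real.exp (2 * p ^ 2) ^ (n - 2) := by
            refine pow_le_pow_left₀ (by positivity) ?_ _
            have := Real.add_one_le_exp (2 * p ^ 2)
            nlinarith [sq_nonneg p]
        _ ≤ Real.exp (2 * p ^ 2) ^ n :=
            pow_le_pow_right₀ (Real.one_le_exp (by positivity)) (Nat.sub_le _ _)
        _ = _ := by rw [← Real.exp_nat_mul]; congr 1; ring
  have h := (bernoulliProb_exists_le (s := vertexPairs V) hp0 hp1 univ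
    (fun (x : V × V) A ↦ x.1 ≠ x.2 ∧ K ≤ #{w | s(x.1, w) ∈ A ∧ s(x.2, w) ∈ A})).trans
    (sum_le_sum fun v _ ↦ key v)
  refine (bernoulliProb_mono hp0 hp1 fun A _ ⟨u, v, h⟩ ↦ ⟨(u, v), mem_univ _, h⟩).trans (h.trans ?_)
  simp [n, sq]

lemma bernoulliProb_exists_no_common_neighbor_le :
    bernoulliProb p (vertexPairs V)
      (fun A ↦ ∃ u v, u ≠ v ∧ ∀ w, ¬ (s(u, w) ∈ A ∧ s(v, w) ∈ A)) ≤
      Fintype.card V ^ 2 * (1 - p ^ 2) ^ (Fintype.card V - 2) := by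
  set n := Fintype.card V
  have hq : 0 ≤ 1 - p ^ 2 := by nlinarith
  have key : ∀ x : V × V, bernoulliProb p (vertexPairs V)
      (fun A ↦ x.1 ≠ x.2 ∧ ∀ w, ¬ (s(x.1, w) ∈ A ∧ s(x.2, w) ∈ A)) ≤ (1 - p ^ 2) ^ (n - 2) := by
    rintro ⟨u, v⟩
    simp only
    by_cases huv : u = v
    · refine le_trans (le_of_eq ?_) (pow_nonneg hq _)
      simp [huv, bernoulliProb]
    have h1 := bernoulliExp_prod_common_neighbor (p := p) huv 0
    rw [zero_sub, neg_one_mul, ← sub_eq_add_neg] at h1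
    rw [← h1]
    refine bernoulliProb_le_bernoulliExp hp0 hp1 (fun A _ ↦ prod_nonneg fun w _ ↦ ?_)
      fun A hA hle ↦ ?_
    · split_ifs <;> positivity
    · rw [prod_congr rfl fun w _ ↦ if_neg (hle.2 w), prod_const_one]
  have h := (bernoulliProb_exists_le (s := vertexPairs V) hp0 hp1 univ
    (fun (x : V × V) A ↦ x.1 ≠ x.2 ∧ ∀ w, ¬ (s(x.1, w) ∈ A ∧ s(x.2, w) ∈ A))).trans
    (sum_le_sum fun v _ ↦ key v)
  refine (bernoulliProb_mono hp0 hp1 fun A _ ⟨u, v, h⟩ ↦ ⟨(u, v), mem_univ _, h⟩).trans (h.trans ?_)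
  simp [n, sq]

/-- The exponent loses one because `v` may itself belong to `T`. -/
lemma bernoulliProb_exists_no_neighbor_le (T : Finset V) :
    bernoulliProb p (vertexPairs V) (fun A ↦ ∃ v, ∀ u ∈ T, s(v, u) ∉ A) ≤
      Fintype.card V * (1 - p) ^ (#T - 1) := by
  have hq := sub_nonneg.2 hp1
  have key : ∀ v : V, bernoulliProb p (vertexPairs V) (fun A ↦ ∀ u ∈ T, s(v, u) ∉ A) ≤
      (1 - p) ^ (#T - 1) := by
    intro v
    have h1 := bernoulliExp_filter_mem (p := p) (s := vertexPairs V) (S := T.erase v)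
      (e := fun u ↦ s(v, u)) (fun a _ b _ h ↦ Sym2.congr_right.1 h)
      (fun b hb ↦ by simpa using (ne_of_mem_erase hb).symm)
      (fun B ↦ if B = ∅ then 1 else 0)
    have h2 : bernoulliProb p (T.erase v) (fun B ↦ B = ∅) ≤ (1 - p) ^ (#T - 1) := by
      rw [bernoulliProb_empty]
      refine pow_le_pow_of_le_one hq (by linarith) ?_
      exact pred_card_le_card_erase
    refine le_trans (bernoulliProb_le_bernoulliExp hp0 hp1 (fun A _ ↦ ?_) fun A hA hle ↦ ?_)
      (h1.trans_le ((le_of_eq ?_).trans h2))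
    · split_ifs <;> norm_num
    · rw [if_pos]
      exact filter_eq_empty_iff.2 fun u hu ↦ hle u (mem_of_mem_erase hu)
    · exact bernoulliExp_congr fun B _ ↦ by congr
  have h := (bernoulliProb_exists_le (s := vertexPairs V) hp0 hp1 univ
    (fun v A ↦ ∀ u ∈ T, s(v, u) ∉ A)).trans (sum_le_sum fun v _ ↦ key v)
  refine (bernoulliProb_mono hp0 hp1 fun A _ ⟨v, h⟩ ↦ ⟨v, mem_univ _, h⟩).trans (h.trans ?_)
  simp

/-- Many edges at one vertex that lie in no triangle are unlikely. -/
lemma bernoulliProb_exists_triangle_free_star_le (k : ℕ) :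
    bernoulliProb p (vertexPairs V)
      (fun A ↦ ∃ v, k ≤ #{u | s(v, u) ∈ A ∧ ∀ w, ¬ (s(v, w) ∈ A ∧ s(u, w) ∈ A)}) ≤
      Fintype.card V * ((Fintype.card V).choose k *
        (p ^ k * (1 - p * (1 - (1 - p) ^ k)) ^ (Fintype.card V - 1 - k))) := by
  set n := Fintype.card V with hn
  have hq := sub_nonneg.2 hp1
  have hq0 : 0 ≤ (1 - p) ^ k := by positivity
  have hq1 : (1 - p) ^ k ≤ 1 := pow_le_one₀ hq (by linarith)
  have hq2 : 0 ≤ 1 - p * (1 - (1 - p) ^ k) := by nlinarith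
  have key : ∀ v : V, ∀ I ∈ powersetCard k (univ.erase v), bernoulliProb p (vertexPairs V)
      (fun A ↦ ∀ u ∈ I, s(v, u) ∈ A ∧ ∀ w, ¬ (s(v, w) ∈ A ∧ s(u, w) ∈ A)) ≤
      p ^ k * (1 - p * (1 - (1 - p) ^ k)) ^ (n - 1 - k) := by
    intro v I hI
    obtain ⟨hIv, hIk⟩ := mem_powersetCard.1 hI
    have hvI : v ∉ I := fun h ↦ notMem_erase v univ (hIv h)
    -- Grouping the pairs that meet `insert v I` by their endpoint `w ∉ I` makes the groups
    -- disjoint. The group of `w = v` contains the star itself; any other `w` closes a triangle when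
    -- it is joined to `v` and to some element of `I`.
    have h1 := bernoulliExp_prod_filter_mem (p := p) (s := vertexPairs V) (univ \ I)
      (fun w ↦ (insert v I).erase w) (fun w b ↦ s(b, w)) (fun w _ a _ b _ h ↦ Sym2.congr_left.1 h)
      (fun w hw b hb ↦ by
        rw [mk_mem_vertexPairs]
        exact ne_of_mem_erase hb)
      (fun w hw w' hw' hww' b hb b' hb' h ↦ by
        rcases Sym2.eq_iff.1 h with ⟨-, h⟩ | ⟨h, h'⟩
        · exact hww' h
        · have e1 := (mem_insert.1 (mem_of_mem_erase hb)).resolve_right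
            fun h3 ↦ (mem_sdiff.1 hw').2 (h ▸ h3)
          have e2 := (mem_insert.1 (mem_of_mem_erase hb')).resolve_right
            fun h3 ↦ (mem_sdiff.1 hw).2 (h' ▸ h3)
          exact hww' (by rw [h', e2, ← e1, h]))
      (fun w B ↦ if w = v then (if I ⊆ B then 1 else 0) else
        if v ∈ B ∧ ∃ i ∈ I, i ∈ B then 0 else 1)
    have hvmem : v ∈ univ \ I := mem_sdiff.2 ⟨mem_univ _, hvI⟩
    have h2 : bernoulliExp p ((insert v I).erase v) (fun B ↦ if I ⊆ B then 1 else 0) = p ^ k := by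
      rw [erase_insert hvI, ← hIk]
      have := bernoulliExp_superset (p := p) (Subset.refl I) fun _ ↦ 1
      rwa [bernoulliExp_const, mul_one] at this
    have h3 : ∀ w ∈ (univ \ I).erase v, bernoulliExp p ((insert v I).erase w)
        (fun B ↦ if w = v then (if I ⊆ B then 1 else 0) else
          if v ∈ B ∧ ∃ i ∈ I, i ∈ B then 0 else 1) = 1 - p * (1 - (1 - p) ^ k) := by
      intro w hw
      have hwv := ne_of_mem_erase hw
      have hwI : w ∉ insert v I := by
        rw [mem_insert, not_or]
        exact ⟨hwv, (mem_sdiff.1 (mem_of_mem_erase hw)).2⟩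
      rw [erase_eq_of_notMem hwI, bernoulliExp_insert hvI]
      simp only [if_neg hwv, mem_insert_self, true_and]
      rw [bernoulliExp_congr (g := fun _ ↦ 1), bernoulliExp_const]
      · have : bernoulliExp p I (fun A ↦ if ∃ i ∈ I, i ∈ insert v A then (0 : ℝ) else 1) =
            (1 - p) ^ k := by
          rw [← hIk, ← bernoulliProb_empty]
          refine bernoulliExp_congr fun A hA ↦ ?_
          by_cases hA0 : A = ∅
          · rw [if_pos hA0, if_neg]
            rintro ⟨i, hi, hi'⟩
            rw [hA0] at hi'
            rcases mem_insert.1 hi' with rfl | h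
            · exact hvI hi
            · simp at h
          · obtain ⟨i, hi⟩ := nonempty_iff_ne_empty.2 hA0
            rw [if_neg hA0, if_pos ⟨i, hA hi, mem_insert_of_mem hi⟩]
        rw [this]
        ring
      · intro A hA
        rw [if_neg]
        exact fun h ↦ hvI (hA h.1)
    rw [← mul_prod_erase _ _ hvmem, prod_congr rfl h3, prod_const] at h1
    simp only [if_true] at h1
    rw [h2, card_erase_of_mem hvmem, card_sdiff_of_subset (subset_univ _), hIk, card_univ,
      Nat.sub_right_comm] at h1
    rw [hn, ← h1]
    refine bernoulliProb_le_bernoulliExp hp0 hp1 (fun A _ ↦ prod_nonneg fun w _ ↦ ?_)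
      fun A hA hle ↦ le_of_eq (Eq.symm ?_)
    · split_ifs <;> norm_num
    · refine prod_eq_one fun w hw ↦ ?_
      split_ifs with hwv hsub hcon
      · rfl
      · refine absurd (fun i hi ↦ ?_) hsub
        rw [hwv, erase_insert hvI, mem_filter]
        exact ⟨hi, Sym2.eq_swap ▸ (hle i hi).1⟩
      · obtain ⟨h4, i, hi, h5⟩ := hcon
        exact absurd ⟨(mem_filter.1 h4).2, (mem_filter.1 h5).2⟩ ((hle i hi).2 w)
      · rfl
  have h1 : ∀ v : V, bernoulliProb p (vertexPairs V)
      (fun A ↦ k ≤ #{u | s(v, u) ∈ A ∧ ∀ w, ¬ (s(v, w) ∈ A ∧ s(u, w) ∈ A)}) ≤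
      n.choose k * (p ^ k * (1 - p * (1 - (1 - p) ^ k)) ^ (n - 1 - k)) := by
    intro v
    have h2 := (bernoulliProb_exists_le (s := vertexPairs V) hp0 hp1
      (powersetCard k (univ.erase v)) (fun I A ↦ ∀ u ∈ I, s(v, u) ∈ A ∧
        ∀ w, ¬ (s(v, w) ∈ A ∧ s(u, w) ∈ A))).trans (sum_le_sum fun I hI ↦ key v I hI)
    refine (bernoulliProb_mono hp0 hp1 fun A hA hle ↦ ?_).trans (h2.trans ?_)
    · obtain ⟨I, hI, hIk⟩ := exists_subset_card_eq hle
      have hI' : ∀ u ∈ I, s(v, u) ∈ A ∧ ∀ w, ¬ (s(v, w) ∈ A ∧ s(u, w) ∈ A) :=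
        fun u hu ↦ by simpa using hI hu
      refine ⟨I, mem_powersetCard.2 ⟨fun u hu ↦ mem_erase.2 ⟨?_, mem_univ _⟩, hIk⟩, hI'⟩
      exact (mk_mem_vertexPairs.1 (hA (hI' u hu).1)).symm
    · rw [sum_const, card_powersetCard, nsmul_eq_mul]
      gcongr
      exact card_le_univ _
  have h := (bernoulliProb_exists_le (s := vertexPairs V) hp0 hp1 univ
    (fun v A ↦ k ≤ #{u | s(v, u) ∈ A ∧ ∀ w, ¬ (s(v, w) ∈ A ∧ s(u, w) ∈ A)})).trans
    (sum_le_sum fun v _ ↦ h1 v)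
  refine (bernoulliProb_mono hp0 hp1 fun A _ ⟨v, h⟩ ↦ ⟨v, mem_univ _, h⟩).trans (h.trans ?_)
  simp [n]

/-- Few edges between `P` and `T` are incident to vertices of `T` with many neighbours in `P`. -/
lemma bernoulliProb_heavy_le {s : Finset (Sym2 V)} {P T : Finset V} (hPT : Disjoint P T)
    (hs : ∀ b ∈ P, ∀ w ∈ T, s(b, w) ∈ s) (t : ℝ) :
    bernoulliProb p s (fun A ↦ t ≤ ∑ w ∈ T, if Real.exp 2 * (p * #P) < #{b ∈ P | s(b, w) ∈ A}
      then (#{b ∈ P | s(b, w) ∈ A} : ℝ) else 0) ≤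
      Real.exp (-t) * (1 + Real.exp (-(p * #P))) ^ #T := by
  have h1 := bernoulliExp_prod_filter_mem (p := p) (s := s) T (fun _ ↦ P)
    (fun w b ↦ s(b, w)) (fun w _ a _ b _ h ↦ Sym2.congr_left.1 h) (fun w hw b hb ↦ hs b hb w hw)
    (fun w hw w' hw' hww' b hb b' hb' h ↦ by
      rcases Sym2.eq_iff.1 h with ⟨-, h⟩ | ⟨h, -⟩
      · exact hww' h
      · exact disjoint_left.1 hPT hb (h ▸ hw'))
    (fun _ B ↦ Real.exp (if Real.exp 2 * (p * #P) < #B then (#B : ℝ) else 0))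
  -- The threshold `e²` times the mean is chosen so that Markov's inequality with `exp (2 * #B)`
  -- leaves exactly `exp (-(p * #P))`.
  have h2 : bernoulliExp p P
      (fun B ↦ Real.exp (if Real.exp 2 * (p * #P) < #B then (#B : ℝ) else 0)) ≤
      1 + Real.exp (-(p * #P)) := by
    have h3 : bernoulliExp p P
        (fun B ↦ Real.exp (if Real.exp 2 * (p * #P) < #B then (#B : ℝ) else 0)) ≤
        bernoulliExp p P
          (fun B ↦ 1 + Real.exp (-(Real.exp 2 * (p * #P))) * Real.exp (2 * #B)) := by
      refine bernoulliExp_mono hp0 hp1 fun B _ ↦ ?_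
      rw [← Real.exp_add]
      split_ifs with h
      · have : Real.exp (#B : ℝ) ≤ Real.exp (-(Real.exp 2 * (p * #P)) + 2 * #B) := by
          rw [Real.exp_le_exp]
          linarith
        linarith
      · rw [Real.exp_zero]
        linarith [Real.exp_nonneg (-(Real.exp 2 * (p * #P)) + 2 * #B)]
    refine h3.trans ?_
    rw [bernoulliExp_add, bernoulliExp_const, bernoulliExp_const_mul]
    gcongr
    calc _ ≤ Real.exp (-(Real.exp 2 * (p * #P))) * Real.exp (p * #P * (Real.exp 2 - 1)) := by
          gcongr
          exact bernoulliExp_exp_card_le hp0 hp1 2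
      _ = _ := by rw [← Real.exp_add]; congr 1; ring
  calc _ ≤ bernoulliExp p s (fun A ↦ Real.exp (-t) * ∏ w ∈ T,
        Real.exp (if Real.exp 2 * (p * #P) < #{b ∈ P | s(b, w) ∈ A}
          then (#{b ∈ P | s(b, w) ∈ A} : ℝ) else 0)) := by
        refine bernoulliProb_le_bernoulliExp hp0 hp1 (fun A _ ↦ ?_) fun A _ hle ↦ ?_
        · exact mul_nonneg (Real.exp_nonneg _) (prod_nonneg fun w _ ↦ Real.exp_nonneg _)
        · rw [← Real.exp_sum, ← Real.exp_add, Real.one_le_exp_iff]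
          linarith
    _ ≤ _ := by
        rw [bernoulliExp_const_mul, h1, prod_const]
        gcongr
        exact bernoulliExp_nonneg hp0 hp1 fun B _ ↦ Real.exp_nonneg _

end Neighbourhoods

/-! ### Upper bounds for the clique chromatic number of the binomial random graph -/

lemma fromEdgeSet_adj_iff_mem {V : Type*} [Fintype V] [DecidableEq V] {A : Finset (Sym2 V)}
    (hA : A ⊆ vertexPairs V) {u v : V} :
    (SimpleGraph.fromEdgeSet (A : Set (Sym2 V))).Adj u v ↔ s(u, v) ∈ A := by
  rw [SimpleGraph.fromEdgeSet_adj, mem_coe, and_iff_left_iff_imp]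
  exact fun h ↦ mk_mem_vertexPairs.1 (hA h)

lemma eventually_mul_log_pow_le (c : ℝ) (a : ℕ) {b : ℝ} (hb : 0 < b) :
    ∀ᶠ n : ℕ in atTop, c * Real.log n ^ a ≤ (n : ℝ) ^ b := by
  have h := (isLittleO_log_rpow_rpow_atTop (a : ℝ) hb).comp_tendsto tendsto_natCast_atTop_atTop
  filter_upwards [h.bound (show (0 : ℝ) < 1 / (|c| + 1) by positivity), eventually_ge_atTop 1]
    with n hn hn1
  have hlog : 0 ≤ Real.log n := Real.log_natCast_nonneg n
  simp only [Function.comp_apply, Real.rpow_natCast, norm_pow, Real.norm_eq_abs,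
    abs_of_nonneg hlog, abs_of_nonneg (Real.rpow_nonneg (Nat.cast_nonneg n) b)] at hn
  have h1 : (|c| + 1) * Real.log n ^ a ≤ (n : ℝ) ^ b := by
    rw [div_mul_eq_mul_div, one_mul, le_div_iff₀ (by positivity)] at hn
    linarith
  have h2 : 0 ≤ Real.log n ^ a := by positivity
  nlinarith [le_abs_self c]

lemma eventually_le_log (c : ℝ) : ∀ᶠ n : ℕ in atTop, c ≤ Real.log n :=
  (Real.tendsto_log_atTop.comp tendsto_natCast_atTop_atTop).eventually_ge_atTop c

lemma exp_neg_mul_log {n : ℕ} (hn : 1 ≤ n) (k : ℕ) :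
    Real.exp (-(k * Real.log n)) = 1 / (n : ℝ) ^ k := by
  rw [Real.exp_neg, Real.exp_nat_mul, Real.exp_log (by positivity), one_div]

/-- Any fixed `k ≈ 3L/p` vertices dominate every vertex with high probability; the factor 3 more
than pays for the union over the vertices. -/
lemma cliqueChromaticNumber_dominating_whp : ∀ᶠ n : ℕ in atTop, ∀ p : ℝ, 0 < p → p ≤ 1 →
    bernoulliProb p (vertexPairs (Fin n)) (fun A ↦ ¬ (cliqueChromaticNumber
      (SimpleGraph.fromEdgeSet (A : Set (Sym2 (Fin n)))) : ℝ) ≤ 3 * Real.log n / p + 1) ≤ 3 / n := by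
  filter_upwards [eventually_ge_atTop 1] with n hn p hp0 hp1
  have hn0 : (0 : ℝ) < n := by exact_mod_cast hn
  have hn1 : (1 : ℝ) ≤ n := by exact_mod_cast hn
  set k := ⌈3 * Real.log n / p⌉₊ with hk
  have hlog : 0 ≤ Real.log n := Real.log_natCast_nonneg n
  have hk1 : (k : ℝ) ≤ 3 * Real.log n / p + 1 := (Nat.ceil_lt_add_one (by positivity)).le
  have hk2 : 3 * Real.log n / p ≤ k := Nat.le_ceil _
  -- If there are fewer than `k` vertices, giving each its own colour is enough.
  rcases lt_or_ge n k with hkn | hkn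
  · have : bernoulliProb p (vertexPairs (Fin n)) (fun A ↦ ¬ (cliqueChromaticNumber
      (SimpleGraph.fromEdgeSet (A : Set (Sym2 (Fin n)))) : ℝ) ≤ 3 * Real.log n / p + 1) ≤
      bernoulliProb p (vertexPairs (Fin n)) (fun _ ↦ False) := by
      refine bernoulliProb_mono hp0.le hp1 fun A _ h ↦ h (le_trans ?_ hk1)
      exact_mod_cast cliqueChromaticNumber_le_card.trans ((Fintype.card_fin n).le.trans hkn.le)
    refine this.trans ?_
    simp only [bernoulliProb, if_false, bernoulliExp_const]
    positivity
  · set T : Finset (Fin n) := univ.map (Fin.castLEEmb hkn) with hT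
    have hTk : #T = k := by simp [hT]
    have h1 := bernoulliProb_exists_no_neighbor_le hp0.le hp1 T
    rw [hTk, Fintype.card_fin] at h1
    refine (bernoulliProb_mono hp0.le hp1 fun A hA h ↦ ?_).trans (h1.trans ?_)
    · by_contra! hcon
      refine h (le_trans ?_ hk1)
      refine Nat.cast_le.2 (cliqueChromaticNumber_le_of_dominating (Fin.castLE hkn) fun v ↦ ?_)
      obtain ⟨u, hu, huA⟩ := hcon v
      obtain ⟨i, -, rfl⟩ := mem_map.1 hu
      exact ⟨i, (fromEdgeSet_adj_iff_mem hA).2 huA⟩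
    · have h2 : (1 - p) ^ (k - 1) ≤ 3 / (n : ℝ) ^ 3 := by
        calc (1 - p) ^ (k - 1) ≤ Real.exp (-p) ^ (k - 1) :=
              pow_le_pow_left₀ (sub_nonneg.2 hp1) (Real.one_sub_le_exp_neg p) _
          _ = Real.exp (-(p * (k - 1 : ℕ))) := by
              rw [← Real.exp_nat_mul]; congr 1; ring
          _ ≤ Real.exp (1 + -((3 : ℕ) * Real.log n)) := by
              rw [Real.exp_le_exp]
              have h3 : (k : ℝ) - 1 ≤ (k - 1 : ℕ) := by
                rw [sub_le_iff_le_add]; exact_mod_cast le_tsub_add (b := k) (a := 1)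
              rw [div_le_iff₀ hp0] at hk2
              push_cast
              nlinarith
          _ ≤ _ := by
              rw [Real.exp_add, exp_neg_mul_log hn, ← div_eq_mul_one_div]
              gcongr
              exact Real.exp_one_lt_three.le
      calc (n : ℝ) * (1 - p) ^ (k - 1) ≤ n * (3 / (n : ℝ) ^ 3) := by gcongr
        _ = 3 / n * (1 / n) := by field_simp
        _ ≤ 3 / n * 1 := by
            gcongr
            rw [div_le_one hn0]
            exact hn1
        _ = _ := mul_one _

/-! ### Sparse upper bound: degrees, triangles and triangle-free edges -/

/-- The order of magnitude of the upper bound for sparse random graphs. -/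
noncomputable def sparseScale (n : ℕ) (p : ℝ) : ℝ :=
  max (Real.log n) (max (Real.exp (-(n * p ^ 2)) * (n * p)) (p * √p * n * √(Real.log n)))

lemma degree_whp : ∀ᶠ n : ℕ in atTop, ∀ p : ℝ, 0 ≤ p → p ≤ 1 →
    bernoulliProb p (vertexPairs (Fin n))
      (fun A ↦ ∃ v, 2 * (n * p) + 2 * Real.log n ≤ #{u | s(v, u) ∈ A}) ≤ 1 / n := by
  filter_upwards [eventually_ge_atTop 1] with n hn p hp0 hp1
  have hn0 : (0 : ℝ) < n := by exact_mod_cast hn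
  have h1 := bernoulliProb_exists_degree_ge_le (V := Fin n) hp0 hp1 zero_le_one le_rfl
    (n * p + 2 * Real.log n)
  rw [Fintype.card_fin] at h1
  refine (bernoulliProb_mono hp0 hp1 fun A _ h ↦ ?_).trans (h1.trans ?_)
  · obtain ⟨v, hv⟩ := h
    exact ⟨v, by linarith⟩
  · rw [show (1 : ℝ) ^ 2 * (n * p) - 1 * (n * p + 2 * Real.log n) = -((2 : ℕ) * Real.log n) by
      push_cast; ring, exp_neg_mul_log hn]
    apply le_of_eq
    field_simp

lemma codegree_whp : ∀ᶠ n : ℕ in atTop, ∀ p : ℝ, 0 ≤ p → p ≤ 1 →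
    bernoulliProb p (vertexPairs (Fin n)) (fun A ↦ ∃ u v, u ≠ v ∧
      2 * (n * p ^ 2) + 3 * Real.log n ≤ #{w | s(u, w) ∈ A ∧ s(v, w) ∈ A}) ≤ 1 / n := by
  filter_upwards [eventually_ge_atTop 1] with n hn p hp0 hp1
  have hn0 : (0 : ℝ) < n := by exact_mod_cast hn
  have h1 := bernoulliProb_exists_codegree_ge_le (V := Fin n) hp0 hp1
    (2 * (n * p ^ 2) + 3 * Real.log n)
  rw [Fintype.card_fin] at h1
  refine h1.trans ?_
  rw [show 2 * (n * p ^ 2) - (2 * (n * p ^ 2) + 3 * Real.log n) = -((3 : ℕ) * Real.log n) by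
      push_cast; ring, exp_neg_mul_log hn]
  apply le_of_eq
  field_simp

lemma choose_le_pow_mul_exp {n k : ℕ} (hk : 0 < k) :
    (n.choose k : ℝ) ≤ (Real.exp 1 * n / k) ^ k := by
  have hk' : (0 : ℝ) < k := by exact_mod_cast hk
  have h1 := Real.pow_div_factorial_le_exp (k : ℝ) hk'.le k
  rw [div_le_iff₀ (by positivity)] at h1
  calc (n.choose k : ℝ) ≤ (n : ℝ) ^ k / k.factorial := Nat.choose_le_pow_div k n
    _ ≤ _ := by
      rw [div_pow, mul_pow, ← Real.exp_nat_mul, mul_one, div_le_div_iff₀ (by positivity)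
        (by positivity)]
      have : 0 ≤ (n : ℝ) ^ k := by positivity
      nlinarith

/-- The union bound for stars of edges in no triangle. -/
lemma triangle_free_star_bound_le {n k : ℕ} {p : ℝ} (hp0 : 0 ≤ p) (hp1 : p ≤ 1) (hk : 0 < k)
    (h1 : n * p ^ 2 * (p * k) ≤ 1) (hpk : p * k ≤ 1) (h2 : (1 + k) * p ^ 2 ≤ 1)
    (h3 : Real.exp 4 * (n * p) * Real.exp (-(n * p ^ 2)) ≤ k) :
    (n.choose k : ℝ) * (p ^ k * (1 - p * (1 - (1 - p) ^ k)) ^ (n - 1 - k)) ≤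
      Real.exp (-k) := by
  have hk' : (0 : ℝ) < k := by exact_mod_cast hk
  set x : ℝ := n * p ^ 2 with hx
  have hq := sub_nonneg.2 hp1
  -- An outside vertex misses all triangles of the star with probability about `1 - p² k`. Over all
  -- outside vertices this gives `exp (-k x)`, and the second-order correction `k * (x * (p * k))`
  -- is at most `k`.
  have e1 : (1 - p) ^ k ≤ 1 - p * k * (1 - p * k) := by
    calc (1 - p) ^ k ≤ Real.exp (-p) ^ k := pow_le_pow_left₀ hq (Real.one_sub_le_exp_neg p) _
      _ = (Real.exp (p * k))⁻¹ := by rw [← Real.exp_nat_mul, ← Real.exp_neg]; congr 1; ring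
      _ ≤ (p * k + 1)⁻¹ := by
          gcongr
          exact Real.add_one_le_exp _
      _ ≤ _ := by
          rw [inv_le_iff_one_le_mul₀ (by positivity)]
          have : 0 ≤ p * k := by positivity
          nlinarith [pow_nonneg this 3]
  have e2 : 1 - p * (1 - (1 - p) ^ k) ≤ Real.exp (-(p ^ 2 * k * (1 - p * k))) := by
    refine le_trans ?_ (Real.one_sub_le_exp_neg _)
    nlinarith
  have e0 : 0 ≤ 1 - p * (1 - (1 - p) ^ k) := by
    have : 0 ≤ (1 - p) ^ k := by positivity
    nlinarith
  have e3 : (1 - p * (1 - (1 - p) ^ k)) ^ (n - 1 - k) ≤ Real.exp (k * (2 - x)) := by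
    calc _ ≤ Real.exp (-(p ^ 2 * k * (1 - p * k))) ^ (n - 1 - k) := pow_le_pow_left₀ e0 e2 _
      _ = Real.exp (-((n - 1 - k : ℕ) * (p ^ 2 * k * (1 - p * k)))) := by
          rw [← Real.exp_nat_mul]; congr 1; ring
      _ ≤ _ := by
          rw [Real.exp_le_exp]
          have h4 : (n : ℝ) - (1 + k) ≤ (n - 1 - k : ℕ) := by
            rw [sub_le_iff_le_add, Nat.sub_sub]
            exact_mod_cast le_tsub_add
          have h5 : 0 ≤ p ^ 2 * k * (1 - p * k) :=
            mul_nonneg (by positivity) (by linarith)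
          have h6 := mul_le_mul_of_nonneg_right h4 h5
          have h7 : ((n : ℝ) - (1 + k)) * (p ^ 2 * k * (1 - p * k)) =
              k * (x - x * (p * k) - (1 + k) * p ^ 2 * (1 - p * k)) := by
            rw [hx]; ring
          have h8 : (1 + k) * p ^ 2 * (1 - p * k) ≤ 1 := by
            have : 0 ≤ (1 + (k : ℝ)) * p ^ 2 * (p * k) := by positivity
            nlinarith
          have h9 : (k : ℝ) * (x - 2) ≤ k * (x - x * (p * k) - (1 + k) * p ^ 2 * (1 - p * k)) := by
            exact mul_le_mul_of_nonneg_left (by linarith) hk'.le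
          linarith
  calc _ ≤ (Real.exp 1 * n / k) ^ k * (p ^ k * Real.exp (k * (2 - x))) := by
        gcongr
        exact choose_le_pow_mul_exp hk
    _ = (Real.exp 1 * n / k * p * Real.exp (2 - x)) ^ k := by
        rw [Real.exp_nat_mul, mul_pow, mul_pow, mul_assoc]
    _ ≤ Real.exp (-1) ^ k := by
        gcongr
        rw [div_mul_eq_mul_div, div_mul_eq_mul_div, div_le_iff₀ hk']
        calc Real.exp 1 * n * p * Real.exp (2 - x) =
            Real.exp (-1) * (Real.exp 4 * (n * p) * Real.exp (-x)) := by
              have : Real.exp 1 * Real.exp (2 - x) =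
                  Real.exp (-1) * (Real.exp 4 * Real.exp (-x)) := by
                rw [← Real.exp_add, ← Real.exp_add, ← Real.exp_add]; congr 1; ring
              linear_combination n * p * this
          _ ≤ _ := by gcongr
    _ = _ := by rw [← Real.exp_nat_mul]; congr 1; ring

lemma exp_four_le : Real.exp 4 ≤ 81 := by
  have h := Real.exp_one_lt_three.le
  calc Real.exp 4 = Real.exp 1 ^ 4 := by rw [← Real.exp_nat_mul]; norm_num
    _ ≤ 3 ^ 4 := by gcongr
    _ = 81 := by norm_num

/-- Three ranges of `x`. For bounded `x` the scale already dominates the degrees, which explains the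
constant `exp 100`; up to `3L` the union bound over stars applies; beyond `3L` any two vertices have
a common neighbour, so there are no such edges. -/
lemma triangle_free_star_whp : ∀ᶠ n : ℕ in atTop, ∀ p : ℝ, 0 ≤ p → p ≤ 1 →
    bernoulliProb p (vertexPairs (Fin n)) (fun A ↦ ∃ v, (4 * Real.exp 100) * sparseScale n p <
      #{u | s(v, u) ∈ A ∧ ∀ w, ¬ (s(v, w) ∈ A ∧ s(u, w) ∈ A)}) ≤ 9 / n := by
  filter_upwards [degree_whp, eventually_ge_atTop 1, eventually_le_log 1,
    eventually_mul_log_pow_le 10000 5 zero_lt_one] with n hdeg hn hL hLn p hp0 hp1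
  rw [Real.rpow_one] at hLn
  have hn0 : (0 : ℝ) < n := by exact_mod_cast hn
  set x : ℝ := n * p ^ 2 with hx
  set L := Real.log n with hLdef
  have hx0 : 0 ≤ x := by positivity
  set M := sparseScale n p with hM
  have hM1 : L ≤ M := le_max_left _ _
  have hM2 : Real.exp (-x) * (n * p) ≤ M := (le_max_left _ _).trans (le_max_right _ _)
  have h100 : (1000 : ℝ) ≤ Real.exp 100 := by
    have := Real.pow_div_factorial_le_exp (100 : ℝ) (by norm_num) 2
    norm_num [Nat.factorial] at this
    linarith
  rcases le_or_gt x 100 with hx1 | hx1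
  · refine (bernoulliProb_mono hp0 hp1 fun A _ ⟨v, hv⟩ ↦ ⟨v, ?_⟩).trans
      ((hdeg p hp0 hp1).trans (by gcongr; norm_num))
    have h1 : (#{u | s(v, u) ∈ A ∧ ∀ w, ¬ (s(v, w) ∈ A ∧ s(u, w) ∈ A)} : ℝ) ≤
        #{u | s(v, u) ∈ A} := by
      exact_mod_cast card_le_card fun u hu ↦ by
        simp only [mem_filter, mem_univ, true_and] at hu ⊢
        exact hu.1
    refine le_trans ?_ (hv.le.trans h1)
    have h2 : n * p ≤ Real.exp 100 * M := by
      have : Real.exp 100 * (Real.exp (-x) * (n * p)) ≤ Real.exp 100 * M := by gcongr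
      refine le_trans ?_ this
      rw [← mul_assoc, ← Real.exp_add]
      have : 1 ≤ Real.exp (100 + -x) := Real.one_le_exp (by linarith)
      nlinarith [show 0 ≤ n * p by positivity]
    nlinarith
  rcases le_or_gt x (3 * L) with hx2 | hx2
  · set k := ⌈max (Real.exp 4 * (n * p) * Real.exp (-x)) (3 * L)⌉₊ with hk
    have hkr := Nat.le_ceil (max (Real.exp 4 * (n * p) * Real.exp (-x)) (3 * L))
    have hk1 : Real.exp 4 * (n * p) * Real.exp (-x) ≤ k := (le_max_left _ _).trans hkr
    have hk2 : 3 * L ≤ k := (le_max_right _ _).trans hkr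
    have hk3 : (k : ℝ) ≤ Real.exp 4 * (n * p) * Real.exp (-x) + 3 * L + 1 := by
      refine (Nat.ceil_lt_add_one (by positivity)).le.trans ?_
      have : max (Real.exp 4 * (n * p) * Real.exp (-x)) (3 * L) ≤
          Real.exp 4 * (n * p) * Real.exp (-x) + 3 * L :=
        max_le_add_of_nonneg (by positivity) (by positivity)
      linarith
    have hkpos : 0 < k := by
      have : (0 : ℝ) < k := by linarith
      exact_mod_cast this
    have hp2 : p ^ 2 ≤ 3 * L / n := by
      rw [le_div_iff₀ hn0]
      linarith
    have hL5 : L ≤ L ^ 5 := le_self_pow₀ hL (by norm_num)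
    have hp2' : p ^ 2 ≤ 1 / 2 := by
      refine hp2.trans ?_
      rw [div_le_iff₀ hn0]
      linarith
    -- The left side equals `e⁴ x² / e^x`, which is small since `x > 100`.
    have a1 : x * p * (Real.exp 4 * (n * p) * Real.exp (-x)) ≤ 1 / 3 := by
      have h4 := Real.pow_div_factorial_le_exp x hx0 4
      norm_num [Nat.factorial] at h4
      have h5 : x * p * (Real.exp 4 * (n * p) * Real.exp (-x)) =
          Real.exp 4 * x ^ 2 / Real.exp x := by
        rw [Real.exp_neg, hx]; ring
      rw [h5, div_le_iff₀ (Real.exp_pos x)]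
      have h6 : Real.exp 4 * x ^ 2 ≤ 81 * x ^ 2 := by
        gcongr
        exact exp_four_le
      nlinarith [sq_nonneg x, mul_le_mul hx1.le hx1.le (by norm_num) hx0]
    have a2 : x * p * (3 * L + 1) ≤ 2 / 3 := by
      have h4 : (x * p * (3 * L + 1)) ^ 2 ≤ (2 / 3) ^ 2 := by
        calc (x * p * (3 * L + 1)) ^ 2 = x ^ 2 * p ^ 2 * (3 * L + 1) ^ 2 := by ring
          _ ≤ (3 * L) ^ 2 * (3 * L / n) * (4 * L) ^ 2 := by
              gcongr
              linarith
          _ = 432 * L ^ 5 / n := by ring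
          _ ≤ (2 / 3) ^ 2 := by
              rw [div_le_iff₀ hn0]
              linarith
      exact (sq_le_sq₀ (by positivity) (by norm_num)).1 h4
    have a3 : x * (p * k) ≤ 1 := by
      have : x * p * k ≤ x * p * (Real.exp 4 * (n * p) * Real.exp (-x) + 3 * L + 1) := by gcongr
      linarith
    have a4 : p * k ≤ 1 / 100 := by
      have : 0 ≤ p * k := by positivity
      nlinarith
    have a5 : (1 + k) * p ^ 2 ≤ 1 := by
      have : p * k * p ≤ 1 / 100 * 1 := by gcongr
      nlinarith
    have h5 := triangle_free_star_bound_le hp0 hp1 hkpos a3 (by linarith) a5 hk1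
    have h6 := bernoulliProb_exists_triangle_free_star_le (V := Fin n) hp0 hp1 k
    rw [Fintype.card_fin] at h6
    refine (bernoulliProb_mono hp0 hp1 fun A _ h ↦ ?_).trans (h6.trans ?_)
    · obtain ⟨v, hv⟩ := h
      refine ⟨v, ?_⟩
      have : (k : ℝ) < #{u | s(v, u) ∈ A ∧ ∀ w, ¬ (s(v, w) ∈ A ∧ s(u, w) ∈ A)} := by
        refine lt_of_le_of_lt ?_ hv
        have h7 : Real.exp 4 * (n * p) * Real.exp (-x) ≤ 81 * M := by
          have := mul_le_mul exp_four_le hM2 (by positivity) (by norm_num)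
          linarith
        nlinarith
      convert Nat.cast_le.1 this.le
    · calc _ ≤ n * Real.exp (-k) := by gcongr
        _ ≤ n * Real.exp (-((3 : ℕ) * L)) := by
            gcongr
            exact_mod_cast hk2
        _ = 1 / n * (1 / n) := by rw [exp_neg_mul_log hn]; field_simp
        _ ≤ 9 / n * 1 := by
            gcongr
            · norm_num
            · rw [div_le_one hn0]
              exact_mod_cast hn
        _ = _ := mul_one _
  · have h6 := bernoulliProb_exists_no_common_neighbor_le (V := Fin n) hp0 hp1
    rw [Fintype.card_fin] at h6
    refine (bernoulliProb_mono hp0 hp1 fun A hA h ↦ ?_).trans (h6.trans ?_)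
    · obtain ⟨v, hv⟩ := h
      have : (0 : ℝ) < #{u | s(v, u) ∈ A ∧ ∀ w, ¬ (s(v, w) ∈ A ∧ s(u, w) ∈ A)} := by
        refine lt_of_le_of_lt ?_ hv
        have : 0 ≤ M := by linarith
        positivity
      obtain ⟨u, hu⟩ := card_pos.1 (Nat.cast_pos.1 this)
      simp only [mem_filter, mem_univ, true_and] at hu
      exact ⟨v, u, mk_mem_vertexPairs.1 (hA hu.1), hu.2⟩
    · calc (n : ℝ) ^ 2 * (1 - p ^ 2) ^ (n - 2) ≤ n ^ 2 * Real.exp (-p ^ 2) ^ (n - 2) := by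
            gcongr
            · nlinarith
            · exact Real.one_sub_le_exp_neg _
        _ = n ^ 2 * Real.exp (-((n - 2 : ℕ) * p ^ 2)) := by
            rw [← Real.exp_nat_mul]; congr 2; ring
        _ ≤ n ^ 2 * Real.exp (2 + -((3 : ℕ) * L)) := by
            gcongr
            have h4 : (n : ℝ) - 2 ≤ (n - 2 : ℕ) := by
              rw [sub_le_iff_le_add]
              exact_mod_cast le_tsub_add
            have h5 := mul_le_mul_of_nonneg_right h4 (sq_nonneg p)
            push_cast
            nlinarith
        _ ≤ n ^ 2 * (9 * (1 / (n : ℝ) ^ 3)) := by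
            rw [Real.exp_add, exp_neg_mul_log hn]
            gcongr
            have := Real.exp_one_lt_three.le
            calc Real.exp 2 = Real.exp 1 ^ 2 := by rw [← Real.exp_nat_mul]; norm_num
              _ ≤ 3 ^ 2 := by gcongr
              _ = 9 := by norm_num
        _ = _ := by field_simp

/-- A vertex lies in at most degree times codegree many ordered triangles. Together with the bound
on triangle-free edges this verifies the hypotheses of `cliqueChromaticNumber_le_of_triangles`. -/
lemma cliqueChromaticNumber_sparse_whp : ∀ᶠ n : ℕ in atTop, ∀ p : ℝ, 0 ≤ p → p ≤ 1 →
    bernoulliProb p (vertexPairs (Fin n)) (fun A ↦ ¬ (cliqueChromaticNumber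
      (SimpleGraph.fromEdgeSet (A : Set (Sym2 (Fin n)))) : ℝ) ≤
        (16 * Real.exp 100 + 31) * sparseScale n p) ≤ 11 / n := by
  classical
  filter_upwards [degree_whp, codegree_whp, triangle_free_star_whp, eventually_ge_atTop 1,
    eventually_le_log 1, eventually_mul_log_pow_le 1 2 zero_lt_one]
    with n hdeg hcod hstar hn hL hLn p hp0 hp1
  rw [Real.rpow_one, one_mul] at hLn
  have hn0 : (0 : ℝ) < n := by exact_mod_cast hn
  have hstar := hstar p hp0 hp1
  have hcod := hcod p hp0 hp1
  have hdeg := hdeg p hp0 hp1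
  set x : ℝ := n * p ^ 2 with hx
  set L := Real.log n with hLdef
  set M := sparseScale n p with hM
  have hM1 : L ≤ M := le_max_left _ _
  have hM2 : Real.exp (-x) * (n * p) ≤ M := (le_max_left _ _).trans (le_max_right _ _)
  have hM3 : p * √p * n * √L ≤ M := (le_max_right _ _).trans (le_max_right _ _)
  have hx0 : 0 ≤ x := by positivity
  -- For `x ≥ 1` the product is of order `np * x * L`, the square of the term `p^{3/2} n √L` of the
  -- scale. For `x ≤ 1` both `np` and `L` are themselves at most of order `M`.
  have hdK : 8 * ((2 * (n * p) + 2 * L) * (2 * x + 3 * L)) ≤ (30 * M) ^ 2 := by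
    rcases le_total 1 x with hx1 | hx1
    · have h1 : L ≤ n * p := by
        refine le_of_sq_le_sq ?_ (by positivity)
        calc L ^ 2 ≤ n := hLn
          _ ≤ n * x := le_mul_of_one_le_right hn0.le hx1
          _ = (n * p) ^ 2 := by rw [hx]; ring
      have h2 : (n * p) * x * L = (p * √p * n * √L) ^ 2 := by
        rw [mul_pow, mul_pow, mul_pow, Real.sq_sqrt hp0, Real.sq_sqrt (by linarith), hx]; ring
      have h3 : (p * √p * n * √L) ^ 2 ≤ M ^ 2 := by gcongr
      have h4 : 2 * x + 3 * L ≤ 5 * (x * L) := by nlinarith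
      have h5 : (2 * (n * p) + 2 * L) * (2 * x + 3 * L) ≤ (4 * (n * p)) * (5 * (x * L)) := by
        gcongr
        linarith
      nlinarith
    · have h1 : n * p ≤ 3 * M := by
        have h3 : 1 ≤ 3 * Real.exp (-x) := by
          have : Real.exp (-1) ≤ Real.exp (-x) := Real.exp_le_exp.2 (by linarith)
          have h4 : Real.exp (-1) * Real.exp 1 = 1 := by rw [← Real.exp_add]; simp
          nlinarith [Real.exp_one_lt_three, Real.exp_pos (-1)]
        have : 0 ≤ n * p := by positivity
        nlinarith
      have h2 : (2 * (n * p) + 2 * L) * (2 * x + 3 * L) ≤ (8 * M) * (5 * M) := by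
        gcongr <;> linarith
      nlinarith
  set C := 16 * Real.exp 100 + 30 with hC
  have hCpos : 0 < C := by positivity
  set k := ⌈C * M⌉₊ with hk
  have hk1 : C * M ≤ k := Nat.le_ceil _
  have hk2 : (k : ℝ) ≤ C * M + 1 := (Nat.ceil_lt_add_one (by nlinarith)).le
  have hkpos : 0 < k := by
    have : (0 : ℝ) < k := lt_of_lt_of_le (by nlinarith) hk1
    exact_mod_cast this
  refine (bernoulliProb_mono hp0 hp1 (Q := fun A ↦ (∃ v, 2 * (n * p) + 2 * L ≤ #{u | s(v, u) ∈ A}) ∨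
    (∃ u v, u ≠ v ∧ 2 * x + 3 * L ≤ #{w | s(u, w) ∈ A ∧ s(v, w) ∈ A}) ∨
    (∃ v, (4 * Real.exp 100) * M < #{u | s(v, u) ∈ A ∧ ∀ w, ¬ (s(v, w) ∈ A ∧ s(u, w) ∈ A)}))
    fun A hA h ↦ ?_).trans ?_
  · by_contra hcon
    simp only [not_or, not_exists, not_and, not_le, not_lt] at hcon
    obtain ⟨h1, h2, h3⟩ := hcon
    refine h (le_trans (Nat.cast_le.2 (cliqueChromaticNumber_le_of_triangles (k := k)
      (D := 4 * Real.exp 100 * M) (Δ := (2 * (n * p) + 2 * L) * (2 * x + 3 * L))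
      hkpos (fun v ↦ ?_) (fun v ↦ ?_) ?_ ?_)) (hk2.trans ?_))
    · simp only [fromEdgeSet_adj_iff_mem hA]
      simpa only [not_and] using h3 v
    · simp only [fromEdgeSet_adj_iff_mem hA]
      have h4 : (univ.filter fun y : Fin n × Fin n ↦ s(v, y.1) ∈ A ∧ s(v, y.2) ∈ A ∧ s(y.1, y.2) ∈ A) ⊆
          (univ.filter fun u ↦ s(v, u) ∈ A).biUnion fun u ↦
            (univ.filter fun w ↦ s(v, w) ∈ A ∧ s(u, w) ∈ A).image fun w ↦ (u, w) := by
        rintro ⟨a, b⟩ hab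
        simp only [mem_filter, mem_univ, true_and, mem_biUnion, mem_image] at hab ⊢
        exact ⟨a, hab.1, b, hab.2, rfl⟩
      have h5 := (card_le_card h4).trans card_biUnion_le
      have h6 : ∀ u ∈ univ.filter fun u ↦ s(v, u) ∈ A,
          (#((univ.filter fun w ↦ s(v, w) ∈ A ∧ s(u, w) ∈ A).image fun w ↦ (u, w)) : ℝ) ≤
            2 * x + 3 * L := by
        intro u hu
        refine (Nat.cast_le.2 card_image_le).trans (h2 v u ?_).le
        exact mk_mem_vertexPairs.1 (hA (mem_filter.1 hu).2)
      refine (Nat.cast_le.2 h5).trans ?_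
      rw [Nat.cast_sum]
      refine (sum_le_sum h6).trans ?_
      rw [sum_const, nsmul_eq_mul]
      exact mul_le_mul_of_nonneg_right (h1 v).le (by positivity)
    · nlinarith
    · refine hdK.trans ?_
      have : 30 * M ≤ k := le_trans (by nlinarith [Real.exp_pos 100]) hk1
      have : 0 ≤ 30 * M := by linarith
      gcongr
    · rw [hC]
      linarith
  · refine (bernoulliProb_or_le hp0 hp1).trans ?_
    have := (bernoulliProb_or_le (s := vertexPairs (Fin n)) hp0 hp1
      (P := fun A ↦ ∃ u v, u ≠ v ∧ 2 * x + 3 * L ≤ #{w | s(u, w) ∈ A ∧ s(v, w) ∈ A})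
      (Q := fun A ↦ ∃ v, (4 * Real.exp 100) * M <
        #{u | s(v, u) ∈ A ∧ ∀ w, ¬ (s(v, w) ∈ A ∧ s(u, w) ∈ A)}))
    have h11 : (11 : ℝ) / n = 1 / n + (1 / n + 9 / n) := by ring
    linarith

/-! ### A lower bound from edges without common neighbours -/

section UncoveredEdges

variable {V : Type*} [Fintype V] [DecidableEq V] {p : ℝ}

/-- The probability that a vertex `a` has no neighbour `b ∈ P` such that no neighbour of `a` in `T`
lies in the given set `N b`. -/
lemma bernoulliProb_no_uncovered_neighbor_le (hp0 : 0 ≤ p) (hp1 : p ≤ 1) {P T : Finset V}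
    (hTP : Disjoint T P) (N : V → Finset V) (hN : ∀ b, N b ⊆ T) :
    bernoulliProb p (T ∪ P) (fun R ↦ ∀ b ∈ P, b ∈ R → ∃ w ∈ N b, w ∈ R) ≤
      Real.exp (-(p * ∑ b ∈ P, (1 - p) ^ #(N b)) + p * ∑ w ∈ T,
        (Real.exp (p * #{b ∈ P | w ∈ N b}) - 1 - p * #{b ∈ P | w ∈ N b})) := by
  rw [bernoulliProb_union hTP]
  -- If `R` is the set of neighbours of `a` in `T`, then `Z R` consists of the `b ∈ P` having no
  -- common neighbour with `a` in `T`. The event forbids `a` from being joined to any of them.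
  set Z : Finset V → Finset V := fun R ↦ {b ∈ P | Disjoint (N b) R} with hZ
  have h1 : ∀ R ⊆ T, bernoulliProb p P (fun B ↦ ∀ b ∈ P, b ∈ R ∪ B → ∃ w ∈ N b, w ∈ R ∪ B) ≤
      Real.exp (-(p * (#(Z R) : ℝ))) := by
    intro R hR
    calc _ ≤ bernoulliProb p P (fun B ↦ B ∩ Z R = ∅) := by
          refine bernoulliProb_mono hp0 hp1 fun B hB h ↦ ?_
          by_contra hne
          obtain ⟨b, hb⟩ := nonempty_iff_ne_empty.2 hne
          obtain ⟨hbB, hbZ⟩ := mem_inter.1 hb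
          obtain ⟨hbP, hbd⟩ := mem_filter.1 hbZ
          obtain ⟨w, hw, hw'⟩ := h b hbP (mem_union_right _ hbB)
          rcases mem_union.1 hw' with h' | h'
          · exact disjoint_left.1 hbd hw h'
          · exact disjoint_left.1 hTP (hN b hw) (hB h')
      _ = (1 - p) ^ #(Z R) := by
          rw [bernoulliProb_inter (t := Z R) (filter_subset _ _) (fun B ↦ B = ∅),
            bernoulliProb_empty]
      _ ≤ Real.exp (-p) ^ #(Z R) :=
          pow_le_pow_left₀ (sub_nonneg.2 hp1) (Real.one_sub_le_exp_neg p) _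
      _ = _ := by rw [← Real.exp_nat_mul]; congr 1; ring
  refine (bernoulliExp_mono hp0 hp1 h1).trans ?_
  -- The count `#(Z R)` decreases in `R`, and adding `w` removes at most the `b` with `w ∈ N b`.
  have h2 := bernoulliExp_exp_neg_le (s := T) (f := fun R ↦ (#(Z R) : ℝ)) hp0 hp1 hp0
    (fun w ↦ (#{b ∈ P | w ∈ N b} : ℝ)) (fun w _ R ↦ ?_) (fun w _ R ↦ ?_)
  · have h3 : bernoulliExp p T (fun R ↦ (#(Z R) : ℝ)) = ∑ b ∈ P, (1 - p) ^ #(N b) := by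
      simp only [hZ, card_filter, Nat.cast_sum, Nat.cast_ite, Nat.cast_one, Nat.cast_zero]
      rw [bernoulliExp_sum]
      refine sum_congr rfl fun b _ ↦ ?_
      rw [← bernoulliProb_empty, ← bernoulliProb_inter (hN b)]
      refine bernoulliExp_congr fun R _ ↦ ?_
      simp only [disjoint_iff_inter_eq_empty, inter_comm]
      congr
    rwa [h3] at h2
  · refine Nat.cast_le.2 (card_le_card fun b hb ↦ ?_)
    simp only [hZ, mem_filter] at hb ⊢
    exact ⟨hb.1, disjoint_of_subset_right (subset_insert _ _) hb.2⟩
  · rw [← Nat.cast_add, Nat.cast_le]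
    refine (card_le_card fun b hb ↦ ?_).trans (card_union_le _ _)
    simp only [hZ, mem_filter, mem_union, disjoint_insert_right] at hb ⊢
    tauto

/-- The inequality `exp (-(q + q ^ 2)) ≤ 1 - q` for `q ≤ 1/2` converts an upper bound on degrees
into a lower bound on the expected number of uncovered pairs. -/
lemma one_sub_pow_ge {q d : ℝ} {k : ℕ} (hp0 : 0 ≤ q) (hp1 : q ≤ 1 / 2) (hk : k ≤ d) :
    Real.exp (-((q + q ^ 2) * d)) ≤ (1 - q) ^ k := by
  have h1 : Real.exp (-(q + q ^ 2)) ≤ 1 - q := by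
    rw [Real.exp_neg, inv_le_comm₀ (Real.exp_pos _) (by linarith)]
    refine le_trans ?_ (Real.quadratic_le_exp_of_nonneg (by positivity))
    rw [inv_le_iff_one_le_mul₀ (by linarith)]
    nlinarith [pow_nonneg hp0 3, pow_nonneg hp0 4, mul_nonneg (pow_nonneg hp0 2)
      (sub_nonneg.2 hp1), mul_nonneg (pow_nonneg hp0 3) (sub_nonneg.2 hp1),
      mul_nonneg (pow_nonneg hp0 4) (sub_nonneg.2 hp1)]
  calc Real.exp (-((q + q ^ 2) * d)) ≤ Real.exp (-((q + q ^ 2) * k)) := by gcongr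
    _ = Real.exp (-(q + q ^ 2)) ^ k := by rw [← Real.exp_nat_mul]; congr 1; ring
    _ ≤ _ := by gcongr

/-- Splitting the second-order terms into those of light and of heavy vertices. -/
lemma sum_exp_sub_le {T : Finset V} {c : V → ℝ} {y d t q n : ℝ} (hq : 0 ≤ q) (hc0 : ∀ w, 0 ≤ c w)
    (hcd : ∀ w ∈ T, c w ≤ d) (hqy : q * y ≤ 1) (hn : #T ≤ n)
    (ht : (∑ w ∈ T, if y < c w then c w else 0) ≤ t) :
    ∑ w ∈ T, (Real.exp (q * c w) - 1 - q * c w) ≤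
      n * (q * y) ^ 2 + q * t * Real.exp (q * d) := by
  have h1 : ∀ w ∈ T, Real.exp (q * c w) - 1 - q * c w ≤
      (q * y) ^ 2 + q * (if y < c w then c w else 0) * Real.exp (q * d) := by
    intro w hw
    have h0 : 0 ≤ q * c w := mul_nonneg hq (hc0 w)
    split_ifs with h
    · have h2 : Real.exp (q * c w) - 1 ≤ q * c w * Real.exp (q * c w) := by
        have h3 := Real.add_one_le_exp (-(q * c w))
        have h4 : Real.exp (-(q * c w)) * Real.exp (q * c w) = 1 := by
          rw [← Real.exp_add]; simp
        nlinarith [Real.exp_pos (q * c w)]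
      have h3 : q * c w * Real.exp (q * c w) ≤ q * c w * Real.exp (q * d) := by
        gcongr
        exact hcd w hw
      nlinarith [sq_nonneg (q * y)]
    · have h2 : q * c w ≤ q * y := by gcongr; linarith
      have h3 := Real.exp_sub_one_le_add_sq h0 (h2.trans hqy)
      have h4 : (q * c w) ^ 2 ≤ (q * y) ^ 2 := by gcongr
      linarith
  refine (sum_le_sum h1).trans ?_
  rw [sum_add_distrib, sum_const, nsmul_eq_mul, ← sum_mul, ← mul_sum]
  gcongr

set_option maxHeartbeats 1000000 in
/-- The probability that all edges between two given sets `P` and `Q` have common neighbours in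
the set `T`, with all degrees bounded by `d`. -/
lemma bernoulliProb_edges_covered_le (hp0 : 0 ≤ p) (hp1 : p ≤ 1 / 2) {P Q T : Finset V} {m : ℕ}
    (hPQ : Disjoint P Q) (hTP : Disjoint T P) (hTQ : Disjoint T Q) (hP : #P = m) (hQ : #Q = m)
    {d t : ℝ} (hm : Real.exp 2 * (p * m) * p ≤ 1) :
    bernoulliProb p (vertexPairs V) (fun A ↦ (∀ v, (#{u | s(v, u) ∈ A} : ℝ) ≤ d) ∧
      ∀ a ∈ Q, ∀ b ∈ P, s(a, b) ∈ A → ∃ w ∈ T, s(a, w) ∈ A ∧ s(b, w) ∈ A) ≤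
      Real.exp (-t) * (1 + Real.exp (-(p * m))) ^ #T +
        Real.exp (-(p * (m * Real.exp (-((p + p ^ 2) * d))) + -(p * (Fintype.card V *
          (p * (Real.exp 2 * (p * m))) ^ 2 + p * t * Real.exp (p * d))))) ^ m := by
  have hp1' : p ≤ 1 := by linarith
  set κ := Real.exp (-(p * (m * Real.exp (-((p + p ^ 2) * d))) + -(p * (Fintype.card V *
          (p * (Real.exp 2 * (p * m))) ^ 2 + p * t * Real.exp (p * d))))) with hκ
  have hheavy := bernoulliProb_heavy_le hp0 hp1' hTP.symm (s := vertexPairs V) (fun b hb w hw ↦ by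
    rw [mk_mem_vertexPairs]
    rintro rfl
    exact disjoint_left.1 hTP hw hb) t
  rw [hP] at hheavy
  set Bad : Finset (Sym2 V) → Prop := fun A ↦ (∀ v, (#{u | s(v, u) ∈ A} : ℝ) ≤ d) ∧
      ∀ a ∈ Q, ∀ b ∈ P, s(a, b) ∈ A → ∃ w ∈ T, s(a, w) ∈ A ∧ s(b, w) ∈ A with hBad
  set Hv : Finset (Sym2 V) → ℝ := fun A ↦ ∑ w ∈ T, if Real.exp 2 * (p * m) <
    #{b ∈ P | s(b, w) ∈ A} then (#{b ∈ P | s(b, w) ∈ A} : ℝ) else 0 with hHv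
  have hsplit : bernoulliProb p (vertexPairs V) Bad ≤
      bernoulliProb p (vertexPairs V) (fun A ↦ t ≤ Hv A) +
      bernoulliProb p (vertexPairs V) (fun A ↦ Hv A ≤ t ∧ Bad A) := by
    refine (bernoulliProb_mono hp0 hp1' fun A _ hA ↦ ?_).trans (bernoulliProb_or_le hp0 hp1')
    rcases le_total t (Hv A) with h | h
    · exact Or.inl h
    · exact Or.inr ⟨h, hA⟩
  refine hsplit.trans (add_le_add hheavy ?_)
  -- The pairs between `P` and `T` are revealed first. Given these, the events for different
  -- vertices of `Q` depend on disjoint sets of pairs, whence the power `κ ^ m`.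
  set E := (P ×ˢ T).image fun x ↦ s(x.1, x.2) with hE
  have hEs : E ⊆ vertexPairs V := by
    rw [hE, image_subset_iff]
    rintro ⟨b, w⟩ hx
    obtain ⟨hb, hw⟩ := mem_product.1 hx
    rw [mk_mem_vertexPairs]
    rintro h
    exact disjoint_left.1 hTP hw (h ▸ hb)
  rw [← union_sdiff_of_subset hEs, bernoulliProb_union disjoint_sdiff]
  have hmain : ∀ A ⊆ E, bernoulliProb p (vertexPairs V \ E)
      (fun B ↦ Hv (A ∪ B) ≤ t ∧ Bad (A ∪ B)) ≤ κ ^ m := by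
    intro A hAE
    set N : V → Finset V := fun b ↦ {w ∈ T | s(b, w) ∈ A} with hN
    have hAB : ∀ B ⊆ vertexPairs V \ E, ∀ b ∈ P, ∀ w ∈ T, s(b, w) ∈ A ∪ B ↔ s(b, w) ∈ A := by
      intro B hB b hb w hw
      rw [mem_union, or_iff_left_iff_imp]
      exact fun h ↦ absurd (mem_image.2 ⟨(b, w), mem_product.2 ⟨hb, hw⟩, rfl⟩)
        (Finset.mem_sdiff.1 (hB h)).2
    have haE : ∀ a ∈ Q, ∀ u, s(a, u) ∉ E := by
      intro a ha u h
      obtain ⟨⟨b, w⟩, hx, h'⟩ := mem_image.1 h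
      obtain ⟨hb, hw⟩ := mem_product.1 hx
      rcases Sym2.eq_iff.1 h' with ⟨h1, -⟩ | ⟨-, h1⟩
      · exact disjoint_left.1 hPQ hb (by rwa [h1])
      · exact disjoint_left.1 hTQ hw (by rwa [h1])
    -- These conditions are determined by the revealed pairs; when they fail, the event cannot
    -- occur, whatever the other pairs are.
    by_cases hreg : Hv A ≤ t ∧ (∀ b ∈ P, (#(N b) : ℝ) ≤ d) ∧
        ∀ w ∈ T, (#{b ∈ P | w ∈ N b} : ℝ) ≤ d
    · obtain ⟨hr1, hr2, hr3⟩ := hreg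
      have hone := bernoulliExp_prod_filter_mem (p := p) (s := vertexPairs V \ E) Q (fun _ ↦ T ∪ P)
        (fun a u ↦ s(a, u)) (fun a _ u _ v _ h ↦ Sym2.congr_right.1 h)
        (fun a ha u hu ↦ by
          rw [Finset.mem_sdiff, mk_mem_vertexPairs]
          refine ⟨?_, haE a ha u⟩
          rintro rfl
          rcases mem_union.1 hu with h | h
          · exact disjoint_left.1 hTQ h ha
          · exact disjoint_left.1 hPQ h ha)
        (fun a ha a' ha' haa' u hu u' hu' h ↦ by
          rcases Sym2.eq_iff.1 h with ⟨h, -⟩ | ⟨h, -⟩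
          · exact haa' h
          · rcases mem_union.1 hu' with h1 | h1
            · exact disjoint_left.1 hTQ h1 (h ▸ ha)
            · exact disjoint_left.1 hPQ h1 (h ▸ ha))
        -- The classical decidability instance makes each factor unfold to a `bernoulliProb`, as the
        -- later `change` requires.
        (fun _ R ↦ @ite _ (∀ b ∈ P, b ∈ R → ∃ w ∈ N b, w ∈ R) (Classical.propDecidable _) 1 0)
      refine (bernoulliProb_le_bernoulliExp hp0 hp1' (fun B _ ↦ prod_nonneg fun a _ ↦ ?_)
        fun B hB hbad ↦ ?_).trans (hone.trans_le ?_)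
      · split_ifs <;> norm_num
      · refine le_of_eq (Eq.symm (prod_eq_one fun a ha ↦ if_pos fun b hb hbR ↦ ?_))
        obtain ⟨w, hw, haw, hbw⟩ := hbad.2.2 a ha b hb (mem_union_right _ (mem_filter.1 hbR).2)
        refine ⟨w, ?_, ?_⟩
        · simp only [hN, mem_filter]
          exact ⟨hw, (hAB B hB b hb w hw).1 hbw⟩
        · rw [mem_filter]
          refine ⟨mem_union_left _ hw, (mem_union.1 haw).resolve_left fun h ↦ haE a ha w (hAE h)⟩
      · rw [prod_const, hQ]
        change (bernoulliProb p (T ∪ P) fun R ↦ ∀ b ∈ P, b ∈ R → ∃ w ∈ N b, w ∈ R) ^ m ≤ κ ^ m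
        refine pow_le_pow_left₀ (bernoulliProb_nonneg hp0 hp1') ?_ _
        refine (bernoulliProb_no_uncovered_neighbor_le hp0 hp1' hTP N
          fun b ↦ filter_subset _ _).trans ?_
        rw [hκ, Real.exp_le_exp, neg_add, neg_neg]
        have hcard : ∀ w ∈ T, ({b ∈ P | w ∈ N b} : Finset V) = {b ∈ P | s(b, w) ∈ A} :=
          fun w hw ↦ filter_congr fun b _ ↦ by simp [hN, hw]
        refine add_le_add (neg_le_neg (mul_le_mul_of_nonneg_left ?_ hp0))
          (mul_le_mul_of_nonneg_left ?_ hp0)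
        · calc (m : ℝ) * Real.exp (-((p + p ^ 2) * d)) =
              ∑ b ∈ P, Real.exp (-((p + p ^ 2) * d)) := by rw [sum_const, nsmul_eq_mul, hP]
            _ ≤ _ := sum_le_sum fun b hb ↦ one_sub_pow_ge hp0 hp1 (hr2 b hb)
        · refine sum_exp_sub_le (c := fun w ↦ (#{b ∈ P | w ∈ N b} : ℝ))
            (y := Real.exp 2 * (p * m)) hp0 (fun w ↦ by positivity) hr3
            (by linarith) (by exact_mod_cast card_le_univ T)
            (le_trans (le_of_eq (sum_congr rfl fun w hw ↦ ?_)) hr1)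
          simp only [hcard w hw]
    · have : bernoulliProb p (vertexPairs V \ E) (fun B ↦ Hv (A ∪ B) ≤ t ∧ Bad (A ∪ B)) ≤
          bernoulliProb p (vertexPairs V \ E) (fun _ ↦ False) := by
        refine bernoulliProb_mono hp0 hp1' fun B hB h ↦ hreg ⟨?_, fun b hb ↦ ?_, fun w hw ↦ ?_⟩
        · refine le_trans (le_of_eq (sum_congr rfl fun w hw ↦ ?_)) h.1
          have : ({b ∈ P | s(b, w) ∈ A ∪ B} : Finset V) = {b ∈ P | s(b, w) ∈ A} :=
            filter_congr fun b hb ↦ hAB B hB b hb w hw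
          rw [this]
        · refine le_trans (Nat.cast_le.2 (card_le_card fun w hw ↦ ?_)) (h.2.1 b)
          simp only [hN, mem_filter, mem_univ, true_and] at hw ⊢
          exact mem_union_left _ hw.2
        · refine le_trans (Nat.cast_le.2 (card_le_card fun b hb ↦ ?_)) (h.2.1 w)
          simp only [hN, mem_filter, mem_univ, true_and] at hb ⊢
          rw [Sym2.eq_swap]
          exact mem_union_left _ hb.2.2
      refine this.trans ?_
      simp only [bernoulliProb, if_false, bernoulliExp_const]
      positivity
  refine (bernoulliExp_mono hp0 hp1' hmain).trans ?_
  rw [bernoulliExp_const]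

end UncoveredEdges

/-! ### Covered transversals and the union bound over colour classes -/

section Transversal

variable {V : Type*} [Fintype V] [DecidableEq V] {p : ℝ} {r m : ℕ}

/-- Every clique with one vertex in each of the sets `φ (i, ·)` has a common neighbour outside the
union of these sets. -/
def TransversalsCovered (φ : Fin r × Fin m ↪ V) (A : Finset (Sym2 V)) : Prop :=
  ∀ f : Fin r → Fin m, (∀ i j, i ≠ j → s(φ (i, f i), φ (j, f j)) ∈ A) →
    ∃ w ∉ Set.range φ, ∀ i, s(w, φ (i, f i)) ∈ A

lemma exists_transversalsCovered [Nonempty V] (hr : 2 ≤ r) {A : Finset (Sym2 V)}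
    (hA : A ⊆ vertexPairs V) (h : ¬ Fintype.card V < cliqueChromaticNumber
      (SimpleGraph.fromEdgeSet (A : Set (Sym2 V))) * (r * m)) :
    ∃ φ : Fin r × Fin m ↪ V, TransversalsCovered φ A := by
  by_contra! hcon
  refine h (card_lt_cliqueChromaticNumber_mul fun φ ↦ ?_)
  have hφ := hcon φ
  simp only [TransversalsCovered, not_forall] at hφ
  obtain ⟨f, hf, hw⟩ := hφ
  refine ⟨Set.range fun i ↦ φ (i, f i), ?_, ?_, ?_, fun w hwr ↦ ?_⟩
  · rintro _ ⟨i, rfl⟩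
    exact ⟨_, rfl⟩
  · rintro _ ⟨i, rfl⟩ _ ⟨j, rfl⟩ hij
    rw [fromEdgeSet_adj_iff_mem hA]
    exact hf i j fun h ↦ hij (by simp [h])
  · refine ⟨_, ⟨⟨0, by omega⟩, rfl⟩, _, ⟨⟨1, by omega⟩, rfl⟩, fun h ↦ ?_⟩
    have := congrArg Prod.fst (φ.injective h)
    simp at this
  · by_contra! hall
    refine hw ⟨w, hwr, fun i ↦ ?_⟩
    exact (fromEdgeSet_adj_iff_mem hA).1 (hall _ ⟨i, rfl⟩)

/-- The union bound over all possible colour classes. -/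
lemma bernoulliProb_not_lt_cliqueChromaticNumber_mul_le [Nonempty V] (hp0 : 0 ≤ p) (hp1 : p ≤ 1)
    (hr : 2 ≤ r) (R : Finset (Sym2 V) → Prop) {β : ℝ} (hβ : 0 ≤ β)
    (h : ∀ φ : Fin r × Fin m ↪ V,
      bernoulliProb p (vertexPairs V) (fun A ↦ R A ∧ TransversalsCovered φ A) ≤ β) :
    bernoulliProb p (vertexPairs V) (fun A ↦ ¬ Fintype.card V < cliqueChromaticNumber
      (SimpleGraph.fromEdgeSet (A : Set (Sym2 V))) * (r * m)) ≤
      bernoulliProb p (vertexPairs V) (fun A ↦ ¬ R A) + (Fintype.card V : ℝ) ^ (r * m) * β := by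
  have h1 := (bernoulliProb_exists_le (s := vertexPairs V) hp0 hp1 univ
    (fun (φ : Fin r × Fin m ↪ V) A ↦ R A ∧ TransversalsCovered φ A)).trans
    (sum_le_sum fun φ _ ↦ h φ)
  have h2 : bernoulliProb p (vertexPairs V) (fun A ↦ ¬ Fintype.card V < cliqueChromaticNumber
      (SimpleGraph.fromEdgeSet (A : Set (Sym2 V))) * (r * m)) ≤
      bernoulliProb p (vertexPairs V) (fun A ↦ ¬ R A ∨
        ∃ φ ∈ (univ : Finset (Fin r × Fin m ↪ V)), R A ∧ TransversalsCovered φ A) := by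
    refine bernoulliProb_mono hp0 hp1 fun A hA hχ ↦ ?_
    obtain ⟨φ, hφ⟩ := exists_transversalsCovered hr hA hχ
    by_cases hR : R A
    · exact Or.inr ⟨φ, mem_univ _, hR, hφ⟩
    · exact Or.inl hR
  refine h2.trans ((bernoulliProb_or_le hp0 hp1).trans ?_)
  refine add_le_add_right (h1.trans ?_) _
  rw [sum_const, nsmul_eq_mul]
  gcongr
  rw [card_univ, Fintype.card_embedding_eq]
  have := Nat.descFactorial_le_pow (Fintype.card V) (Fintype.card (Fin r × Fin m))
  simp only [Fintype.card_prod, Fintype.card_fin] at this ⊢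
  exact_mod_cast this

/-- With an edge-probability for which many edges have no common neighbours, the transversal edges
of a large set are unlikely to be covered. -/
lemma bernoulliProb_transversal_edges_covered_le (hp0 : 0 ≤ p) (hp1 : p ≤ 1 / 2)
    (φ : Fin 2 × Fin m ↪ V) {d t : ℝ} (hm : Real.exp 2 * (p * m) * p ≤ 1) :
    bernoulliProb p (vertexPairs V) (fun A ↦ (∀ v, (#{u | s(v, u) ∈ A} : ℝ) ≤ d) ∧
      TransversalsCovered φ A) ≤
      Real.exp (-t) * (1 + Real.exp (-(p * m))) ^ Fintype.card V +
        Real.exp (-(p * (m * Real.exp (-((p + p ^ 2) * d))) + -(p * (Fintype.card V *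
          (p * (Real.exp 2 * (p * m))) ^ 2 + p * t * Real.exp (p * d))))) ^ m := by
  have hp1' : p ≤ 1 := by linarith
  set P : Fin 2 → Finset V := fun i ↦ univ.image fun j ↦ φ (i, j) with hP
  have hPc : ∀ i, #(P i) = m := fun i ↦ by
    rw [hP, card_image_of_injective _ fun a b h ↦ by simpa using φ.injective h]
    simp
  have hPQ : Disjoint (P 0) (P 1) := by
    rw [disjoint_left]
    intro v h0 h1
    simp only [hP, mem_image, mem_univ, true_and] at h0 h1
    obtain ⟨a, rfl⟩ := h0
    obtain ⟨b, hb⟩ := h1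
    simpa using φ.injective hb
  set T : Finset V := univ \ (P 0 ∪ P 1) with hT
  have hTr : ∀ w ∉ Set.range φ, w ∈ T := by
    intro w hw
    simp only [hT, Finset.mem_sdiff, mem_univ, true_and, mem_union, hP, mem_image, not_or,
      not_exists]
    exact ⟨fun j h ↦ hw ⟨_, h⟩, fun j h ↦ hw ⟨_, h⟩⟩
  have hTP : ∀ i, Disjoint T (P i) := fun i ↦ by
    refine disjoint_of_subset_right ?_ sdiff_disjoint
    fin_cases i
    exacts [subset_union_left, subset_union_right]
  have h := bernoulliProb_edges_covered_le (T := T) (d := d) (t := t) hp0 hp1 hPQ (hTP 0) (hTP 1)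
    (hPc 0) (hPc 1) hm
  refine (bernoulliProb_mono hp0 hp1' fun A _ hA ↦ ?_).trans (h.trans ?_)
  · refine ⟨hA.1, fun a ha b hb hab ↦ ?_⟩
    simp only [hP, mem_image, mem_univ, true_and] at ha hb
    obtain ⟨j, rfl⟩ := ha
    obtain ⟨i, rfl⟩ := hb
    obtain ⟨w, hw, hwA⟩ := hA.2 ![i, j] (by
      intro k l hkl
      fin_cases k <;> fin_cases l
      · exact absurd rfl hkl
      · rw [Sym2.eq_swap]; exact hab
      · exact hab
      · exact absurd rfl hkl)
    refine ⟨w, hTr w hw, ?_, ?_⟩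
    · rw [Sym2.eq_swap]; exact hwA 1
    · rw [Sym2.eq_swap]; exact hwA 0
  · gcongr
    · linarith [Real.exp_nonneg (-(p * m : ℝ))]
    · exact card_le_univ T

end Transversal

/-! ### Sparse lower bound: choice of the parameters -/

lemma one_add_exp_neg_pow_le {n : ℕ} (hn : 1 ≤ n) {y : ℝ} (hy : Real.log n ≤ y) :
    (1 + Real.exp (-y)) ^ n ≤ 3 := by
  have hn0 : (0 : ℝ) < n := by exact_mod_cast hn
  have h1 : Real.exp (-y) ≤ 1 / n := by
    calc Real.exp (-y) ≤ Real.exp (-Real.log n) := by gcongr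
      _ = 1 / n := by rw [Real.exp_neg, Real.exp_log hn0, one_div]
  calc (1 + Real.exp (-y)) ^ n ≤ Real.exp (1 / n) ^ n := by
        have := Real.add_one_le_exp (1 / n : ℝ)
        gcongr
        linarith
    _ = Real.exp 1 := by rw [← Real.exp_nat_mul]; congr 1; field_simp
    _ ≤ 3 := Real.exp_one_lt_three.le

lemma exp_two_le : Real.exp 2 ≤ 9 := by
  have h := Real.exp_one_lt_three.le
  calc Real.exp 2 = Real.exp 1 ^ 2 := by rw [← Real.exp_nat_mul]; norm_num
    _ ≤ 3 ^ 2 := by gcongr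
    _ = 9 := by norm_num

-- Two parts of `m ≈ 72 e^x L/p` vertices each. A vertex of one part expects about `p m e^{-x}`, of
-- order `L`, neighbours in the other with no common neighbour outside. The probability that it has
-- none is at most `n^{-4}`, independently over the `m` vertices, and `n^{-4m}` beats the `n^{2m}`
-- choices of the set. The hypothesis on `e^{-x} np` yields `p > 0` and `x ≤ L`; the one on `e^{2x}
-- p L³` keeps the second-order terms bounded.
set_option maxHeartbeats 1000000 in
lemma lt_cliqueChromaticNumber_sparse_whp : ∀ᶠ n : ℕ in atTop, ∀ p : ℝ, 0 ≤ p → p ≤ 1 →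
    Real.log n ^ 2 ≤ Real.exp (-(n * p ^ 2)) * (n * p) →
    Real.exp (2 * (n * p ^ 2)) * p * Real.log n ^ 3 ≤ 1 / 10 ^ 8 →
    bernoulliProb p (vertexPairs (Fin n)) (fun A ↦ ¬ Real.exp (-(n * p ^ 2)) * (n * p) /
      (300 * Real.log n) ≤ (cliqueChromaticNumber
        (SimpleGraph.fromEdgeSet (A : Set (Sym2 (Fin n)))) : ℝ)) ≤ 7 / n := by
  filter_upwards [eventually_ge_atTop 1, eventually_le_log 2] with n hn hL p hp0 hp1 hnp hpe
  have hn0 : (0 : ℝ) < n := by exact_mod_cast hn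
  have : Nonempty (Fin n) := ⟨⟨0, hn⟩⟩
  set x : ℝ := n * p ^ 2 with hx
  set L := Real.log n with hLdef
  have hx0 : 0 ≤ x := by positivity
  have hp0' : 0 < p := by
    refine lt_of_le_of_ne hp0 fun h ↦ ?_
    rw [← h] at hnp
    simp only [mul_zero] at hnp
    nlinarith
  have hex : 1 ≤ Real.exp x := Real.one_le_exp hx0
  have he2 : Real.exp (2 * x) = Real.exp x ^ 2 := by rw [← Real.exp_nat_mul]; norm_num
  have hxe : x ≤ Real.exp x := by linarith [Real.add_one_le_exp x]
  have hxL : x ≤ L := by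
    rw [← Real.exp_le_exp, hLdef, Real.exp_log hn0]
    have h1 : Real.exp (-x) * (n * p) * Real.exp x = n * p := by
      rw [mul_right_comm, ← Real.exp_add]; simp
    have h2 := mul_le_mul_of_nonneg_right hnp (Real.exp_nonneg x)
    have h3 : n * p ≤ n := mul_le_of_le_one_right hn0.le hp1
    have h4 : Real.exp x ≤ L ^ 2 * Real.exp x :=
      le_mul_of_one_le_left (Real.exp_nonneg x) (one_le_pow₀ (by linarith))
    linarith
  have hL3 : L ^ 3 = L ^ 2 * L := by ring
  have hpe' : Real.exp x ^ 2 * p * L ^ 3 ≤ 1 / 10 ^ 8 := he2 ▸ hpe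
  have hpL : p * L ^ 2 ≤ 1 / 10 ^ 8 := by
    calc p * L ^ 2 ≤ Real.exp x ^ 2 * p * L ^ 3 := by
          rw [hL3, mul_assoc]
          have : p * L ^ 2 * 1 ≤ p * L ^ 2 * (Real.exp x ^ 2 * L) := by
            gcongr
            nlinarith
          linarith
      _ ≤ _ := hpe'
  have hpL1 : p * L ≤ 1 / 10 ^ 8 := by
    refine le_trans ?_ hpL
    gcongr
    nlinarith
  have hp8 : p ≤ 1 / 10 ^ 8 := by nlinarith
  -- Here `72 = 8 * 9` with `e² ≤ 9`: the main exponent is at least `8L`, of which `4L` must survive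
  -- two error terms of at most 1 each.
  set m := ⌈72 * Real.exp x * L / p⌉₊ with hm
  have hm1 : 72 * Real.exp x * L / p ≤ m := Nat.le_ceil _
  have hm2 : (m : ℝ) ≤ 72 * Real.exp x * L / p + 1 := (Nat.ceil_lt_add_one (by positivity)).le
  have hpm1 : 72 * Real.exp x * L ≤ p * m := by
    rw [div_le_iff₀ hp0'] at hm1
    linarith
  have hpm2 : p * m ≤ 74 * Real.exp x * L := by
    have : p * m ≤ p * (72 * Real.exp x * L / p + 1) := by gcongr
    rw [mul_add, mul_div_cancel₀ _ hp0'.ne'] at this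
    nlinarith
  have hm0 : (0 : ℝ) < m := lt_of_lt_of_le (by positivity) hm1
  have hm1' : (1 : ℝ) ≤ m := by
    have : 0 < m := by exact_mod_cast hm0
    exact_mod_cast this
  -- The slack `1/p` changes `p * d` by only 1, so `exp (-(p * d))` is still `exp (-x)` up to a
  -- constant.
  set d : ℝ := n * p + 1 / p with hd
  have hpd : p * d = x + 1 := by rw [hd, hx]; field_simp
  have hpd2 : (p + p ^ 2) * d ≤ x + 2 := by
    have h1 : (p + p ^ 2) * d = (1 + p) * (x + 1) := by rw [← hpd]; ring
    rw [h1]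
    nlinarith
  -- With this choice `exp (-t) = n^{-4m}`, the same order as the main failure probability.
  set t : ℝ := 4 * m * L with ht
  have hexpm : Real.exp 2 * (p * m) * p ≤ 1 := by
    have h1 : Real.exp 2 * (p * m) * p ≤ 9 * (74 * Real.exp x * L) * p := by
      gcongr
      exact exp_two_le
    have h2 : Real.exp x * L * p ≤ Real.exp x ^ 2 * p * L ^ 3 := by
      have h3 : Real.exp x * L * p * 1 ≤ Real.exp x * L * p * (Real.exp x * L ^ 2) := by
        gcongr
        nlinarith
      linarith
    linarith
  have hdeg : bernoulliProb p (vertexPairs (Fin n))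
      (fun A ↦ ¬ ∀ v, (#{u | s(v, u) ∈ A} : ℝ) ≤ d) ≤ 3 / n := by
    have h1 := bernoulliProb_exists_degree_ge_le (V := Fin n) (l := 2 * (p * L)) hp0 hp1
      (by positivity) (by linarith) (1 / p)
    rw [Fintype.card_fin] at h1
    refine (bernoulliProb_mono hp0 hp1 fun A _ h ↦ ?_).trans (h1.trans ?_)
    · push Not at h
      obtain ⟨v, hv⟩ := h
      exact ⟨v, hv.le⟩
    · have h2 : (2 * (p * L)) ^ 2 * (n * p) - 2 * (p * L) * (1 / p) =
          4 * (x * (p * L ^ 2)) + -((2 : ℕ) * L) := by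
        have h5 : p * (1 / p) = 1 := mul_one_div_cancel hp0'.ne'
        rw [hx]
        push_cast
        linear_combination (-2 * L) * h5
      have h3 : x * (p * L ^ 2) ≤ Real.exp x ^ 2 * p * L ^ 3 := by
        have : x * (p * L ^ 2) ≤ (Real.exp x ^ 2 * L) * (p * L ^ 2) := by
          gcongr
          nlinarith
        linarith
      rw [h2, Real.exp_add, exp_neg_mul_log hn]
      have h4 : Real.exp (4 * (x * (p * L ^ 2))) ≤ 3 :=
        (Real.exp_le_exp.2 (by linarith)).trans Real.exp_one_lt_three.le
      calc (n : ℝ) * (Real.exp (4 * (x * (p * L ^ 2))) * (1 / (n : ℝ) ^ 2)) ≤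
            n * (3 * (1 / (n : ℝ) ^ 2)) := by gcongr
        _ = _ := by field_simp
  have hκ : Real.exp (-(p * (m * Real.exp (-((p + p ^ 2) * d))) + -(p * (n *
      (p * (Real.exp 2 * (p * m))) ^ 2 + p * t * Real.exp (p * d))))) ≤ Real.exp (-(4 * L)) := by
    rw [Real.exp_le_exp, neg_le_neg_iff]
    have h1 : 8 * L ≤ p * (m * Real.exp (-((p + p ^ 2) * d))) := by
      have h2 : Real.exp (-(x + 2)) ≤ Real.exp (-((p + p ^ 2) * d)) := by gcongr
      have h3 : 1 ≤ 9 * (Real.exp x * Real.exp (-(x + 2))) := by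
        rw [← Real.exp_add, show x + -(x + 2) = -2 by ring]
        have h4 : Real.exp 2 * Real.exp (-2) = 1 := by rw [← Real.exp_add]; simp
        nlinarith [exp_two_le, Real.exp_pos (-2)]
      calc 8 * L ≤ 8 * L * (9 * (Real.exp x * Real.exp (-(x + 2)))) :=
            le_mul_of_one_le_right (by linarith) h3
        _ = 72 * Real.exp x * L * Real.exp (-(x + 2)) := by ring
        _ ≤ p * m * Real.exp (-((p + p ^ 2) * d)) := by gcongr
        _ = _ := by ring
    have h2 : p * (n * (p * (Real.exp 2 * (p * m))) ^ 2) ≤ 1 := by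
      calc p * (n * (p * (Real.exp 2 * (p * m))) ^ 2) =
            x * p * Real.exp 2 ^ 2 * (p * m) ^ 2 := by rw [hx]; ring
        _ ≤ L * p * 9 ^ 2 * (74 * Real.exp x * L) ^ 2 := by
            gcongr
            exact exp_two_le
        _ = 443556 * (Real.exp x ^ 2 * p * L ^ 3) := by ring
        _ ≤ 1 := by linarith
    have h3 : p * (p * t * Real.exp (p * d)) ≤ 1 := by
      rw [hpd, Real.exp_add]
      calc p * (p * t * (Real.exp x * Real.exp 1)) =
            4 * (p * m) * L * p * Real.exp x * Real.exp 1 := by rw [ht]; ring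
        _ ≤ 4 * (74 * Real.exp x * L) * L * p * Real.exp x * 3 := by
            gcongr
            exact Real.exp_one_lt_three.le
        _ = 888 * (Real.exp x ^ 2 * p * L ^ 2) := by ring
        _ ≤ 888 * (Real.exp x ^ 2 * p * L ^ 3) := by
            gcongr
            · linarith
            · norm_num
        _ ≤ 1 := by linarith
    linarith
  have hβ : ∀ φ : Fin 2 × Fin m ↪ Fin n, bernoulliProb p (vertexPairs (Fin n))
      (fun A ↦ (∀ v, (#{u | s(v, u) ∈ A} : ℝ) ≤ d) ∧ TransversalsCovered φ A) ≤
      4 * Real.exp (-(4 * m * L)) := by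
    intro φ
    refine (bernoulliProb_transversal_edges_covered_le hp0 (by linarith) φ (t := t) hexpm).trans ?_
    rw [Fintype.card_fin]
    have h1 : (1 + Real.exp (-(p * m))) ^ n ≤ 3 :=
      one_add_exp_neg_pow_le hn (le_trans (by nlinarith) hpm1)
    have h2 := (pow_le_pow_left₀ (Real.exp_nonneg _) hκ m).trans_eq
      (show Real.exp (-(4 * L)) ^ m = Real.exp (-(4 * m * L)) by
        rw [← Real.exp_nat_mul]; congr 1; ring)
    have h4 : Real.exp (-t) * (1 + Real.exp (-(p * m))) ^ n ≤ Real.exp (-t) * 3 := by gcongr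
    rw [ht] at h4 ⊢
    linarith
  have h := bernoulliProb_not_lt_cliqueChromaticNumber_mul_le (V := Fin n) hp0 hp1 le_rfl _ (by positivity) hβ
  rw [Fintype.card_fin] at h
  refine (bernoulliProb_mono hp0 hp1 fun A _ hA ↦ ?_).trans (h.trans ?_)
  · intro hlt
    refine hA ?_
    have h1 : (n : ℝ) ≤ cliqueChromaticNumber (SimpleGraph.fromEdgeSet (A : Set (Sym2 (Fin n)))) *
        (2 * m) := by exact_mod_cast hlt.le
    set χ := (cliqueChromaticNumber (SimpleGraph.fromEdgeSet (A : Set (Sym2 (Fin n)))) : ℝ)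
    rw [div_le_iff₀ (by positivity)]
    have h2 : Real.exp (-x) * (n * p) ≤ Real.exp (-x) * (χ * (2 * (p * m))) := by
      have : n * p ≤ χ * (2 * (p * m)) := by
        have := mul_le_mul_of_nonneg_right h1 hp0
        linarith
      gcongr
    have h3 : Real.exp (-x) * (χ * (2 * (p * m))) ≤
        Real.exp (-x) * (χ * (2 * (74 * Real.exp x * L))) := by gcongr
    have h4 : Real.exp (-x) * (χ * (2 * (74 * Real.exp x * L))) = 148 * χ * L := by
      have : Real.exp (-x) * Real.exp x = 1 := by rw [← Real.exp_add]; simp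
      linear_combination 148 * χ * L * this
    have h5 : 0 ≤ χ * L := by positivity
    linarith
  · have h1 : (n : ℝ) ^ (2 * m) = Real.exp (2 * m * L) := by
      rw [← Real.exp_log (pow_pos hn0 _), Real.log_pow]
      push_cast
      rfl
    have h2 : (n : ℝ) ^ (2 * m) * (4 * Real.exp (-(4 * m * L))) ≤ 4 / n := by
      rw [h1, mul_left_comm, ← Real.exp_add, div_eq_mul_inv]
      gcongr
      calc Real.exp (2 * m * L + -(4 * m * L)) ≤ Real.exp (-L) := by
            gcongr
            nlinarith
        _ = _ := by rw [Real.exp_neg, hLdef, Real.exp_log hn0]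
    have h3 : (7 : ℝ) / n = 3 / n + 4 / n := by ring
    linarith

/-! ### Transversal cliques via Janson's inequality -/

section TransversalCliques

variable {V : Type*} [Fintype V] [DecidableEq V] {p : ℝ} {r m : ℕ}

/-- The pairs of distinct elements of `S`. -/
def pairsIn (S : Finset V) : Finset (Sym2 V) := S.offDiag.image Sym2.mk.uncurry

lemma mk_mem_pairsIn {S : Finset V} {a b : V} : s(a, b) ∈ pairsIn S ↔ a ∈ S ∧ b ∈ S ∧ a ≠ b := by
  simp only [pairsIn, mem_image, mem_offDiag, Prod.exists, Function.uncurry_apply_pair]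
  constructor
  · rintro ⟨c, d, ⟨hc, hd, hcd⟩, h⟩
    rcases Sym2.eq_iff.1 h with ⟨rfl, rfl⟩ | ⟨rfl, rfl⟩
    exacts [⟨hc, hd, hcd⟩, ⟨hd, hc, hcd.symm⟩]
  · exact fun h ↦ ⟨a, b, h, rfl⟩

lemma card_pairsIn (S : Finset V) : #(pairsIn S) = (#S).choose 2 := Sym2.card_image_offDiag S

lemma pairsIn_inter (S T : Finset V) : pairsIn S ∩ pairsIn T = pairsIn (S ∩ T) := by
  ext e
  induction e with
  | _ a b =>
    simp only [mem_inter, mk_mem_pairsIn]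
    tauto

/-- The vertices of a transversal. -/
def transversal (φ : Fin r × Fin m ↪ V) (f : Fin r → Fin m) : Finset V :=
  univ.image fun i ↦ φ (i, f i)

lemma card_transversal (φ : Fin r × Fin m ↪ V) (f : Fin r → Fin m) : #(transversal φ f) = r := by
  rw [transversal, card_image_of_injective]
  · simp
  · exact fun i j h ↦ congrArg Prod.fst (φ.injective h)

lemma card_transversal_inter_le (φ : Fin r × Fin m ↪ V) (f g : Fin r → Fin m) :
    #(transversal φ f ∩ transversal φ g) ≤ #{i | g i = f i} := by
  refine (card_le_card (t := (univ.filter fun i ↦ g i = f i).image fun i ↦ φ (i, f i))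
    fun v hv ↦ ?_).trans card_image_le
  obtain ⟨h1, h2⟩ := mem_inter.1 hv
  simp only [transversal, mem_image, mem_univ, true_and, mem_filter] at h1 h2 ⊢
  obtain ⟨i, rfl⟩ := h1
  obtain ⟨j, hj⟩ := h2
  have := φ.injective hj
  obtain ⟨rfl, h⟩ := Prod.mk.inj this
  exact ⟨j, h, rfl⟩

/-- The transversals that agree with `f` exactly on a given set of `j` parts number at most `m ^ (r
- j)`. This organises the correlation sum in Janson's inequality by overlap. -/
lemma sum_agree_le {β : ℝ} (f : Fin r → Fin m) (F : ℕ → ℝ) (hF : ∀ j, 0 ≤ F j)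
    (hβ : ∑ j ∈ range (r + 1), r.choose j • ((m : ℝ) ^ (r - j) * F j) ≤ β) :
    ∑ g : Fin r → Fin m, F #{i | g i = f i} ≤ β := by
  refine le_trans ?_ hβ
  have h1 := sum_powerset_apply_card (fun j ↦ (m : ℝ) ^ (r - j) * F j)
    (x := (univ : Finset (Fin r)))
  rw [card_univ, Fintype.card_fin] at h1
  rw [← h1]
  rw [← sum_fiberwise_of_maps_to (s := univ) (t := (univ : Finset (Fin r)).powerset)
    (g := fun g : Fin r → Fin m ↦ univ.filter fun i ↦ g i = f i) (by simp)]
  refine sum_le_sum fun J _ ↦ ?_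
  have h2 : ∀ g ∈ univ.filter fun g : Fin r → Fin m ↦ (univ.filter fun i ↦ g i = f i) = J,
      F #{i | g i = f i} = F #J := fun g hg ↦ by rw [(mem_filter.1 hg).2]
  rw [sum_congr rfl h2, sum_const, nsmul_eq_mul]
  refine mul_le_mul_of_nonneg_right ?_ (hF _)
  have h3 : (univ.filter fun g : Fin r → Fin m ↦ (univ.filter fun i ↦ g i = f i) = J) ⊆
      Fintype.piFinset fun i ↦ if i ∈ J then {f i} else univ := by
    intro g hg
    rw [mem_filter] at hg
    rw [Fintype.mem_piFinset]
    intro i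
    split_ifs with hi
    · rw [← hg.2] at hi
      simpa using hi
    · simp
  have h4 : #(Fintype.piFinset fun i ↦ if i ∈ J then {f i} else (univ : Finset (Fin m))) =
      m ^ (r - #J) := by
    rw [Fintype.card_piFinset]
    have : ∀ i, #(if i ∈ J then {f i} else (univ : Finset (Fin m))) = if i ∈ J then 1 else m := by
      intro i
      split_ifs <;> simp
    simp only [this, prod_ite, prod_const_one, prod_const, one_mul]
    rw [filter_not, filter_mem_eq_inter, univ_inter, card_sdiff_of_subset (subset_univ _),
      card_univ, Fintype.card_fin]
  exact_mod_cast (card_le_card h3).trans h4.le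

/-- The probability that none of many given transversals is a clique. -/
lemma bernoulliProb_no_transversal_clique_le (hp0 : 0 < p) (hp1 : p ≤ 1) (hm : 0 < m)
    (φ : Fin r × Fin m ↪ V) {s : Finset (Sym2 V)} (U : Finset (Fin r → Fin m))
    (hU : (m : ℝ) ^ r ≤ 2 * #U) (hs : ∀ f, pairsIn (transversal φ f) ⊆ s) {κ : ℝ} (hκ : 0 ≤ κ)
    (hsum : 4 * κ * ∑ j ∈ Icc 2 r, (r.choose j : ℝ) / ((m : ℝ) ^ j * p ^ j.choose 2) ≤ 1) :
    bernoulliProb p s (fun B ↦ ∀ f ∈ U, ¬ pairsIn (transversal φ f) ⊆ B) ≤ Real.exp (-κ) := by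
  have hm' : (0 : ℝ) < m := by exact_mod_cast hm
  set σ₀ := ∑ j ∈ Icc 2 r, (r.choose j : ℝ) / ((m : ℝ) ^ j * p ^ j.choose 2) with hσ
  set q := p ^ r.choose 2 with hq
  have hq0 : 0 < q := by positivity
  have hcard : ∀ f, #(pairsIn (transversal φ f)) = r.choose 2 := fun f ↦ by
    rw [card_pairsIn, card_transversal]
  have hΔ : ∑ f ∈ U, ∑ g ∈ U with ¬ Disjoint (pairsIn (transversal φ f))
      (pairsIn (transversal φ g)), p ^ #(pairsIn (transversal φ f) ∪ pairsIn (transversal φ g)) ≤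
      #U * (q ^ 2 * (m : ℝ) ^ r * σ₀) := by
    rw [← nsmul_eq_mul, ← sum_const]
    refine sum_le_sum fun f _ ↦ ?_
    -- Two transversals agreeing in `j` places share at most `j.choose 2` pairs, and none if `j <
    -- 2`.
    set F : ℕ → ℝ := fun j ↦ if 2 ≤ j then q ^ 2 / p ^ j.choose 2 else 0 with hF
    have hF0 : ∀ j, 0 ≤ F j := fun j ↦ by
      simp only [hF]
      split_ifs <;> positivity
    calc _ ≤ ∑ g ∈ U with ¬ Disjoint (pairsIn (transversal φ f)) (pairsIn (transversal φ g)),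
          F #{i | g i = f i} := by
          refine sum_le_sum fun g hg ↦ ?_
          have h1 : #(pairsIn (transversal φ f) ∩ pairsIn (transversal φ g)) ≤
              (#{i | g i = f i}).choose 2 := by
            rw [pairsIn_inter, card_pairsIn]
            exact Nat.choose_le_choose 2 (card_transversal_inter_le φ f g)
          have h2 : 2 ≤ #{i | g i = f i} := by
            by_contra! hlt
            rw [Nat.choose_eq_zero_of_lt hlt, Nat.le_zero, card_eq_zero] at h1
            exact (mem_filter.1 hg).2 (disjoint_iff_inter_eq_empty.2 h1)
          have h3 := card_union_add_card_inter (pairsIn (transversal φ f))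
            (pairsIn (transversal φ g))
          rw [hcard, hcard] at h3
          simp only [hF, if_pos h2]
          rw [le_div_iff₀ (by positivity), ← pow_add, hq, ← pow_mul]
          exact pow_le_pow_of_le_one hp0.le hp1 (by omega)
      _ ≤ ∑ g : Fin r → Fin m, F #{i | g i = f i} :=
          sum_le_sum_of_subset_of_nonneg (subset_univ _) fun g _ _ ↦ hF0 _
      _ ≤ q ^ 2 * (m : ℝ) ^ r * σ₀ := by
          refine sum_agree_le f F hF0 (le_of_eq ?_)
          rw [hσ, mul_sum]
          symm
          refine sum_subset_zero_on_sdiff (fun j hj ↦ ?_) (fun j hj ↦ ?_) (fun j hj ↦ ?_)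
          · rw [mem_Icc] at hj
            rw [mem_range]
            omega
          · have : ¬ 2 ≤ j := by
              rw [Finset.mem_sdiff, mem_range, mem_Icc] at hj
              omega
            simp [hF, this]
          · rw [mem_Icc] at hj
            simp only [hF, if_pos hj.1, nsmul_eq_mul]
            have : (m : ℝ) ^ r = m ^ (r - j) * m ^ j := by
              rw [← pow_add, Nat.sub_add_cancel hj.2]
            rw [this]
            field_simp
  -- With this `l` the first-order term is `4 κ #U / m ^ r` and, by `hsum`, the second-order term is
  -- at most half of it. The difference is at least `κ` since `U` contains half of the transversals.
  have hJ := bernoulliProb_forall_not_subset_le (l := 4 * κ / (q * (m : ℝ) ^ r)) hp0.le hp1 U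
    (fun f ↦ pairsIn (transversal φ f)) (fun f _ ↦ hs f) (by positivity)
  refine hJ.trans (Real.exp_le_exp.2 ?_)
  simp only [hcard, sum_const, nsmul_eq_mul]
  have h1 := mul_le_mul_of_nonneg_left hΔ
    (show 0 ≤ (4 * κ / (q * (m : ℝ) ^ r)) ^ 2 / 2 by positivity)
  have h2 : (4 * κ / (q * (m : ℝ) ^ r)) ^ 2 / 2 * (#U * (q ^ 2 * (m : ℝ) ^ r * σ₀)) =
      2 * κ * (#U / (m : ℝ) ^ r) * (4 * κ * σ₀) := by
    field_simp
    ring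
  have h3 : 4 * κ / (q * (m : ℝ) ^ r) * (#U * q) = 4 * κ * (#U / (m : ℝ) ^ r) := by
    field_simp
  have h4 : 1 ≤ 2 * (#U / (m : ℝ) ^ r) := by
    rw [mul_div_assoc', le_div_iff₀ (by positivity)]
    linarith
  have h5 : 2 * κ * (#U / (m : ℝ) ^ r) * (4 * κ * σ₀) ≤ 2 * κ * (#U / (m : ℝ) ^ r) * 1 := by
    gcongr
  rw [← hq, h3]
  rw [h2] at h1
  nlinarith

/-- The inequality of arithmetic and geometric means. It allows the number of transversals covered
by one vertex to be bounded through its total degree into the set, without controlling the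
distribution over the parts. -/
lemma prod_le_sum_div_pow (hr : 0 < r) (a : Fin r → ℝ) (ha : ∀ i, 0 ≤ a i) :
    ∏ i, a i ≤ ((∑ i, a i) / r) ^ r := by
  have hr' : (0 : ℝ) < r := by exact_mod_cast hr
  have h := Real.geom_mean_le_arith_mean_weighted univ (fun _ : Fin r ↦ (1 / r : ℝ)) a
    (fun _ _ ↦ by positivity) (by simp [hr'.ne']) (fun i _ ↦ ha i)
  rw [← mul_sum, one_div_mul_eq_div] at h
  have h2 := pow_le_pow_left₀ (prod_nonneg fun i _ ↦ Real.rpow_nonneg (ha i) _) h r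
  rw [← prod_pow] at h2
  refine le_trans (le_of_eq (prod_congr rfl fun i _ ↦ ?_)) h2
  rw [← Real.rpow_natCast, ← Real.rpow_mul (ha i), one_div_mul_cancel hr'.ne', Real.rpow_one]

/-- The number of transversals covered by some `w ∈ T`, where `w` covers the vertices in `N w`. -/
lemma card_covered_le {T : Finset V} (hr : 0 < r) (hm : 0 < m) (N : V → Fin r → Finset (Fin m))
    {ε t y : ℝ} (hε : ∀ w ∈ T, ∑ i, (#(N w i) : ℝ) ≤ ε * (r * m)) (hy : 0 ≤ y)
    (ht : (∑ w ∈ T, if y * (r * m) < ∑ i, (#(N w i) : ℝ) then ∑ i, (#(N w i) : ℝ) else 0) ≤ t)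
    (hε0 : 0 ≤ ε) :
    (#{f : Fin r → Fin m | ∃ w ∈ T, ∀ i, f i ∈ N w i} : ℝ) ≤
      (m : ℝ) ^ r * (Fintype.card V * y ^ r + ε ^ (r - 1) * (t / (r * m))) := by
  have hm' : (0 : ℝ) < m := by exact_mod_cast hm
  have hr' : (0 : ℝ) < r := by exact_mod_cast hr
  have h1 : ({f : Fin r → Fin m | ∃ w ∈ T, ∀ i, f i ∈ N w i} : Finset _) ⊆
      T.biUnion fun w ↦ Fintype.piFinset (N w) := by
    intro f hf
    obtain ⟨w, hw, hfw⟩ := (mem_filter.1 hf).2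
    exact mem_biUnion.2 ⟨w, hw, Fintype.mem_piFinset.2 hfw⟩
  have h2 : (#{f : Fin r → Fin m | ∃ w ∈ T, ∀ i, f i ∈ N w i} : ℝ) ≤
      ∑ w ∈ T, ∏ i, (#(N w i) : ℝ) := by
    refine (Nat.cast_le.2 ((card_le_card h1).trans card_biUnion_le)).trans (le_of_eq ?_)
    rw [Nat.cast_sum]
    refine sum_congr rfl fun w _ ↦ ?_
    rw [Fintype.card_piFinset, Nat.cast_prod]
  -- A light vertex covers at most a fraction `y ^ r` of the transversals. For a heavy one all
  -- factors but one are bounded by `ε`, leaving a bound linear in the degree that can be summed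
  -- against `t`.
  have h3 : ∀ w ∈ T, ∏ i, (#(N w i) : ℝ) ≤ (m : ℝ) ^ r * (y ^ r + ε ^ (r - 1) *
      ((if y * (r * m) < ∑ i, (#(N w i) : ℝ) then ∑ i, (#(N w i) : ℝ) else 0) / (r * m))) := by
    intro w hw
    have hεw := hε w hw
    refine (prod_le_sum_div_pow hr _ fun i ↦ Nat.cast_nonneg _).trans ?_
    set c := ∑ i, (#(N w i) : ℝ)
    have hc0 : 0 ≤ c := sum_nonneg fun i _ ↦ Nat.cast_nonneg _
    clear_value c
    have h4 : (c / r) ^ r = (m : ℝ) ^ r * (c / (r * m)) ^ r := by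
      rw [← mul_pow]
      congr 1
      field_simp
    rw [h4]
    gcongr
    split_ifs with hlt
    · have h5 : c / (r * m) ≤ ε := by
        rw [div_le_iff₀ (by positivity)]
        exact hεw
      calc (c / (r * m)) ^ r = (c / (r * m)) ^ (r - 1) * (c / (r * m)) := by
            rw [← pow_succ, Nat.sub_add_cancel hr]
        _ ≤ ε ^ (r - 1) * (c / (r * m)) := by gcongr
        _ ≤ _ := le_add_of_nonneg_left (by positivity)
    · have h5 : c / (r * m) ≤ y := by
        rw [div_le_iff₀ (by positivity)]
        exact not_lt.1 hlt
      rw [zero_div, mul_zero, add_zero]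
      gcongr
  refine h2.trans ((sum_le_sum h3).trans ?_)
  rw [← mul_sum, sum_add_distrib, sum_const, nsmul_eq_mul, ← mul_sum, ← sum_div]
  gcongr
  exact card_le_univ T

set_option maxHeartbeats 1000000 in
/-- The transversal cliques of a large set are unlikely to be covered by vertices outside the
set. -/
lemma bernoulliProb_transversal_cliques_covered_le (hp0 : 0 < p) (hp1 : p ≤ 1) (hr : 0 < r)
    (hm : 0 < m) (φ : Fin r × Fin m ↪ V) {ε t κ : ℝ} (hε0 : 0 ≤ ε) (hκ : 0 ≤ κ)
    (hcov : Fintype.card V * (Real.exp 2 * p) ^ r + ε ^ (r - 1) * (t / (r * m)) ≤ 1 / 2)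
    (hsum : 4 * κ * ∑ j ∈ Icc 2 r, (r.choose j : ℝ) / ((m : ℝ) ^ j * p ^ j.choose 2) ≤ 1) :
    bernoulliProb p (vertexPairs V) (fun A ↦ (∀ v, (#{u | s(v, u) ∈ A} : ℝ) ≤ ε * (r * m)) ∧
      TransversalsCovered φ A) ≤
      Real.exp (-t) * (1 + Real.exp (-(p * (r * m)))) ^ Fintype.card V + Real.exp (-κ) := by
  set S : Finset V := univ.image φ with hS
  set T : Finset V := univ \ S with hT
  have hSc : (#S : ℝ) = r * m := by
    rw [hS, card_image_of_injective _ φ.injective]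
    simp
  have hmemS : ∀ x, φ x ∈ S := fun x ↦ mem_image_of_mem _ (mem_univ x)
  have hST : Disjoint S T := disjoint_sdiff
  have hTr : ∀ w ∉ Set.range φ, w ∈ T := by
    intro w hw
    simpa [hT, hS] using hw
  have hheavy := bernoulliProb_heavy_le hp0.le hp1 hST (s := vertexPairs V) (fun b hb w hw ↦ by
    rw [mk_mem_vertexPairs]
    rintro rfl
    exact disjoint_left.1 hST hb hw) t
  rw [hSc] at hheavy
  set Bad : Finset (Sym2 V) → Prop := fun A ↦ (∀ v, (#{u | s(v, u) ∈ A} : ℝ) ≤ ε * (r * m)) ∧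
      TransversalsCovered φ A with hBad
  set Hv : Finset (Sym2 V) → ℝ := fun A ↦ ∑ w ∈ T, if Real.exp 2 * (p * (r * m)) <
    #{b ∈ S | s(b, w) ∈ A} then (#{b ∈ S | s(b, w) ∈ A} : ℝ) else 0 with hHv
  have hsplit : bernoulliProb p (vertexPairs V) Bad ≤
      bernoulliProb p (vertexPairs V) (fun A ↦ t ≤ Hv A) +
      bernoulliProb p (vertexPairs V) (fun A ↦ Hv A ≤ t ∧ Bad A) := by
    refine (bernoulliProb_mono hp0.le hp1 fun A _ hA ↦ ?_).trans (bernoulliProb_or_le hp0.le hp1)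
    rcases le_total t (Hv A) with h | h
    · exact Or.inl h
    · exact Or.inr ⟨h, hA⟩
  refine hsplit.trans (add_le_add (hheavy.trans ?_) ?_)
  · gcongr
    · linarith [Real.exp_nonneg (-(p * (r * m : ℝ)))]
    · exact card_le_univ T
  -- Which transversals are covered depends only on the pairs between `S` and `T`; which are cliques
  -- depends only on the pairs inside `S`. Revealing the former leaves the latter random.
  set E := (S ×ˢ T).image fun x ↦ s(x.1, x.2) with hE
  have hEs : E ⊆ vertexPairs V := by
    rw [hE, image_subset_iff]
    rintro ⟨b, w⟩ hx
    obtain ⟨hb, hw⟩ := mem_product.1 hx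
    rw [mk_mem_vertexPairs]
    rintro h
    exact disjoint_left.1 hST hb (h ▸ hw)
  have hSE : ∀ x y, s(φ x, φ y) ∉ E := by
    intro x y h
    obtain ⟨⟨b, w⟩, hx, h'⟩ := mem_image.1 h
    obtain ⟨-, hw⟩ := mem_product.1 hx
    rcases Sym2.eq_iff.1 h' with ⟨-, h1⟩ | ⟨-, h1⟩
    · exact disjoint_left.1 hST (hmemS y) (h1 ▸ hw)
    · exact disjoint_left.1 hST (hmemS x) (h1 ▸ hw)
  rw [← union_sdiff_of_subset hEs, bernoulliProb_union disjoint_sdiff]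
  have hmain : ∀ A ⊆ E, bernoulliProb p (vertexPairs V \ E)
      (fun B ↦ Hv (A ∪ B) ≤ t ∧ Bad (A ∪ B)) ≤ Real.exp (-κ) := by
    intro A hAE
    have hAB : ∀ B ⊆ vertexPairs V \ E, ∀ b ∈ S, ∀ w ∈ T, s(b, w) ∈ A ∪ B ↔ s(b, w) ∈ A := by
      intro B hB b hb w hw
      rw [mem_union, or_iff_left_iff_imp]
      exact fun h ↦ absurd (mem_image.2 ⟨(b, w), mem_product.2 ⟨hb, hw⟩, rfl⟩)
        (Finset.mem_sdiff.1 (hB h)).2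
    set N : V → Fin r → Finset (Fin m) := fun w i ↦ {j | s(φ (i, j), w) ∈ A} with hN
    have hNc : ∀ w, ∑ i, (#(N w i) : ℝ) = #{b ∈ S | s(b, w) ∈ A} := by
      intro w
      have h1 : #{b ∈ S | s(b, w) ∈ A} = #{x : Fin r × Fin m | s(φ x, w) ∈ A} := by
        rw [hS, filter_image, card_image_of_injective _ φ.injective]
      rw [h1, card_filter, Fintype.sum_prod_type]
      simp only [hN, card_filter]
      push_cast
      rfl
    by_cases hreg : Hv A ≤ t ∧ ∀ w ∈ T, (#{b ∈ S | s(b, w) ∈ A} : ℝ) ≤ ε * (r * m)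
    · obtain ⟨hr1, hr2⟩ := hreg
      -- `U` consists of the uncovered transversals. The bad event forces that none of them is a
      -- clique.
      set U : Finset (Fin r → Fin m) := {f | ¬ ∃ w ∈ T, ∀ i, f i ∈ N w i} with hU
      have hUc : (m : ℝ) ^ r ≤ 2 * #U := by
        have h1 := card_covered_le (T := T) hr hm N (ε := ε) (t := t) (y := Real.exp 2 * p)
          (fun w hw ↦ by rw [hNc]; exact hr2 w hw) (by positivity)
          (by simp only [hNc, mul_assoc]; exact hr1) hε0
        have h2 : #{f : Fin r → Fin m | ∃ w ∈ T, ∀ i, f i ∈ N w i} + #U = m ^ r := by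
          rw [hU, card_filter_add_card_filter_not]
          simp
        have h3 : (#{f : Fin r → Fin m | ∃ w ∈ T, ∀ i, f i ∈ N w i} : ℝ) + #U = (m : ℝ) ^ r := by
          exact_mod_cast h2
        have h4 : (m : ℝ) ^ r * (Fintype.card V * (Real.exp 2 * p) ^ r +
            ε ^ (r - 1) * (t / (r * m))) ≤ (m : ℝ) ^ r * (1 / 2) := by gcongr
        linarith
      refine (bernoulliProb_mono hp0.le hp1 fun B hB hbad f hf hsub ↦ ?_).trans
        (bernoulliProb_no_transversal_clique_le hp0 hp1 hm φ U hUc (fun f ↦ ?_) hκ hsum)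
      · refine (mem_filter.1 hf).2 ?_
        obtain ⟨w, hw, hwA⟩ := hbad.2.2 f fun i j hij ↦ by
          refine mem_union_right _ (hsub ?_)
          rw [mk_mem_pairsIn]
          exact ⟨mem_image_of_mem _ (mem_univ i), mem_image_of_mem _ (mem_univ j),
            fun h ↦ hij (congrArg Prod.fst (φ.injective h))⟩
        refine ⟨w, hTr w hw, fun i ↦ ?_⟩
        simp only [hN, mem_filter, mem_univ, true_and]
        rw [← hAB B hB _ (hmemS _) w (hTr w hw), Sym2.eq_swap]
        exact hwA i
      · intro e
        induction e with
        | _ a b =>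
          rw [mk_mem_pairsIn]
          rintro ⟨ha, hb, hab⟩
          obtain ⟨i, -, rfl⟩ := mem_image.1 ha
          obtain ⟨j, -, rfl⟩ := mem_image.1 hb
          exact Finset.mem_sdiff.2 ⟨mk_mem_vertexPairs.2 hab, hSE _ _⟩
    · have : bernoulliProb p (vertexPairs V \ E) (fun B ↦ Hv (A ∪ B) ≤ t ∧ Bad (A ∪ B)) ≤
          bernoulliProb p (vertexPairs V \ E) (fun _ ↦ False) := by
        refine bernoulliProb_mono hp0.le hp1 fun B hB h ↦ hreg ⟨?_, fun w hw ↦ ?_⟩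
        · refine le_trans (le_of_eq (sum_congr rfl fun w hw ↦ ?_)) h.1
          have : ({b ∈ S | s(b, w) ∈ A ∪ B} : Finset V) = {b ∈ S | s(b, w) ∈ A} :=
            filter_congr fun b hb ↦ hAB B hB b hb w hw
          rw [this]
        · refine le_trans (Nat.cast_le.2 (card_le_card fun b hb ↦ ?_)) (h.2.1 w)
          simp only [mem_filter, mem_univ, true_and] at hb ⊢
          rw [Sym2.eq_swap]
          exact mem_union_left _ hb.2
      refine this.trans ?_
      simp only [bernoulliProb, if_false, bernoulliExp_const]
      positivity
  refine (bernoulliExp_mono hp0.le hp1 hmain).trans ?_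
  rw [bernoulliExp_const]

end TransversalCliques

/-! ### Choice of the clique size -/

section CliqueSize

variable {p L : ℝ} {r m : ℕ}

/-- With `κ = 4 r m L`, the hypothesis makes each of the fewer than `r` terms at most `1 / r`. -/
lemma sum_choose_div_le (hp : 0 < p) (hr : 0 < r) (hm : 0 < m)
    (h : ∀ j ∈ Icc 2 r, 16 * (r : ℝ) ^ 2 * L * r.choose j ≤ (m : ℝ) ^ (j - 1) * p ^ j.choose 2) :
    4 * (4 * (r * m) * L) * ∑ j ∈ Icc 2 r, (r.choose j : ℝ) / ((m : ℝ) ^ j * p ^ j.choose 2) ≤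
      1 := by
  have hm' : (0 : ℝ) < m := by exact_mod_cast hm
  have hr' : (0 : ℝ) < r := by exact_mod_cast hr
  rw [mul_sum]
  have h1 : ∀ j ∈ Icc 2 r, 4 * (4 * (r * m) * L) *
      ((r.choose j : ℝ) / ((m : ℝ) ^ j * p ^ j.choose 2)) ≤ 1 / r := by
    intro j hj
    have hj1 : j = j - 1 + 1 := by have := (mem_Icc.1 hj).1; omega
    have h2 : (m : ℝ) ^ j = m ^ (j - 1) * m := by
      rw [← pow_succ, ← hj1]
    rw [h2, mul_div_assoc', div_le_div_iff₀ (by positivity) hr']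
    have h3 := mul_le_mul_of_nonneg_right (h j hj) hm'.le
    linarith
  refine (sum_le_sum h1).trans ?_
  rw [sum_const, nsmul_eq_mul, mul_one_div, div_le_one hr', Nat.card_Icc]
  exact_mod_cast (by omega)

/-- For `j = k + 1` the square of the right side is `(m ^ 2 * p ^ (k + 1)) ^ k`, and `p ^ (k + 1) ≥
p ^ r`. One condition on `m ^ 2 * p ^ r` therefore serves every overlap `j`. -/
lemma le_pow_mul_pow_of_sq_le (hp : 0 < p) (hp1 : p ≤ 1) (hL : 1 ≤ L) (hr : 1 ≤ r)
    (h : (16 * (r : ℝ) ^ 4 * L) ^ 2 ≤ (m : ℝ) ^ 2 * p ^ r) :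
    ∀ j ∈ Icc 2 r, 16 * (r : ℝ) ^ 2 * L * r.choose j ≤ (m : ℝ) ^ (j - 1) * p ^ j.choose 2 := by
  intro j hj
  obtain ⟨hj2, hjr⟩ := mem_Icc.1 hj
  obtain ⟨k, rfl⟩ := Nat.exists_eq_add_of_le' (show 1 ≤ j by omega)
  have hk : 1 ≤ k := by omega
  have hr' : (1 : ℝ) ≤ r := by exact_mod_cast hr
  rw [Nat.add_sub_cancel]
  have h1 : 16 * (r : ℝ) ^ 2 * L * r.choose (k + 1) ≤ (16 * (r : ℝ) ^ 4 * L) ^ k := by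
    have h2 : (r.choose (k + 1) : ℝ) ≤ (r : ℝ) ^ (2 * k) := by
      calc (r.choose (k + 1) : ℝ) ≤ (r : ℝ) ^ (k + 1) := by
            exact_mod_cast Nat.choose_le_pow r (k + 1)
        _ ≤ _ := pow_le_pow_right₀ hr' (by omega)
    have h3 : 1 ≤ 16 * (r : ℝ) ^ 2 * L := by
      have := one_le_pow₀ hr' (n := 2)
      nlinarith
    calc 16 * (r : ℝ) ^ 2 * L * r.choose (k + 1) ≤ (16 * (r : ℝ) ^ 2 * L) ^ k * r ^ (2 * k) := by
          gcongr
          exact le_self_pow₀ h3 (by omega)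
      _ = _ := by rw [pow_mul, ← mul_pow]; ring
  refine h1.trans ?_
  rw [← pow_le_pow_iff_left₀ (by positivity) (by positivity) two_ne_zero]
  have hch : (k + 1).choose 2 * 2 = (k + 1) * k := by
    rw [Nat.choose_two_right, Nat.div_mul_cancel (Nat.even_mul_pred_self (k + 1)).two_dvd]
    simp
  calc ((16 * (r : ℝ) ^ 4 * L) ^ k) ^ 2 = ((16 * (r : ℝ) ^ 4 * L) ^ 2) ^ k := by
        rw [← pow_mul, ← pow_mul, mul_comm k]
    _ ≤ ((m : ℝ) ^ 2 * p ^ r) ^ k := by gcongr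
    _ = ((m : ℝ) ^ k) ^ 2 * p ^ (r * k) := by rw [mul_pow, ← pow_mul, ← pow_mul, ← pow_mul,
        mul_comm k 2]
    _ ≤ ((m : ℝ) ^ k) ^ 2 * p ^ ((k + 1) * k) := by
        gcongr ?_ * ?_
        exact pow_le_pow_of_le_one hp.le hp1 (Nat.mul_le_mul_right k hjr)
    _ = _ := by rw [mul_pow, ← pow_mul p, hch]

end CliqueSize

/-- The smallest size of cliques that typically have no common neighbour, but at least three. -/
lemma exists_clique_size : ∀ᶠ n : ℕ in atTop, ∀ p : ℝ, 0 < p → p * Real.log n ≤ 1 →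
    ∃ r : ℕ, 3 ≤ r ∧ (r : ℝ) ≤ Real.log n ∧ n * (Real.exp 2 * p) ^ r ≤ 1 / 4 ∧
      (r = 3 ∨ r = 4 ∧ 1 / 2916 ≤ n * p ^ 3 ∨
        256 * Real.log n ^ 10 ≤ (n : ℝ) ^ 2 * p ^ (r + 2)) := by
  filter_upwards [eventually_ge_atTop 1, eventually_le_log 1000,
    eventually_le_log (Real.exp 102),
    eventually_mul_log_pow_le (256 ^ 4 * 4 ^ 7) 40 (show (0 : ℝ) < 1 / 2 by norm_num)]
    with n hn hL hLe hpow p hp0 hpL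
  have hn0 : (0 : ℝ) < n := by exact_mod_cast hn
  set L := Real.log n with hLdef
  set y := Real.exp 2 * p with hy
  have hy0 : 0 < y := by positivity
  have hnL : (n : ℝ) = Real.exp L := (Real.exp_log hn0).symm
  -- Of the exponent 102, the part 2 absorbs the factor `e²` in `y`. The bound forces `r` to be at
  -- most about `L / 100`, so that powers `e^{O(r)}` cost only a small power of `n`.
  have hye : y ≤ Real.exp (-100) := by
    have h1 : p * Real.exp 102 ≤ 1 := le_trans (by gcongr) hpL
    have h2 : Real.exp 102 * Real.exp (-100) = Real.exp 2 := by
      rw [← Real.exp_add]; norm_num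
    calc y = p * Real.exp 102 * Real.exp (-100) := by rw [mul_assoc, h2, hy, mul_comm]
      _ ≤ 1 * Real.exp (-100) := by gcongr
      _ = _ := one_mul _
  have hy1 : y ≤ 1 := hye.trans (Real.exp_le_one_iff.2 (by norm_num))
  have hfour : Real.exp (-2) ≤ 1 / 4 := by
    rw [Real.exp_neg, ← one_div, one_div_le_one_div (Real.exp_pos _) (by norm_num)]
    have := Real.exp_one_gt_d9
    calc (4 : ℝ) = 2 ^ 2 := by norm_num
      _ ≤ Real.exp 1 ^ 2 := by gcongr; linarith
      _ = Real.exp 2 := by rw [← Real.exp_nat_mul]; norm_num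
  have hyk : ∀ k : ℕ, y ^ k ≤ Real.exp (-(100 * k)) := fun k ↦ by
    calc y ^ k ≤ Real.exp (-100) ^ k := by gcongr
      _ = _ := by rw [← Real.exp_nat_mul]; congr 1; ring
  have hex : ∃ k : ℕ, n * y ^ k ≤ 1 / 4 := by
    obtain ⟨k, hk⟩ := exists_nat_ge ((L + 2) / 100)
    refine ⟨k, le_trans ?_ hfour⟩
    calc n * y ^ k ≤ Real.exp L * Real.exp (-(100 * k)) := by
          rw [← hnL]
          gcongr
          exact hyk k
      _ = Real.exp (L - 100 * k) := by rw [← Real.exp_add]; rfl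
      _ ≤ _ := by
          gcongr
          rw [div_le_iff₀ (by norm_num)] at hk
          linarith
  have hspec := Nat.find_spec hex
  have hmin : ∀ k, k < Nat.find hex → 1 / 4 < n * y ^ k := fun k hk ↦
    not_le.1 (Nat.find_min hex hk)
  set r₀ := Nat.find hex with hr₀
  clear_value r₀
  rcases le_or_gt r₀ 3 with h3 | h3
  · refine ⟨3, le_rfl, ?_, le_trans ?_ hspec, Or.inl rfl⟩
    · norm_num
      linarith
    · gcongr n * ?_
      exact pow_le_pow_of_le_one hy0.le hy1 h3
  obtain ⟨k, rfl⟩ := Nat.exists_eq_add_of_lt h3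
  have hmin' := hmin (k + 3) (by omega)
  have hrk : 100 * ((k : ℝ) + 3) ≤ L + 2 := by
    by_contra! hlt
    have h1 : n * y ^ (k + 3) ≤ Real.exp (-2) := by
      calc n * y ^ (k + 3) ≤ Real.exp L * Real.exp (-(100 * ((k + 3 : ℕ) : ℝ))) := by
            rw [← hnL]
            gcongr
            exact hyk (k + 3)
        _ = Real.exp (L - 100 * (k + 3)) := by rw [← Real.exp_add]; push_cast; rfl
        _ ≤ _ := by
            gcongr
            linarith
    linarith
  refine ⟨3 + k + 1, by omega, by push_cast; linarith, hspec, Or.inr ?_⟩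
  rcases Nat.eq_zero_or_pos k with rfl | hk
  · refine Or.inl ⟨rfl, ?_⟩
    have h1 : n * y ^ 3 = Real.exp 2 ^ 3 * (n * p ^ 3) := by rw [hy]; ring
    rw [zero_add, h1] at hmin'
    have h2 : Real.exp 2 ^ 3 * (n * p ^ 3) ≤ 9 ^ 3 * (n * p ^ 3) := by
      gcongr
      exact exp_two_le
    linarith
  · right
    have hy4 : 1 / 4 ≤ n * y ^ 4 := by
      refine hmin'.le.trans ?_
      gcongr n * ?_
      exact pow_le_pow_of_le_one hy0.le hy1 (by omega)
    have hsqrt : (n : ℝ) ^ (1 / 2 : ℝ) = Real.exp (L / 2) := by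
      rw [Real.rpow_def_of_pos hn0]
      congr 1
      ring
    -- Minimality of `r` gives `n y^{r-1} > 1/4` and, since `r ≥ 5`, also `n y^4 ≥ 1/4`. Four
    -- factors of the first and three of the second yield the fourth power of `n² y^{r+2}`, with one
    -- factor `n` to spare.
    have hpow1 : (n : ℝ) ^ 8 * y ^ (4 * (k + 6)) ≥ n * (1 / 4) ^ 7 := by
      have h6 : (1 / 4 : ℝ) ^ 4 * ((1 / 4) ^ 3 * n) ≤
          (n * y ^ (k + 3)) ^ 4 * ((n * y ^ 4) ^ 3 * n) := by gcongr
      have h7 : (n : ℝ) ^ 8 * y ^ (4 * (k + 6)) =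
          (n * y ^ (k + 3)) ^ 4 * ((n * y ^ 4) ^ 3 * n) := by ring
      rw [h7]
      linarith
    have hyp : y ^ (4 * (k + 6)) ≤ Real.exp (L / 2) * p ^ (4 * (k + 6)) := by
      rw [hy, mul_pow, ← Real.exp_nat_mul]
      gcongr
      push_cast
      linarith
    have hnn : (n : ℝ) = Real.exp (L / 2) * Real.exp (L / 2) := by
      rw [← Real.exp_add, add_halves, hnL]
    have h5 : (256 * L ^ 10) ^ 4 ≤ ((n : ℝ) ^ 2 * p ^ (3 + k + 1 + 2)) ^ 4 := by
      have h6 : Real.exp (L / 2) * (256 ^ 4 * L ^ 40) ≤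
          Real.exp (L / 2) * ((n : ℝ) ^ 8 * p ^ (4 * (k + 6))) := by
        calc Real.exp (L / 2) * (256 ^ 4 * L ^ 40) =
              Real.exp (L / 2) * (256 ^ 4 * 4 ^ 7 * L ^ 40) * (1 / 4) ^ 7 := by ring
          _ ≤ Real.exp (L / 2) * Real.exp (L / 2) * (1 / 4) ^ 7 := by
              rw [hsqrt] at hpow
              gcongr
          _ = n * (1 / 4) ^ 7 := by rw [hnn]
          _ ≤ (n : ℝ) ^ 8 * y ^ (4 * (k + 6)) := hpow1
          _ ≤ (n : ℝ) ^ 8 * (Real.exp (L / 2) * p ^ (4 * (k + 6))) := by gcongr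
          _ = _ := by ring
      have h7 := le_of_mul_le_mul_left h6 (Real.exp_pos _)
      calc (256 * L ^ 10) ^ 4 = 256 ^ 4 * L ^ 40 := by ring
        _ ≤ (n : ℝ) ^ 8 * p ^ (4 * (k + 6)) := h7
        _ = _ := by ring
    exact (pow_le_pow_iff_left₀ (by positivity) (by positivity) (by norm_num)).1 h5

/-! ### Dense lower bound -/

/-- Typical sets of this size, up to a constant factor, contain maximal cliques when `n * p ^ 2` is
large. -/
noncomputable def denseScale (n : ℕ) (p : ℝ) : ℝ :=
  10 ^ 8 * max (√(Real.log n) / (p * √p)) (n * p * Real.log n)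

-- The first term of the scale ensures that a set of `s` vertices expects at least of order `s L`
-- triangles, enough for the union bound over sets. The second makes the set larger than any
-- neighbourhood by a factor of order `L`, so that heavy vertices cover few transversals.
set_option maxHeartbeats 1000000 in
lemma lt_cliqueChromaticNumber_dense_whp : ∀ᶠ n : ℕ in atTop, ∀ p : ℝ, 0 < p → p ≤ 1 →
    1 ≤ n * p ^ 2 → p * Real.log n ≤ 1 →
    bernoulliProb p (vertexPairs (Fin n)) (fun A ↦ ¬ n / (2 * denseScale n p) ≤
      (cliqueChromaticNumber (SimpleGraph.fromEdgeSet (A : Set (Sym2 (Fin n)))) : ℝ)) ≤ 5 / n := by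
  filter_upwards [eventually_ge_atTop 1, eventually_le_log 1, exists_clique_size, degree_whp]
    with n hn hL hsize hdegree p hp0 hp1 hx hpL
  have hn0 : (0 : ℝ) < n := by exact_mod_cast hn
  have : Nonempty (Fin n) := ⟨⟨0, hn⟩⟩
  obtain ⟨r, hr3, hrL, hnr, hr⟩ := hsize p hp0 hpL
  have hdeg := hdegree p hp0.le hp1
  set L := Real.log n with hLdef
  set s := denseScale n p with hs
  have hr3' : (3 : ℝ) ≤ r := by exact_mod_cast hr3
  have hr0 : (0 : ℝ) < r := by linarith
  have hs1 : 10 ^ 8 * (√L / (p * √p)) ≤ s := by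
    rw [hs, denseScale]
    gcongr
    exact le_max_left _ _
  have hs2 : 10 ^ 8 * (n * p * L) ≤ s := by
    rw [hs, denseScale]
    gcongr
    exact le_max_right _ _
  have hnpL : L ≤ n * p := by
    have : p * L * (n * p) ≤ 1 * (n * p) := by gcongr
    nlinarith
  have hsL : 10 ^ 8 * L ^ 2 ≤ s := by
    refine le_trans ?_ hs2
    rw [pow_two]
    gcongr
  have hLs : L ≤ s := by nlinarith
  have hs0 : 0 < s := by linarith
  set m := ⌈s / r⌉₊ with hm
  have hm1 : s / r ≤ m := Nat.le_ceil _
  have hrm1 : s ≤ r * m := by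
    rw [div_le_iff₀ hr0] at hm1
    linarith
  have hrm2 : r * m ≤ 2 * s := by
    have h1 : (m : ℝ) ≤ s / r + 1 := (Nat.ceil_lt_add_one (by positivity)).le
    have h2 : r * m ≤ r * (s / r + 1) := by gcongr
    rw [mul_add, mul_div_cancel₀ _ hr0.ne'] at h2
    linarith
  have hm0 : (0 : ℝ) < m := lt_of_lt_of_le (by positivity) hm1
  have hm0' : 0 < m := by exact_mod_cast hm0
  have hprm : L ≤ p * (r * m) := by
    have h1 : p * (10 ^ 8 * (n * p * L)) ≤ p * (r * m) :=
      mul_le_mul_of_nonneg_left (hs2.trans hrm1) hp0.le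
    refine le_trans ?_ h1
    have h2 : L * 1 ≤ L * (n * p ^ 2) := by gcongr
    nlinarith
  -- The largest fraction of the set that can lie in one neighbourhood; the degree bound `2np + 2L`
  -- is at most `4np` because `L ≤ np`.
  set ε : ℝ := 4 * (n * p) / (r * m) with hε
  have hεrm : ε * (r * m) = 4 * (n * p) := by
    rw [hε]
    field_simp
  have hε1 : ε ≤ 1 / (4 * L) := by
    rw [hε, div_le_div_iff₀ (by positivity) (by positivity)]
    nlinarith
  have hε0 : 0 ≤ ε := by positivity
  have hcov : Fintype.card (Fin n) * (Real.exp 2 * p) ^ r +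
      ε ^ (r - 1) * (4 * (r * m) * L / (r * m)) ≤ 1 / 2 := by
    rw [Fintype.card_fin]
    have h1 : 4 * (r * m) * L / (r * m) = 4 * L := by field_simp
    have h2 : ε ^ (r - 1) ≤ (1 / (4 * L)) ^ 2 := by
      have h3 : 1 / (4 * L) ≤ 1 := by
        rw [div_le_one (by positivity)]
        linarith
      calc ε ^ (r - 1) ≤ ε ^ 2 := pow_le_pow_of_le_one hε0 (hε1.trans h3) (by omega)
        _ ≤ _ := by gcongr
    have h4 : ε ^ (r - 1) * (4 * L) ≤ (1 / (4 * L)) ^ 2 * (4 * L) := by gcongr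
    have h5 : (1 / (4 * L)) ^ 2 * (4 * L) = 1 / (4 * L) := by field_simp
    have h6 : 1 / (4 * L) ≤ 1 / 4 := by
      gcongr
      linarith
    rw [h1]
    linarith
  have hsum : 4 * (4 * (r * m) * L) * ∑ j ∈ Icc 2 r,
      (r.choose j : ℝ) / ((m : ℝ) ^ j * p ^ j.choose 2) ≤ 1 := by
    refine sum_choose_div_le hp0 (by omega) hm0' ?_
    -- For `r = 3` the term `√L / p^{3/2}` of the scale is what is needed. For `r = 4` the term
    -- `npL` together with `np³ ≥ 1/2916` suffices. Otherwise `m ≥ np` is enough.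
    rcases hr with rfl | ⟨rfl, hr⟩ | hr
    · have hsp : 0 < √p := Real.sqrt_pos.2 hp0
      have hspp : √p * √p = p := Real.mul_self_sqrt hp0.le
      have hsLL : √L * √L = L := Real.mul_self_sqrt (by linarith)
      have hmp : 10 ^ 7 * √L ≤ m * (p * √p) := by
        have h1 : 10 ^ 8 * (√L / (p * √p)) * (p * √p) ≤ 3 * m * (p * √p) := by
          push_cast at hrm1
          exact mul_le_mul_of_nonneg_right (hs1.trans hrm1) (by positivity)
        have h2 : √L / (p * √p) * (p * √p) = √L := by field_simp
        have h3 : 0 ≤ √L := Real.sqrt_nonneg _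
        nlinarith
      have hspL : √p * √L ≤ 1 := by
        rw [← Real.sqrt_mul hp0.le, Real.sqrt_le_one]
        exact hpL
      have hmp2 : 10 ^ 7 * L ≤ m * p := by
        have h1 : 10 ^ 7 * √L * √L ≤ m * (p * √p) * √L := by gcongr
        have h2 : m * p * (√p * √L) ≤ m * p * 1 := by gcongr
        nlinarith
      intro j hj
      obtain ⟨h1, h2⟩ := mem_Icc.1 hj
      interval_cases j
      · norm_num [Nat.choose]
        linarith
      · have h3 : (10 ^ 7 * √L) ^ 2 ≤ (m * (p * √p)) ^ 2 := by gcongr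
        have h4 : (10 ^ 7 * √L) ^ 2 = 10 ^ 14 * L := by rw [mul_pow, pow_two √L, hsLL]; norm_num
        have h5 : (m * (p * √p)) ^ 2 = m ^ 2 * p ^ 3 := by
          rw [mul_pow, mul_pow, pow_two √p, hspp]; ring
        norm_num [Nat.choose]
        linarith
    · refine le_pow_mul_pow_of_sq_le hp0 hp1 hL (by norm_num) ?_
      have h1 : 25 * 10 ^ 6 * (n * p * L) ≤ m := by
        push_cast at hrm1
        linarith
      calc (16 * ((4 : ℕ) : ℝ) ^ 4 * L) ^ 2 ≤
            ((25 * 10 ^ 6) * L) ^ 2 * (1 / 2916) ^ 2 := by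
            push_cast
            nlinarith [sq_nonneg L]
        _ ≤ ((25 * 10 ^ 6) * L) ^ 2 * (n * p ^ 3) ^ 2 := by gcongr
        _ = (25 * 10 ^ 6 * (n * p * L)) ^ 2 * p ^ 4 := by ring
        _ ≤ (m : ℝ) ^ 2 * p ^ 4 := by gcongr
    · refine le_pow_mul_pow_of_sq_le hp0 hp1 hL (by omega) ?_
      have h1 : n * p ≤ m := by
        have h2 : r * (n * p) ≤ r * m := by
          refine le_trans ?_ hrm1
          refine le_trans ?_ hs2
          have h3 : r * (n * p) ≤ L * (n * p) := by gcongr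
          have h4 : 0 ≤ L * (n * p) := by positivity
          linarith
        exact le_of_mul_le_mul_left h2 hr0
      calc (16 * (r : ℝ) ^ 4 * L) ^ 2 ≤ (16 * L ^ 4 * L) ^ 2 := by gcongr
        _ = 256 * L ^ 10 := by ring
        _ ≤ (n : ℝ) ^ 2 * p ^ (r + 2) := hr
        _ = (n * p) ^ 2 * p ^ r := by ring
        _ ≤ (m : ℝ) ^ 2 * p ^ r := by gcongr
  have hβ : ∀ φ : Fin r × Fin m ↪ Fin n, bernoulliProb p (vertexPairs (Fin n))
      (fun A ↦ (∀ v, (#{u | s(v, u) ∈ A} : ℝ) ≤ ε * (r * m)) ∧ TransversalsCovered φ A) ≤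
      4 * Real.exp (-(4 * (r * m) * L)) := by
    intro φ
    refine (bernoulliProb_transversal_cliques_covered_le hp0 hp1 (by omega) hm0' φ hε0
      (by positivity) hcov hsum).trans ?_
    rw [Fintype.card_fin]
    have h1 := mul_le_mul_of_nonneg_left (one_add_exp_neg_pow_le hn hprm)
      (Real.exp_nonneg (-(4 * (r * m) * L)))
    linarith
  have h := bernoulliProb_not_lt_cliqueChromaticNumber_mul_le (V := Fin n) hp0.le hp1 (by omega) _
    (by positivity) hβ
  rw [Fintype.card_fin] at h
  refine (bernoulliProb_mono hp0.le hp1 fun A _ hA ↦ ?_).trans (h.trans ?_)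
  · intro hlt
    refine hA ?_
    have h1 : (n : ℝ) ≤ cliqueChromaticNumber (SimpleGraph.fromEdgeSet (A : Set (Sym2 (Fin n)))) *
        (r * m) := by exact_mod_cast hlt.le
    set χ := (cliqueChromaticNumber (SimpleGraph.fromEdgeSet (A : Set (Sym2 (Fin n)))) : ℝ)
    rw [div_le_iff₀ (by positivity)]
    exact h1.trans (by gcongr)
  · have h1 : (n : ℝ) ^ (r * m) = Real.exp (r * m * L) := by
      rw [← Real.exp_log (pow_pos hn0 _), Real.log_pow]
      push_cast
      rfl
    have h2 : (n : ℝ) ^ (r * m) * (4 * Real.exp (-(4 * (r * m) * L))) ≤ 4 / n := by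
      rw [h1, mul_left_comm, ← Real.exp_add, div_eq_mul_inv]
      gcongr
      calc Real.exp (r * m * L + -(4 * (r * m) * L)) ≤ Real.exp (-L) := by
            gcongr
            nlinarith
        _ = _ := by rw [Real.exp_neg, hLdef, Real.exp_log hn0]
    have h3 : bernoulliProb p (vertexPairs (Fin n))
        (fun A ↦ ¬ ∀ v, (#{u | s(v, u) ∈ A} : ℝ) ≤ ε * (r * m)) ≤ 1 / n := by
      refine (bernoulliProb_mono hp0.le hp1 fun A _ h ↦ ?_).trans hdeg
      push Not at h
      obtain ⟨v, hv⟩ := h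
      exact ⟨v, by linarith⟩
    have h4 : (5 : ℝ) / n = 1 / n + 4 / n := by ring
    linarith

/-! ### Combination of the bounds -/

/-- The typical order of magnitude of the clique chromatic number of the binomial random graph, up
to logarithmic factors. -/
noncomputable def cliqueChromaticScale (n : ℕ) (p : ℝ) : ℝ :=
  max 1 (max (Real.exp (-(n * p ^ 2)) * (n * p) / Real.log n)
    (min (p ^ (3 / 2 : ℝ) * n / √(Real.log n)) (1 / p)))

lemma bernoulliProb_not_le_of_forall {E : Type*} [DecidableEq E] {p : ℝ} {s : Finset E}
    {P : Finset E → Prop} (h : ∀ A, P A) {c : ℝ} (hc : 0 ≤ c) :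
    bernoulliProb p s (fun A ↦ ¬ P A) ≤ c := by
  simpa [bernoulliProb, h, bernoulliExp_const] using hc

lemma rpow_three_halves {p : ℝ} (hp : 0 ≤ p) : p ^ (3 / 2 : ℝ) = p * √p := by
  rw [show (3 / 2 : ℝ) = 1 + 1 / 2 by norm_num, Real.rpow_add_of_nonneg hp (by norm_num)
    (by norm_num), Real.rpow_one, Real.sqrt_eq_rpow]

lemma cliqueChromaticNumber_le_mul_scale_whp : ∀ᶠ n : ℕ in atTop, ∀ p : ℝ, 0 ≤ p → p ≤ 1 →
    bernoulliProb p (vertexPairs (Fin n)) (fun A ↦ ¬ (cliqueChromaticNumber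
      (SimpleGraph.fromEdgeSet (A : Set (Sym2 (Fin n)))) : ℝ) ≤
        (16 * Real.exp 100 + 31) * Real.log n * cliqueChromaticScale n p) ≤ 11 / n := by
  filter_upwards [cliqueChromaticNumber_sparse_whp, cliqueChromaticNumber_dominating_whp,
    eventually_le_log 1] with n hsparse hdom hL p hp0 hp1
  set L := Real.log n with hLdef
  set f := cliqueChromaticScale n p with hf
  have hf1 : 1 ≤ f := le_max_left _ _
  have hf2 : Real.exp (-(n * p ^ 2)) * (n * p) / L ≤ f :=
    (le_max_left _ _).trans (le_max_right _ _)
  have hf3 : min (p * √p * n / √L) (1 / p) ≤ f := by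
    rw [hf, cliqueChromaticScale, rpow_three_halves hp0]
    exact (le_max_right _ _).trans (le_max_right _ _)
  have hLf : L ≤ L * f := le_mul_of_one_le_right (by linarith) hf1
  rcases le_or_gt (p * √p * n / √L) (1 / p) with h | h
  · rw [min_eq_left h] at hf3
    have hscale : sparseScale n p ≤ L * f := by
      refine max_le hLf (max_le ?_ ?_)
      · rwa [div_le_iff₀' (by linarith)] at hf2
      · calc p * √p * n * √L = L * (p * √p * n / √L) := by
              rw [mul_div_left_comm, Real.div_sqrt]
          _ ≤ _ := by gcongr
    refine (bernoulliProb_mono hp0 hp1 fun A _ hA hle ↦ hA (hle.trans ?_)).trans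
      (hsparse p hp0 hp1)
    rw [mul_assoc]
    gcongr
  · rw [min_eq_right h.le] at hf3
    -- For `p = 0` both terms of the minimum are 0, as `1 / 0 = 0`, so the strict inequality `h`
    -- excludes this case.
    rcases hp0.eq_or_lt with rfl | hp0'
    · simp at h
    refine (bernoulliProb_mono hp0 hp1 fun A _ hA hle ↦ hA (hle.trans ?_)).trans
      ((hdom p hp0' hp1).trans (by gcongr; norm_num))
    calc 3 * L / p + 1 = 3 * (L * (1 / p)) + 1 := by ring
      _ ≤ 3 * (L * f) + L * f := by
          gcongr
          linarith
      _ = 4 * (L * f) := by ring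
      _ ≤ (16 * Real.exp 100 + 31) * (L * f) := by
          gcongr
          linarith [Real.exp_pos 100]
      _ = _ := by ring

/-- Scales of order `L` are matched by the trivial bound of one colour. For `x < 1` the minimum is
dominated by the exponential term, so the sparse bound suffices. For `x ≥ 1` the dense bound handles
the minimum, and the exponential term is handled by whichever of the two bounds applies. -/
lemma scale_le_mul_cliqueChromaticNumber_whp : ∀ᶠ n : ℕ in atTop, ∀ p : ℝ, 0 ≤ p → p ≤ 1 →
    bernoulliProb p (vertexPairs (Fin n)) (fun A ↦ ¬ cliqueChromaticScale n p ≤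
      2 * 10 ^ 12 * Real.log n * (cliqueChromaticNumber
        (SimpleGraph.fromEdgeSet (A : Set (Sym2 (Fin n)))) : ℝ)) ≤ 12 / n := by
  filter_upwards [lt_cliqueChromaticNumber_sparse_whp, lt_cliqueChromaticNumber_dense_whp,
    eventually_ge_atTop 1, eventually_le_log 1,
    eventually_mul_log_pow_le (9 * 10 ^ 8) 3 (show (0 : ℝ) < 1 / 2 by norm_num)]
    with n hsparse hdense hn hL hlog p hp0 hp1
  have hn0 : (0 : ℝ) < n := by exact_mod_cast hn
  have : Nonempty (Fin n) := ⟨⟨0, hn⟩⟩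
  set L := Real.log n with hLdef
  set x : ℝ := n * p ^ 2 with hx
  have hx0 : 0 ≤ x := by positivity
  have hL0 : 0 < L := by linarith
  have hsL0 : 0 < √L := Real.sqrt_pos.2 hL0
  set T := Real.exp (-x) * (n * p) / L with hT
  set M := min (p * √p * n / √L) (1 / p) with hM
  have hT0 : 0 ≤ T := by positivity
  have hscale : ∀ {b : ℝ}, 1 ≤ b → T ≤ b → M ≤ b → cliqueChromaticScale n p ≤ b := by
    intro b h1 h2 h3
    rw [cliqueChromaticScale, rpow_three_halves hp0]
    exact max_le h1 (max_le h2 h3)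
  have hone : ∀ A : Finset (Sym2 (Fin n)), 1 ≤ (cliqueChromaticNumber
      (SimpleGraph.fromEdgeSet (A : Set (Sym2 (Fin n)))) : ℝ) := fun A ↦ by
    exact_mod_cast one_le_cliqueChromaticNumber
  have htriv : cliqueChromaticScale n p ≤ 3 * L → bernoulliProb p (vertexPairs (Fin n))
      (fun A ↦ ¬ cliqueChromaticScale n p ≤ 2 * 10 ^ 12 * L * (cliqueChromaticNumber
        (SimpleGraph.fromEdgeSet (A : Set (Sym2 (Fin n)))) : ℝ)) ≤ 12 / n := by
    intro h
    refine bernoulliProb_not_le_of_forall (fun A ↦ h.trans ?_) (by positivity)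
    have := mul_le_mul_of_nonneg_left (hone A) hL0.le
    linarith
  have hxT : x * Real.exp (-x) ≤ 1 := by
    have h1 := Real.add_one_le_exp x
    have h2 : Real.exp x * Real.exp (-x) = 1 := by rw [← Real.exp_add]; simp
    nlinarith [Real.exp_pos (-x)]
  have hTp : 0 < p → T ≤ 1 / (p * L) := by
    intro hp
    have h1 : T = x * Real.exp (-x) / (p * L) := by
      rw [hT, hx]
      field_simp
    rw [h1]
    gcongr
  have hTsparse : L < T → Real.exp (2 * x) * p * L ^ 3 ≤ 1 / 10 ^ 8 →
      bernoulliProb p (vertexPairs (Fin n)) (fun A ↦ ¬ T ≤ 300 * (cliqueChromaticNumber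
        (SimpleGraph.fromEdgeSet (A : Set (Sym2 (Fin n)))) : ℝ)) ≤ 7 / n := by
    intro h1 h2
    rw [hT, lt_div_iff₀ hL0] at h1
    refine (bernoulliProb_mono hp0 hp1 fun A _ hA hle ↦ hA ?_).trans
      (hsparse p hp0 hp1 (by linarith) h2)
    calc T = 300 * (Real.exp (-x) * (n * p) / (300 * L)) := by rw [hT]; field_simp
      _ ≤ _ := by gcongr
  rcases lt_or_ge 1 (p * L) with hpL | hpL
  · have hp : 0 < p := pos_of_mul_pos_left (by linarith) hL0.le
    refine htriv (hscale (by linarith) ((hTp hp).trans ?_) ((min_le_right _ _).trans ?_))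
    · rw [div_le_iff₀ (by positivity)]
      nlinarith
    · rw [div_le_iff₀ hp]
      linarith
  rcases lt_or_ge x 1 with hx1 | hx1
  · have hM3 : M ≤ 3 * T := by
      refine (min_le_left _ _).trans ?_
      have h1 : 1 ≤ 3 * Real.exp (-x) := by
        have h2 : Real.exp x * Real.exp (-x) = 1 := by rw [← Real.exp_add]; simp
        have h3 : Real.exp x ≤ 3 := (Real.exp_le_exp.2 hx1.le).trans Real.exp_one_lt_three.le
        nlinarith [Real.exp_pos (-x)]
      have h4 : √p * √L ≤ 1 := by
        rw [← Real.sqrt_mul hp0, Real.sqrt_le_one]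
        exact hpL
      calc p * √p * n / √L = n * p / L * (√p * √L) := by
            rw [div_eq_div_iff hsL0.ne' hL0.ne' |>.2 (show p * √p * n * L =
              (p * √p * n * √L) * √L by rw [mul_assoc _ √L, Real.mul_self_sqrt hL0.le])]
            ring
        _ ≤ n * p / L * (3 * Real.exp (-x)) := by
            refine mul_le_mul_of_nonneg_left (by linarith) (by positivity)
        _ = 3 * T := by rw [hT]; ring
    rcases le_or_gt T L with hTL | hTL
    · exact htriv (hscale (by linarith) (by linarith) (by linarith))
    · have hpn : p * L ^ 3 ≤ 1 / (9 * 10 ^ 8) := by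
        have h1 : p * (n : ℝ) ^ (1 / 2 : ℝ) ≤ 1 := by
          rw [← Real.sqrt_eq_rpow]
          have h2 : (p * √n) ^ 2 ≤ 1 := by
            rw [mul_pow, Real.sq_sqrt hn0.le, mul_comm]
            exact hx1.le
          exact (sq_le_one_iff₀ (by positivity)).1 h2
        have h2 := mul_le_mul_of_nonneg_left hlog hp0
        linarith
      have he : Real.exp (2 * x) ≤ 9 := (Real.exp_le_exp.2 (by linarith)).trans exp_two_le
      have h2 : Real.exp (2 * x) * p * L ^ 3 ≤ 1 / 10 ^ 8 := by
        calc Real.exp (2 * x) * p * L ^ 3 ≤ 9 * p * L ^ 3 := by gcongr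
          _ ≤ _ := by linarith
      refine (bernoulliProb_mono hp0 hp1 fun A _ hA hle ↦ hA ?_).trans
        ((hTsparse hTL h2).trans (by gcongr; norm_num))
      have h3 := hone A
      set χ := (cliqueChromaticNumber (SimpleGraph.fromEdgeSet (A : Set (Sym2 (Fin n)))) : ℝ)
      have h4 : χ ≤ L * χ := le_mul_of_one_le_left (by linarith) hL
      exact hscale (by linarith) (by linarith) (by linarith)
  · have hp : 0 < p := by
      refine lt_of_le_of_ne hp0 fun h ↦ ?_
      rw [hx, ← h] at hx1
      norm_num at hx1
    have hsp : 0 < √p := Real.sqrt_pos.2 hp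
    set Q := n / (2 * denseScale n p) with hQ
    -- Up to a constant, `Q` is `min (p^{3/2} n/√L) (1/(pL))`; the missing factor `L` in the second
    -- term is where a logarithm is lost.
    have hQ1 : ∀ {b : ℝ}, b ≤ p * √p * n / √L → b ≤ 1 / (p * L) → b ≤ 2 * 10 ^ 8 * Q := by
      intro b h1 h2
      have h3 : 2 * 10 ^ 8 * Q = n / max (√L / (p * √p)) (n * p * L) := by
        rw [hQ, denseScale, ← hLdef]
        field_simp
      rw [h3, le_div_iff₀ (lt_max_of_lt_right (by positivity))]
      rcases max_choice (√L / (p * √p)) (n * p * L) with h | h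
      · rw [h]
        calc b * (√L / (p * √p)) ≤ p * √p * n / √L * (√L / (p * √p)) := by gcongr
          _ = n := by field_simp
      · rw [h]
        calc b * (n * p * L) ≤ 1 / (p * L) * (n * p * L) := by gcongr
          _ = n := by field_simp
    have hMQ : M ≤ 2 * 10 ^ 8 * L * Q := by
      have h1 : M / L ≤ 2 * 10 ^ 8 * Q := by
        refine hQ1 ?_ ?_
        · refine (div_le_self (by positivity) hL).trans (min_le_left _ _)
        · rw [← div_div]
          gcongr
          exact min_le_right _ _
      rw [div_le_iff₀ hL0] at h1
      linarith
    -- The maximum with `Q` makes the claim deterministic when the sparse bound does not apply; the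
    -- dense bound later gives `Q ≤ χ`.
    have hmain : bernoulliProb p (vertexPairs (Fin n)) (fun A ↦ ¬ T ≤ 2 * 10 ^ 12 * L *
        max (cliqueChromaticNumber (SimpleGraph.fromEdgeSet (A : Set (Sym2 (Fin n)))) : ℝ) Q) ≤
        7 / n := by
      rcases le_or_gt T L with hTL | hTL
      · refine bernoulliProb_not_le_of_forall (fun A ↦ hTL.trans ?_) (by positivity)
        have := mul_le_mul_of_nonneg_left ((hone A).trans (le_max_left _ Q)) hL0.le
        linarith
      rcases le_or_gt (Real.exp (2 * x) * p * L ^ 3) (1 / 10 ^ 8) with h2 | h2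
      · refine (bernoulliProb_mono hp0 hp1 fun A _ hA hle ↦ hA (hle.trans ?_)).trans
          (hTsparse hTL h2)
        have h3 := le_max_left (cliqueChromaticNumber
          (SimpleGraph.fromEdgeSet (A : Set (Sym2 (Fin n)))) : ℝ) Q
        have h4 := hone A
        have := mul_le_mul hL h3 (by linarith) hL0.le
        linarith
      -- Failure of the sparse hypothesis bounds `exp (-x)`, hence `T` by `10^4 L` times the first
      -- term of the minimum. Multiplying by `2 * 10^8` from `hQ1` gives the constant `2 * 10^12`.
      · have h3 : Real.exp (-x) ≤ 10 ^ 4 * (√p * √L * L) := by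
          refine le_of_sq_le_sq ?_ (by positivity)
          have h4 : (10 ^ 4 * (√p * √L * L)) ^ 2 = 10 ^ 8 * (p * L ^ 3) := by
            rw [mul_pow, mul_pow, mul_pow, Real.sq_sqrt hp0, Real.sq_sqrt hL0.le]
            ring
          have h5 : Real.exp (-x) ^ 2 * Real.exp (2 * x) = 1 := by
            rw [← Real.exp_nat_mul, ← Real.exp_add]
            push_cast
            simp
          rw [h4]
          nlinarith [Real.exp_pos (2 * x), Real.exp_pos (-x), sq_nonneg (Real.exp (-x))]
        have h4 : T / (10 ^ 4 * L) ≤ 2 * 10 ^ 8 * Q := by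
          refine hQ1 ?_ ((div_le_self hT0 (by linarith)).trans (hTp hp))
          rw [div_le_iff₀ (by positivity)]
          calc T ≤ 10 ^ 4 * (√p * √L * L) * (n * p) / L := by rw [hT]; gcongr
            _ = p * √p * n / √L * (√L * √L * 10 ^ 4) := by field_simp
            _ = _ := by rw [Real.mul_self_sqrt hL0.le]; ring
        rw [div_le_iff₀ (by positivity)] at h4
        refine bernoulliProb_not_le_of_forall (fun A ↦ ?_) (by positivity)
        have := mul_le_mul_of_nonneg_left (le_max_right (cliqueChromaticNumber
          (SimpleGraph.fromEdgeSet (A : Set (Sym2 (Fin n)))) : ℝ) Q) hL0.le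
        linarith
    have hboth := (bernoulliProb_or_le (s := vertexPairs (Fin n)) hp0 hp1).trans
      (add_le_add hmain (hdense p hp hp1 hx1 hpL))
    refine (bernoulliProb_mono hp0 hp1 fun A _ hA ↦ ?_).trans (hboth.trans (le_of_eq (by ring)))
    by_contra! hcon
    have h3 := hone A
    set χ := (cliqueChromaticNumber (SimpleGraph.fromEdgeSet (A : Set (Sym2 (Fin n)))) : ℝ)
    rw [max_eq_left hcon.2] at hcon
    have h4 : χ ≤ L * χ := le_mul_of_one_le_left (by linarith) hL
    have h5 : L * Q ≤ L * χ := mul_le_mul_of_nonneg_left hcon.2 hL0.le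
    exact hA (hscale (by linarith) hcon.1 (by linarith))

theorem theorem2 :
    ∃ C : ℝ, 1 ≤ C ∧ ∀ p : ℕ → unitInterval,
      Tendsto
        (fun n : ℕ ↦ SimpleGraph.binomialRandom (Fin n) (p n)
          {G : SimpleGraph (Fin n) |
            (cliqueChromaticNumber G : ℝ) /
              max 1 (max
                (Real.exp (-((n : ℝ) * (p n : ℝ) ^ 2)) * ((n : ℝ) * (p n : ℝ)) / Real.log (n : ℝ))
                (min ((p n : ℝ) ^ (3 / 2 : ℝ) * (n : ℝ) / √(Real.log (n : ℝ))) (1 / (p n : ℝ))))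
              ∈ Set.Icc ((C * Real.log (n : ℝ))⁻¹) (C * Real.log (n : ℝ))})
        atTop (𝓝 1) := by
  set C : ℝ := 16 * Real.exp 100 + 2 * 10 ^ 12 with hC
  have he := Real.exp_pos 100
  refine ⟨C, by linarith, fun p ↦ ?_⟩
  -- The upper and lower bounds fail with probability at most `11 / n` and `12 / n`, whence 23.
  refine tendsto_of_tendsto_of_tendsto_of_le_of_le' (g := fun n : ℕ ↦ ENNReal.ofReal (1 - 23 / n))
    (h := fun _ ↦ 1) ?_ tendsto_const_nhds ?_ (Eventually.of_forall fun n ↦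
      MeasureTheory.prob_le_one)
  · have := (tendsto_const_div_atTop_nhds_zero_nat (23 : ℝ)).const_sub 1
    rw [sub_zero] at this
    simpa using ENNReal.tendsto_ofReal this
  filter_upwards [cliqueChromaticNumber_le_mul_scale_whp, scale_le_mul_cliqueChromaticNumber_whp,
    eventually_le_log 1] with n hup hlow hL
  have hp0 := (p n).2.1
  have hp1 := (p n).2.2
  refine ENNReal.ofReal_le_of_le_toReal ?_
  rw [← MeasureTheory.measureReal_def, binomialRandom_real_eq_bernoulliProb]
  change 1 - 23 / (n : ℝ) ≤ bernoulliProb (p n : ℝ) (vertexPairs (Fin n)) fun A ↦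
    (cliqueChromaticNumber (SimpleGraph.fromEdgeSet (A : Set (Sym2 (Fin n)))) : ℝ) /
      cliqueChromaticScale n (p n) ∈ Set.Icc ((C * Real.log n)⁻¹) (C * Real.log n)
  have hor := (bernoulliProb_or_le (s := vertexPairs (Fin n)) hp0 hp1).trans
    (add_le_add (hup _ hp0 hp1) (hlow _ hp0 hp1))
  have h23 : (23 : ℝ) / n = 11 / n + 12 / n := by ring
  rw [h23, sub_le_comm, ← bernoulliProb_not]
  refine (bernoulliProb_mono hp0 hp1 fun A _ hA ↦ ?_).trans hor
  by_contra! hcon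
  obtain ⟨h1, h2⟩ := hcon
  have hf1 : 1 ≤ cliqueChromaticScale n (p n) := le_max_left _ _
  set f := cliqueChromaticScale n (p n)
  set L := Real.log n
  have hL0 : 0 < L := by linarith
  refine hA ?_
  set χ := (cliqueChromaticNumber (SimpleGraph.fromEdgeSet (A : Set (Sym2 (Fin n)))) : ℝ) with hχ
  have hχ0 : 0 ≤ χ := Nat.cast_nonneg _
  constructor
  · rw [inv_eq_one_div, div_le_div_iff₀ (by positivity) (by positivity), one_mul]
    calc f ≤ 2 * 10 ^ 12 * L * χ := h2
      _ ≤ C * L * χ := by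
          gcongr
          linarith
      _ = _ := by ring
  · rw [div_le_iff₀ (by positivity)]
    refine h1.trans ?_
    gcongr
    linarith
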